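/- **Definitions.** Let $\omega\in\mathbb C$, and let $D(a,r)$ denote the open disc of centre $a$ and radius $r$. *Discrete filtered sets.* A discrete filtered set $\Omega_\star$ centred at $\omega$ is a family of finite sets $\Omega_L\subset D(\omega,L)$, $L>0$, with $\Omega_{L_1}\subseteq\Omega_{L_2}$ for $L_1\le L_2$ and $\Omega_L=\{\omega\}$ for all sufficiently small $L>0$. The fine sum of two discrete filtered sets centred at $\omega$ is $$(\Omega_\star*\Omega'_\star)_L=\{-\omega+\omega_1+\omega_2 \mid \omega_1\in\Omega_{L_1},\ \omega_2\in\Omega'_{L_2},\ L_1,L_2>0,\ L_1+L_2=L\}.$$ The saturated set $\Omega_\star^\infty$ is the direct limit (levelwise union) of the iterated fine sums: $\Omega^\infty_L=\bigcup_{n\ge1}(\underbrace{\Omega_\star*\cdots*\Omega_\star}_{n})_L$. It is again a discrete filtered set centred at $\omega$. *Allowed paths.* For $L>0$ let $\mathfrak R_{\Omega_\star}(L)$ be the set of continuous piecewise $C^1$ paths $\lambda:[0,1]\to\mathbb C$ with $\lambda(0)=\omega$, of length $<L$, which either are constant or satisfy, for some $t_0\in[0,1)$, $\lambda([0,t_0])=\{\omega\}$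 and $\lambda((t_0,1])\subset D(\omega,L)\setminus\Omega_L$. A path is $\Omega_\star$-allowed if it lies in $\mathfrak R_{\Omega_\star}(L)$ for some $L>0$. Two $\Omega_\star$-allowed paths with the same endpoint are $\Omega_\star$-homotopic if there is a continuous homotopy $H:(s,t)\in[0,1]^2\mapsto H_t(s)$ between them with fixed extremities such that every $H_t$ is $\Omega_\star$-allowed and, for some subdivision $0=\sigma_0<\dots<\sigma_k=1$, $\partial H/\partial s$ exists and is continuous on each $[\sigma_i,\sigma_{i+1}]\times[0,1]$. Let $\mathrm{cl}(\lambda)$ denote the class of $\lambda$. *Riemann surface.* $\mathscr R_{\Omega_\star}$ is the set of classes $\mathrm{cl}(\lambda)$ of $\Omega_\star$-allowed paths, with projection $\mathfrak p(\mathrm{cl}(\lambda))=\lambda(1)$ and base point the class of the constant path. Its topology is generated by the following sets: (i) $\{\mathrm{cl}([\omega,\xi])\mid \xi\in U\}$, where $L>0$ and $U\subset D(\omega,L)\setminus(\Omega_L\setminus\{\omega\})$ is open, contains $\omega$ and is star-shaped with respect to $\omega$; (ii) $\{\mathrm{cl}(\lambda_1\cdot[\lambda_1(1),\xi])\mid\xi\in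 U\}$, where $\lambda_1\in\mathfrak R_{\Omega_\star}(L)$, $L_2>0$, $\mathrm{length}(\lambda_1)+L_2<L$, and $U\subset D(\lambda_1(1),L_2)\setminus\Omega_L$ is open, contains $\lambda_1(1)$ and is star-shaped with respect to $\lambda_1(1)$. Its complex structure is pulled back from $\mathbb C$ by $\mathfrak p$: a function on $\mathscr R_{\Omega_\star}$ is holomorphic if near each point it is of the form $f\circ\mathfrak p$ with $f$ holomorphic. Let $\widehat{\mathscr R}_{\Omega_\star}$ be the space of germs $\widehat\varphi$ of holomorphic functions at $\omega$ that can be analytically continued to $\mathscr R_{\Omega_\star}$, i.e. for which there is a holomorphic function $\Phi$ on $\mathscr R_{\Omega_\star}$ with $\Phi=\widehat\varphi\circ\mathfrak p$ near the base point. *Convolution.* For germs of holomorphic functions at $\omega$, $$\widehat\varphi*\widehat\psi(\zeta)=\int_\omega^\zeta\widehat\varphi(\eta)\,\widehat\psi(\zeta+\omega-\eta)\,d\eta$$ for $\zeta$ close to $\omega$ (integral along the segment); $\widehat\varphi^{*1}=\widehat\varphi$ and $\widehat\varphi^{*(n+1)}=\widehat\varphi^{*n}*\widehat\varphi$. **Corollary.**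 Let $\Omega_\star$ be a discrete filtered set centred at $\omega\in\mathbb C$ and let $\widehat\varphi\in\widehat{\mathscr R}_{\Omega_\star}$. Then for every integer $n\ge1$ the iterated convolution product $\widehat\varphi^{*n}$ belongs to $\widehat{\mathscr R}_{\Omega_\star^\infty}$. -/

import Mathlib

open Set Filter Topology

noncomputable section

namespace Resurgence

/-! ### Discrete filtered sets -/

/-- A discrete filtered set centred at `ω`: an increasing family of finite sets `Ω_L`, `L > 0`, with
`Ω_L` inside the open disc `D(ω, L)` and `Ω_L = {ω}` for small `L`. Only the values at `L > 0` are
meaningful. -/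
structure DiscreteFilteredSet (ω : ℂ) where
  /-- the set `Ω_L` -/
  level : ℝ → Set ℂ
  finite_level : ∀ L, 0 < L → (level L).Finite
  level_subset_ball : ∀ L, 0 < L → level L ⊆ Metric.ball ω L
  level_mono : ∀ L₁ L₂, 0 < L₁ → L₁ ≤ L₂ → level L₁ ⊆ level L₂
  level_small : ∃ δ, 0 < δ ∧ ∀ L, 0 < L → L < δ → level L = {ω}

variable {ω : ℂ}

theorem DiscreteFilteredSet.center_mem (Ω : DiscreteFilteredSet ω) {L : ℝ} (hL : 0 < L) :
    ω ∈ Ω.level L := by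
  obtain ⟨δ, hδ, h⟩ := Ω.level_small
  have hm : 0 < min L (δ / 2) := lt_min hL (by linarith)
  have h1 := h (min L (δ / 2)) hm ((min_le_right _ _).trans_lt (by linarith))
  exact Ω.level_mono _ _ hm (min_le_left _ _) (h1 ▸ mem_singleton ω)

/-- The fine sum `Ω ∗ Ω'`. -/
def DiscreteFilteredSet.fineSum (Ω Ω' : DiscreteFilteredSet ω) : DiscreteFilteredSet ω where
  level L := {ζ | ∃ L₁ L₂ : ℝ, 0 < L₁ ∧ 0 < L₂ ∧ L₁ + L₂ = L ∧
    ∃ ω₁ ∈ Ω.level L₁, ∃ ω₂ ∈ Ω'.level L₂, ζ = -ω + ω₁ + ω₂}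
  finite_level := by
    intro L hL
    refine ((Ω.finite_level L hL).image2 (fun a b => -ω + a + b)
      (Ω'.finite_level L hL)).subset ?_
    rintro ζ ⟨L₁, L₂, h₁, h₂, h, a, ha, b, hb, rfl⟩
    exact ⟨a, Ω.level_mono _ _ h₁ (by linarith) ha, b,
      Ω'.level_mono _ _ h₂ (by linarith) hb, rfl⟩
  level_subset_ball := by
    rintro L hL ζ ⟨L₁, L₂, h₁, h₂, h, a, ha, b, hb, rfl⟩
    have ha' := Ω.level_subset_ball _ h₁ ha
    have hb' := Ω'.level_subset_ball _ h₂ hb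
    rw [Metric.mem_ball, dist_eq_norm] at ha' hb' ⊢
    have e : -ω + a + b - ω = (a - ω) + (b - ω) := by ring
    rw [e]
    exact (norm_add_le _ _).trans_lt (by linarith)
  level_mono := by
    rintro L L' hL hLL' ζ ⟨L₁, L₂, h₁, h₂, h, a, ha, b, hb, rfl⟩
    exact ⟨L₁, L' - L₁, h₁, by linarith, by ring, a, ha, b,
      Ω'.level_mono _ _ h₂ (by linarith) hb, rfl⟩
  level_small := by
    obtain ⟨δ, hδ, h⟩ := Ω.level_small
    obtain ⟨δ', hδ', h'⟩ := Ω'.level_small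
    refine ⟨min δ δ', lt_min hδ hδ', fun L hL hL' => ?_⟩
    have hLδ := hL'.trans_le (min_le_left _ _)
    have hLδ' := hL'.trans_le (min_le_right _ _)
    ext ζ
    constructor
    · rintro ⟨L₁, L₂, h₁, h₂, hs, a, ha, b, hb, rfl⟩
      rw [h L₁ h₁ (by linarith), mem_singleton_iff] at ha
      rw [h' L₂ h₂ (by linarith), mem_singleton_iff] at hb
      rw [ha, hb, mem_singleton_iff]
      ring
    · intro hζ
      rw [mem_singleton_iff] at hζ
      exact ⟨L / 2, L / 2, by linarith, by linarith, by ring, ω, Ω.center_mem (by linarith), ω,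
        Ω'.center_mem (by linarith), by rw [hζ]; ring⟩

/-- `Ω.iterFineSum n` is the fine sum of `n + 1` copies of `Ω`. -/
def DiscreteFilteredSet.iterFineSum (Ω : DiscreteFilteredSet ω) : ℕ → DiscreteFilteredSet ω
  | 0 => Ω
  | n + 1 => (Ω.iterFineSum n).fineSum Ω

open scoped Pointwise in
/-- An element of an iterated fine sum at level `L' ≤ L` is, up to translation, a sum of at most
`L' / δ` elements of `Ω_L - ω`. -/
theorem DiscreteFilteredSet.iterFineSum_bound (Ω : DiscreteFilteredSet ω) {δ : ℝ}
    (hsmall : ∀ L, 0 < L → L < δ → Ω.level L = {ω}) (L : ℝ) (n : ℕ) :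
    ∀ L' ζ, 0 < L' → L' ≤ L → ζ ∈ (Ω.iterFineSum n).level L' →
      ∃ k : ℕ, k * δ ≤ L' ∧ ζ - ω ∈ k • ((fun z => z - ω) '' Ω.level L) := by
  have key : ∀ L' ζ, 0 < L' → L' ≤ L → ζ ∈ Ω.level L' →
      ∃ k : ℕ, k * δ ≤ L' ∧ ζ - ω ∈ k • ((fun z => z - ω) '' Ω.level L) := by
    intro L' ζ h0 hL hζ
    by_cases hd : L' < δ
    · rw [hsmall L' h0 hd, mem_singleton_iff] at hζ
      exact ⟨0, by simpa using h0.le, by simp [hζ]⟩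
    · exact ⟨1, by simpa using hd, by
        rw [one_nsmul]; exact ⟨ζ, Ω.level_mono _ _ h0 hL hζ, rfl⟩⟩
  induction n with
  | zero => exact key
  | succ n ih =>
    rintro L' ζ h0 hL ⟨L₁, L₂, h₁, h₂, h, a, ha, b, hb, rfl⟩
    obtain ⟨k, hk, hka⟩ := ih L₁ a h₁ (by linarith) ha
    obtain ⟨l, hl, hlb⟩ := key L₂ b h₂ (by linarith) hb
    refine ⟨k + l, by push_cast; linarith, ?_⟩
    rw [add_nsmul]
    exact ⟨a - ω, hka, b - ω, hlb, by ring⟩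

open scoped Pointwise in
/-- The saturated set `Ω^∞`: the direct limit (levelwise union) of the iterated fine sums of `Ω`. -/
def DiscreteFilteredSet.saturated (Ω : DiscreteFilteredSet ω) : DiscreteFilteredSet ω where
  level L := ⋃ n : ℕ, (Ω.iterFineSum n).level L
  finite_level := by
    intro L hL
    obtain ⟨δ, hδ, hs⟩ := Ω.level_small
    have hA : ((fun z => z - ω) '' Ω.level L).Finite := (Ω.finite_level L hL).image _
    have hpow : ∀ k : ℕ, (k • ((fun z => z - ω) '' Ω.level L)).Finite := by
      intro k
      induction k with
      | zero => rw [zero_nsmul]; exact finite_singleton (0 : ℂ)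
      | succ k ih => rw [succ_nsmul]; exact ih.add hA
    have hfin : (⋃ k ∈ Set.Iic ⌊L / δ⌋₊, (fun z => z + ω) ''
        (k • ((fun z => z - ω) '' Ω.level L))).Finite :=
      (Set.finite_Iic _).biUnion fun k _ => (hpow k).image _
    refine hfin.subset ?_
    intro ζ hζ
    obtain ⟨n, hn⟩ := mem_iUnion.1 hζ
    obtain ⟨k, hk, hkz⟩ := Ω.iterFineSum_bound hs L n L ζ hL le_rfl hn
    refine mem_iUnion₂.2 ⟨k, Nat.le_floor ((le_div_iff₀ hδ).2 hk), ζ - ω, hkz, by ring⟩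
  level_subset_ball := fun L hL => iUnion_subset fun n => (Ω.iterFineSum n).level_subset_ball L hL
  level_mono := fun L₁ L₂ h₁ h => iUnion_mono fun n => (Ω.iterFineSum n).level_mono L₁ L₂ h₁ h
  level_small := by
    obtain ⟨δ, hδ, hs⟩ := Ω.level_small
    refine ⟨δ, hδ, fun L hL hLδ => Subset.antisymm ?_ ?_⟩
    · intro ζ hζ
      obtain ⟨n, hn⟩ := mem_iUnion.1 hζ
      obtain ⟨k, hk, hkz⟩ := Ω.iterFineSum_bound hs L n L ζ hL le_rfl hn
      have hk0 : k = 0 := by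
        by_contra hne
        have : (1 : ℝ) ≤ k := by exact_mod_cast Nat.one_le_iff_ne_zero.2 hne
        nlinarith
      subst hk0
      rw [zero_nsmul] at hkz
      exact sub_eq_zero.1 hkz
    · rw [singleton_subset_iff]
      exact mem_iUnion.2 ⟨0, Ω.center_mem hL⟩

/-! ### Allowed paths and homotopies

All paths are standardized: they are maps on `[0, 1]`, given by functions `ℝ → ℂ` whose values
outside `[0, 1]` play no role. -/

/-- `0 = σ 0 < σ 1 < ⋯ < σ n = 1` is a subdivision of `[0, 1]`. -/
def IsSubdivision (n : ℕ) (σ : ℕ → ℝ) : Prop :=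
  σ 0 = 0 ∧ σ n = 1 ∧ ∀ i < n, σ i < σ (i + 1)

/-- `γ` is continuous and piecewise `C¹` on `[0, 1]`. -/
def PiecewiseC1 (γ : ℝ → ℂ) : Prop :=
  ContinuousOn γ (Icc 0 1) ∧
    ∃ (n : ℕ) (σ : ℕ → ℝ), IsSubdivision n σ ∧
      ∀ i < n, ContDiffOn ℝ 1 γ (Icc (σ i) (σ (i + 1)))

/-- The length of a piecewise `C¹` path. -/
def pathLength (γ : ℝ → ℂ) : ℝ := ∫ t in (0 : ℝ)..1, ‖deriv γ t‖

/-- `γ` belongs to `ℜ_Ω(L)`: it starts at `ω`, is piecewise `C¹` of length `< L`, and is either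
constant or stays at `ω` during some `[0, t₀]` and then stays in `D(ω, L) \ Ω_L`. -/
def AllowedAt (Ω : DiscreteFilteredSet ω) (L : ℝ) (γ : ℝ → ℂ) : Prop :=
  γ 0 = ω ∧ PiecewiseC1 γ ∧ pathLength γ < L ∧
    ((∀ t ∈ Icc (0 : ℝ) 1, γ t = ω) ∨
      ∃ t₀ ∈ Ico (0 : ℝ) 1, (∀ t ∈ Icc 0 t₀, γ t = ω) ∧
        ∀ t ∈ Ioc t₀ 1, γ t ∈ Metric.ball ω L \ Ω.level L)

/-- `γ` is `Ω`-allowed. -/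
def Allowed (Ω : DiscreteFilteredSet ω) (γ : ℝ → ℂ) : Prop :=
  ∃ L, 0 < L ∧ AllowedAt Ω L γ

/-- The type of `Ω`-allowed paths. -/
def AllowedPath (Ω : DiscreteFilteredSet ω) : Type := {γ : ℝ → ℂ // Allowed Ω γ}

/-- `H : (s, t) ↦ H_t(s)` is an `Ω`-homotopy: `H` is continuous on `[0, 1]²`, the partial derivative
`∂H/∂s` is continuous on each strip `[σ i, σ (i+1)] × [0, 1]` of some subdivision (paths being only
piecewise `C¹`), and every `H_t` is `Ω`-allowed. -/
def IsHomotopy (Ω : DiscreteFilteredSet ω) (H : ℝ → ℝ → ℂ) : Prop :=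
  ContinuousOn (fun q : ℝ × ℝ => H q.1 q.2) (Icc 0 1 ×ˢ Icc 0 1) ∧
    (∃ (n : ℕ) (σ : ℕ → ℝ) (D : ℕ → ℝ × ℝ → ℂ), IsSubdivision n σ ∧ ∀ i < n,
      ContinuousOn (D i) (Icc (σ i) (σ (i + 1)) ×ˢ Icc 0 1) ∧
      ∀ s ∈ Icc (σ i) (σ (i + 1)), ∀ t ∈ Icc (0 : ℝ) 1,
        HasDerivWithinAt (fun s' => H s' t) (D i (s, t)) (Icc (σ i) (σ (i + 1))) s) ∧
    ∀ t ∈ Icc (0 : ℝ) 1, Allowed Ω (fun s => H s t)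

/-- `γ₀` and `γ₁` are `Ω`-homotopic with fixed extremities. -/
def Homotopic (Ω : DiscreteFilteredSet ω) (γ₀ γ₁ : AllowedPath Ω) : Prop :=
  ∃ H : ℝ → ℝ → ℂ, IsHomotopy Ω H ∧
    (∀ s ∈ Icc (0 : ℝ) 1, H s 0 = γ₀.1 s) ∧ (∀ s ∈ Icc (0 : ℝ) 1, H s 1 = γ₁.1 s) ∧
    (∀ t ∈ Icc (0 : ℝ) 1, H 0 t = ω) ∧ ∀ t ∈ Icc (0 : ℝ) 1, H 1 t = γ₀.1 1

/-! ### The Riemann surface of a discrete filtered set -/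

/-- The space `𝓡_Ω` of `Ω`-homotopy classes of `Ω`-allowed paths. -/
def Surface (Ω : DiscreteFilteredSet ω) : Type := Quot (Homotopic Ω)

/-- The class of an allowed path. -/
def cl {Ω : DiscreteFilteredSet ω} (γ : AllowedPath Ω) : Surface Ω := Quot.mk _ γ

/-- The projection `𝔭 : 𝓡_Ω → ℂ`, `cl γ ↦ γ(1)`. -/
def proj {Ω : DiscreteFilteredSet ω} : Surface Ω → ℂ :=
  Quot.lift (fun γ => γ.1 1) (by
    rintro γ₀ γ₁ ⟨H, -, -, h₁, -, he⟩
    have h := he 1 ⟨zero_le_one, le_rfl⟩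
    rw [h₁ 1 ⟨zero_le_one, le_rfl⟩] at h
    exact h.symm)

/-- The constant path at the centre. -/
def constPath (Ω : DiscreteFilteredSet ω) : AllowedPath Ω :=
  ⟨fun _ => ω, 1, one_pos, rfl,
    ⟨continuousOn_const, 1, fun i => i, by
      refine ⟨by simp, by simp, fun i _ => by simp⟩, fun i _ => contDiffOn_const⟩,
    by simp [pathLength], Or.inl fun _ _ => rfl⟩

/-- The base point of `𝓡_Ω`, the class of the constant path. -/
def basePoint (Ω : DiscreteFilteredSet ω) : Surface Ω := cl (constPath Ω)

/-- The (standardized) concatenation of two standard paths. -/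
def concat (γ₁ γ₂ : ℝ → ℂ) (t : ℝ) : ℂ := if t ≤ 1 / 2 then γ₁ (2 * t) else γ₂ (2 * t - 1)

/-- Basic open sets around the base point: the classes of the straight segments `[ω, ξ]`, `ξ ∈ U`,
with `U ⊆ D(ω, L) \ Ω_L^⋆` open and star-shaped about `ω`. -/
def IsBaseNhd (Ω : DiscreteFilteredSet ω) (W : Set (Surface Ω)) : Prop :=
  ∃ (L : ℝ) (U : Set ℂ), 0 < L ∧ IsOpen U ∧ ω ∈ U ∧ StarConvex ℝ ω U ∧
    U ⊆ Metric.ball ω L \ (Ω.level L \ {ω}) ∧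
    W = {q | ∃ γ : AllowedPath Ω, q = cl γ ∧
      ∃ ξ ∈ U, EqOn γ.1 (fun t => AffineMap.lineMap ω ξ t) (Icc 0 1)}

/-- Basic open sets around the class of `γ₁ ∈ ℜ_Ω(L)`: the classes of the products of `γ₁` with the
straight segments `[γ₁(1), ξ]`, `ξ ∈ U`, with `U ⊆ D(γ₁(1), L₂) \ Ω_L` open and star-shaped about
`γ₁(1)`, where `length γ₁ + L₂ < L`. -/
def IsPointNhd (Ω : DiscreteFilteredSet ω) (W : Set (Surface Ω)) : Prop :=
  ∃ (γ₁ : AllowedPath Ω) (L L₂ : ℝ) (U : Set ℂ), AllowedAt Ω L γ₁.1 ∧ 0 < L₂ ∧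
    pathLength γ₁.1 + L₂ < L ∧ IsOpen U ∧ γ₁.1 1 ∈ U ∧ StarConvex ℝ (γ₁.1 1) U ∧
    U ⊆ Metric.ball (γ₁.1 1) L₂ \ Ω.level L ∧
    W = {q | ∃ γ : AllowedPath Ω, q = cl γ ∧
      ∃ ξ ∈ U, EqOn γ.1 (concat γ₁.1 (fun t => AffineMap.lineMap (γ₁.1 1) ξ t)) (Icc 0 1)}

/-- The topology of `𝓡_Ω`. -/
instance instTopologicalSpaceSurface (Ω : DiscreteFilteredSet ω) : TopologicalSpace (Surface Ω) :=
  TopologicalSpace.generateFrom {W | IsBaseNhd Ω W ∨ IsPointNhd Ω W}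

/-- `Φ` is holomorphic on `𝓡_Ω` for the complex structure pulled back by the local homeomorphism
`𝔭`: near every point it is the composition of `𝔭` with a holomorphic function. -/
def HolomorphicOnSurface {Ω : DiscreteFilteredSet ω} (Φ : Surface Ω → ℂ) : Prop :=
  ∀ z : Surface Ω, ∃ f : ℂ → ℂ, AnalyticAt ℂ f (proj z) ∧ ∀ᶠ w in 𝓝 z, Φ w = f (proj w)

/-- The germ at `ω` of the function `φ` is holomorphic and can be analytically continued to
`𝓡_Ω`. -/
def ContinuesTo (Ω : DiscreteFilteredSet ω) (φ : ℂ → ℂ) : Prop :=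
  AnalyticAt ℂ φ ω ∧ ∃ Φ : Surface Ω → ℂ, HolomorphicOnSurface Φ ∧
    ∀ᶠ z in 𝓝 (basePoint Ω), Φ z = φ (proj z)

/-! ### Convolution -/

/-- The convolution product at `ω`, `(φ ∗ ψ)(ζ) = ∫_ω^ζ φ(η) ψ(ζ + ω - η) dη`, the integral being
taken along the segment `η = ω + t (ζ - ω)`. Only its germ at `ω` matters. -/
def conv (ω : ℂ) (φ ψ : ℂ → ℂ) (ζ : ℂ) : ℂ :=
  ∫ t in (0 : ℝ)..1,
    (φ (ω + t * (ζ - ω)) * ψ (ζ + ω - (ω + t * (ζ - ω)))) * (ζ - ω)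

/-- The germ of the convolution product only depends on the germs of the factors. -/
theorem conv_congr {φ φ' ψ ψ' : ℂ → ℂ} (h : φ =ᶠ[𝓝 ω] φ') (h' : ψ =ᶠ[𝓝 ω] ψ') :
    conv ω φ ψ =ᶠ[𝓝 ω] conv ω φ' ψ' := by
  obtain ⟨r, hr, hb⟩ := Metric.eventually_nhds_iff.1 (h.and h')
  refine Metric.eventually_nhds_iff.2 ⟨r, hr, fun ζ hζ => ?_⟩
  rw [dist_eq_norm] at hζ
  refine intervalIntegral.integral_congr fun t ht => ?_
  rw [uIcc_of_le zero_le_one] at ht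
  have aux : ∀ u : ℝ, 0 ≤ u → u ≤ 1 → ‖(u : ℂ) * (ζ - ω)‖ < r := fun u h0 h1 => by
    rw [norm_mul, Complex.norm_real, Real.norm_of_nonneg h0]
    exact (mul_le_of_le_one_left (norm_nonneg _) h1).trans_lt hζ
  have e1 : φ (ω + t * (ζ - ω)) = φ' (ω + t * (ζ - ω)) := by
    refine (hb ?_).1
    rw [dist_eq_norm, add_sub_cancel_left]
    exact aux t ht.1 ht.2
  have e2 : ψ (ζ + ω - (ω + t * (ζ - ω))) = ψ' (ζ + ω - (ω + t * (ζ - ω))) := by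
    refine (hb ?_).2
    have e : ζ + ω - (ω + t * (ζ - ω)) - ω = ((1 - t : ℝ) : ℂ) * (ζ - ω) := by
      push_cast; ring
    rw [dist_eq_norm, e]
    exact aux (1 - t) (by linarith [ht.2]) (by linarith [ht.1])
  simp only [e1, e2]

/-- The convolution power `φ^{∗n}` for `n ≥ 1` (the value at `n = 0` is not meaningful). -/
def convPow (ω : ℂ) (φ : ℂ → ℂ) : ℕ → ℂ → ℂ
  | 0 => 0
  | 1 => φ
  | n + 2 => conv ω (convPow ω φ (n + 1)) φ

end Resurgence

end

open Set Filter Topology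

noncomputable section

namespace Resurgence

/-! ### Analytic continuation along paths -/

/-! The filtration is traded for one more real dimension. A path is recorded as a causal path `q =
(ℓ, c)` in `ℝ × ℂ`, with `‖c t' - c t‖ ≤ ℓ t' - ℓ t`, and `Ω` becomes the closed set `singularSet`
of pairs `(ℓ, a)` with `ω + a ∈ Ω_L` for all `L > ℓ`. In this picture fine sums contain ordinary
sums: the singular sets of `Ω` and `Ω'` add up into that of `Ω ∗ Ω'` (`add_mem_singularSet`), and
the causal cone is stable under addition and nonnegative scaling.

A germ extends to the surface exactly when, for small `r`, it continues along every causal path that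
starts in the cone below height `r` and avoids the singular set: `ContinuesTo.hasContinuation` and
`HasContinuation.continuesTo`. The theorem thus reduces to `HasContinuation.conv₀`, applied
inductively to the iterated fine sums, whose singular sets lie in that of `Ω^∞`.

For `conv₀`, let `q` avoid `K''`, where `K + K' ⊆ K''`. The segment `[0, q 0]` is deformed into
curves `s ↦ X s t` from `0` to `q t` such that `X s` avoids `K` for `s > 0`, `q - X s` avoids `K'`
for `s < 1`, and both are causal. Each increment of `q` is divided between `X` and `q - X` in the
proportions `θ` and `1 - θ`, with `θ = d(X, K) / (d(X, K) + d(q - X, K'))`. The denominator is at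
least `d(q, K'')`, hence bounded below, and each part slows down near its own obstacle. Freezing `θ`
on short time steps replaces a differential equation by finitely many explicit formulas
(`IsFlow.step`). The factors continue along `X s` and `q - X s`, and the integral of `φ(η) ψ(ζ - η)`
over the deformed curve continues `φ ∗ ψ`. These curves are merely continuous, so polygonal lines
inscribed in a grid of discs are used (`IsCells.exists_grid`), and Cauchy's theorem makes the
integral independent of the vertices (`sum_segInt_eq`).

From the surface to causal paths: a causal path need not be piecewise `C¹`, so it is shadowed by
polygonal allowed paths in general position, and the function on the surface is read along the local
sections `ξ ↦ cl (p · [p(1), ξ])`. Continuity of these sections for the generated topology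
(`tendsto_clOf_bump`) comes from perturbing homotopies by small motions of their common end.
Matching successive sections requires that a path be homotopic to its product with a constant path
(`Allowed.clOf_segConcat_self`).

From causal paths to the surface: an allowed path with its running length is causal, continuation
along homotopic paths gives the same germ, and the values of the end germs define a function which
is holomorphic on the basic open sets. -/

/-- `f t` is, for `t ∈ I`, a germ at `c t` of holomorphic function, and these germs are obtained from
one another by analytic continuation along `c`. -/
def IsContinuationOn (c : ℝ → ℂ) (f : ℝ → ℂ → ℂ) (I : Set ℝ) : Prop :=
  ∀ t ∈ I, AnalyticAt ℂ (f t) (c t) ∧ ∀ᶠ t' in 𝓝[I] t, f t' =ᶠ[𝓝 (c t')] f t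

theorem exists_ball_of_analyticAt {f : ℂ → ℂ} {x : ℂ} (hf : AnalyticAt ℂ f x) :
    ∃ r > 0, AnalyticOnNhd ℂ f (Metric.ball x r) := by
  obtain ⟨r, hr, h⟩ := Metric.eventually_nhds_iff_ball.1 hf.eventually_analyticAt
  exact ⟨r, hr, h⟩

theorem eventuallyEq_of_convex {f g : ℂ → ℂ} {U : Set ℂ} {x y : ℂ} (hU : IsOpen U)
    (hc : Convex ℝ U) (hf : AnalyticOnNhd ℂ f U) (hg : AnalyticOnNhd ℂ g U) (hx : x ∈ U)
    (hy : y ∈ U) (h : f =ᶠ[𝓝 x] g) : f =ᶠ[𝓝 y] g :=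
  (hf.eqOn_of_preconnected_of_eventuallyEq hg hc.isPreconnected hx h).eventuallyEq_of_mem
    (hU.mem_nhds hy)

/-- Agreement is locally constant in time: near `t` both families come from two functions on a
common disc, to which the identity theorem applies. Connectedness of `I` does the rest. -/
theorem IsContinuationOn.eventuallyEq {c : ℝ → ℂ} {f g : ℝ → ℂ → ℂ} {I : Set ℝ}
    (hI : IsPreconnected I) (hc : ContinuousOn c I) (hf : IsContinuationOn c f I)
    (hg : IsContinuationOn c g I) {t₀ t : ℝ} (h₀ : t₀ ∈ I) (ht : t ∈ I)
    (h : f t₀ =ᶠ[𝓝 (c t₀)] g t₀) : f t =ᶠ[𝓝 (c t)] g t := by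
  have key := hI.induction₂ (fun t t' => (f t =ᶠ[𝓝 (c t)] g t ↔ f t' =ᶠ[𝓝 (c t')] g t'))
    (fun t ht => ?_) (fun _ _ _ _ _ _ h h' => h.trans h') (fun _ _ _ _ h => h.symm) h₀ ht
  · exact key.1 h
  obtain ⟨r, hr, hfr⟩ := exists_ball_of_analyticAt (hf t ht).1
  obtain ⟨r', hr', hgr⟩ := exists_ball_of_analyticAt (hg t ht).1
  have hm : 0 < min r r' := lt_min hr hr'
  have hfm := hfr.mono (Metric.ball_subset_ball (min_le_left r r'))
  have hgm := hgr.mono (Metric.ball_subset_ball (min_le_right r r'))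
  filter_upwards [(hf t ht).2, (hg t ht).2, (hc t ht) (Metric.ball_mem_nhds _ hm)] with t' h₁ h₂ h₃
  have h₄ := Metric.mem_ball_self (x := c t) hm
  constructor
  · intro h
    exact h₁.trans ((eventuallyEq_of_convex Metric.isOpen_ball (convex_ball _ _) hfm hgm h₄ h₃ h).trans
      h₂.symm)
  · intro h
    exact eventuallyEq_of_convex Metric.isOpen_ball (convex_ball _ _) hfm hgm h₃ h₄
      (h₁.symm.trans (h.trans h₂))

theorem IsContinuationOn.mono {c : ℝ → ℂ} {f : ℝ → ℂ → ℂ} {I J : Set ℝ}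
    (hf : IsContinuationOn c f I) (h : J ⊆ I) : IsContinuationOn c f J :=
  fun t ht => ⟨(hf t (h ht)).1, (hf t (h ht)).2.filter_mono (nhdsWithin_mono _ h)⟩

theorem IsContinuationOn.const {c : ℝ → ℂ} {g : ℂ → ℂ} {I : Set ℝ}
    (h : ∀ t ∈ I, AnalyticAt ℂ g (c t)) : IsContinuationOn c (fun _ => g) I :=
  fun t ht => ⟨h t ht, Eventually.of_forall fun _ => EventuallyEq.rfl⟩

theorem eventually_eventuallyEq_comp {α : Type*} {l : Filter α} {x : α → ℂ} {z : ℂ} {f g : ℂ → ℂ}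
    (h : f =ᶠ[𝓝 z] g) (hx : Tendsto x l (𝓝 z)) : ∀ᶠ a in l, f =ᶠ[𝓝 (x a)] g :=
  hx.eventually (eventually_eventually_nhds.2 h)

/-- A family of continuations along paths depending continuously on a parameter, which is coherent
at time `0`, is coherent. -/
theorem IsContinuationOn.coherent {P : Type*} [TopologicalSpace P] {c : P → ℝ → ℂ}
    {f : P → ℝ → ℂ → ℂ} (hc : Continuous fun q : P × ℝ => c q.1 q.2)
    (hf : ∀ p, IsContinuationOn (c p) (f p) univ) (p₀ : P)
    (h₀ : ∀ᶠ p in 𝓝 p₀, f p 0 =ᶠ[𝓝 (c p 0)] f p₀ 0) (t₀ : ℝ) :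
    ∀ᶠ q in 𝓝 (p₀, t₀), f q.1 q.2 =ᶠ[𝓝 (c q.1 q.2)] f p₀ t₀ := by
  have hcp : ∀ p, Continuous (c p) := fun p => hc.comp (by fun_prop : Continuous fun t => (p, t))
  have hct : ∀ t, Continuous fun p => c p t := fun t =>
    hc.comp (by fun_prop : Continuous fun p => (p, t))
  -- local form
  have loc : ∀ T : ℝ, ∃ δ > 0, ∀ t₁ ∈ Metric.ball T δ,
      (∀ᶠ p in 𝓝 p₀, f p t₁ =ᶠ[𝓝 (c p t₁)] f p₀ t₁) →
      ∀ᶠ p in 𝓝 p₀, ∀ t ∈ Metric.ball T δ, f p t =ᶠ[𝓝 (c p t)] f p₀ T := by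
    intro T
    obtain ⟨r, hr, hfr⟩ := exists_ball_of_analyticAt (hf p₀ T trivial).1
    have h1 : ∀ᶠ q in 𝓝 (p₀, T), c q.1 q.2 ∈ Metric.ball (c p₀ T) r :=
      hc.continuousAt.eventually_mem (Metric.ball_mem_nhds _ hr)
    rw [nhds_prod_eq] at h1
    obtain ⟨V, hV, W, hW, hVW⟩ := Filter.eventually_prod_iff.1 h1
    obtain ⟨δ₁, hδ₁, hW'⟩ := Metric.eventually_nhds_iff_ball.1 hW
    have h2 := (hf p₀ T trivial).2
    rw [nhdsWithin_univ] at h2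
    obtain ⟨δ₂, hδ₂, h2'⟩ := Metric.eventually_nhds_iff_ball.1 h2
    refine ⟨min δ₁ δ₂, lt_min hδ₁ hδ₂, fun t₁ ht₁ h => ?_⟩
    have e1 := Metric.ball_subset_ball (min_le_left δ₁ δ₂) (x := T)
    have e2 := h2' t₁ (Metric.ball_subset_ball (min_le_right δ₁ δ₂) ht₁)
    have e3 := eventually_eventuallyEq_comp e2 ((hct t₁).tendsto p₀)
    filter_upwards [h, e3, hV] with p hp1 hp2 hp3 t ht
    -- On a short time interval the single function `f p₀ T` is also a continuation along the nearby
    -- path `c p`, so uniqueness spreads the agreement from `t₁` to the whole interval.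
    exact IsContinuationOn.eventuallyEq (g := fun _ => f p₀ T)
      (convex_ball T (min δ₁ δ₂)).isPreconnected (hcp p).continuousOn
      ((hf p).mono (subset_univ _))
      (IsContinuationOn.const fun t ht => hfr _ (hVW hp3 (hW' t (e1 ht)))) ht₁ ht (hp1.trans hp2)
  -- propagation
  have prop : ∀ T, ∀ᶠ p in 𝓝 p₀, f p T =ᶠ[𝓝 (c p T)] f p₀ T := by
    intro T
    have key := (isPreconnected_univ (α := ℝ)).induction₂
      (fun t t' => (∀ᶠ p in 𝓝 p₀, f p t =ᶠ[𝓝 (c p t)] f p₀ t) ↔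
        (∀ᶠ p in 𝓝 p₀, f p t' =ᶠ[𝓝 (c p t')] f p₀ t')) (fun t _ => ?_)
      (fun _ _ _ _ _ _ h h' => h.trans h') (fun _ _ _ _ h => h.symm) (mem_univ 0) (mem_univ T)
    · exact key.1 h₀
    rw [nhdsWithin_univ]
    obtain ⟨δ, hδ, h⟩ := loc t
    filter_upwards [Metric.ball_mem_nhds t hδ] with t' ht'
    have aux : ∀ a ∈ Metric.ball t δ, ∀ b ∈ Metric.ball t δ,
        (∀ᶠ p in 𝓝 p₀, f p a =ᶠ[𝓝 (c p a)] f p₀ a) →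
        (∀ᶠ p in 𝓝 p₀, f p b =ᶠ[𝓝 (c p b)] f p₀ b) := by
      intro a ha b hb hab
      have h' := h a ha hab
      have h3 := eventually_eventuallyEq_comp (h'.self_of_nhds b hb) ((hct b).tendsto p₀)
      filter_upwards [h', h3] with p hp hp'
      exact (hp b hb).trans hp'.symm
    have hs := Metric.mem_ball_self (x := t) hδ
    exact ⟨aux t hs t' ht', aux t' ht' t hs⟩
  obtain ⟨δ, hδ, h⟩ := loc t₀
  have h' := h t₀ (Metric.mem_ball_self hδ) (prop t₀)
  rw [nhds_prod_eq]
  filter_upwards [h'.prod_mk (Metric.ball_mem_nhds t₀ hδ)] with q hq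
  exact hq.1 q.2 hq.2

/-- Prolongation of a continuation along a stopped path. -/
theorem IsContinuationOn.extend {c : ℝ → ℂ} (hc : Continuous c) {T T' : ℝ} (hT : T ≤ T')
    {f : ℝ → ℂ → ℂ} {g : ℂ → ℂ} (hf : IsContinuationOn (fun t => c (min t T)) f univ)
    (hg : ∀ t ∈ Icc T T', AnalyticAt ℂ g (c t)) (h : f T =ᶠ[𝓝 (c T)] g) :
    IsContinuationOn (fun t => c (min t T')) (fun t => if t ≤ T then f t else g) univ := by
  intro t _
  have hcont : Tendsto (fun t => c (min t T')) (𝓝 t) (𝓝 (c (min t T'))) := by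
    have : Continuous fun t => c (min t T') := by fun_prop
    exact this.tendsto t
  rw [nhdsWithin_univ]
  rcases lt_trichotomy t T with h1 | h1 | h1
  · have h2 := hf t trivial
    rw [nhdsWithin_univ] at h2
    simp only [min_eq_left h1.le, h1.le, if_true, min_eq_left (h1.le.trans hT)] at h2 ⊢
    refine ⟨h2.1, ?_⟩
    filter_upwards [h2.2, Iio_mem_nhds h1] with t' h3 h4
    have h4' : t' ≤ T := le_of_lt h4
    simpa [h4', h4'.trans hT] using h3
  · subst h1
    have h2 := hf t trivial
    rw [nhdsWithin_univ] at h2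
    simp only [min_self, le_refl, if_true, min_eq_left hT] at h2 hcont ⊢
    refine ⟨h2.1, ?_⟩
    filter_upwards [h2.2, eventually_eventuallyEq_comp h hcont] with t' h3 h4
    by_cases h5 : t' ≤ t
    · simpa [h5, h5.trans hT] using h3
    · simpa [h5] using h4.symm
  · have h2 : ¬ t ≤ T := not_le.2 h1
    simp only [h2, if_false]
    refine ⟨hg _ ⟨le_min h1.le hT, min_le_right _ _⟩, ?_⟩
    filter_upwards [Ioi_mem_nhds h1] with t' h3
    have : ¬ t' ≤ T := not_le.2 h3
    simp only [this, if_false]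
    exact EventuallyEq.rfl

/-- The germ `g` at `c T` is obtained by analytic continuation of the germ `φ` at `c 0` along `c`. -/
def ContinuesAlong (c : ℝ → ℂ) (φ g : ℂ → ℂ) (T : ℝ) : Prop :=
  ∃ f : ℝ → ℂ → ℂ, IsContinuationOn (fun t => c (min t T)) f univ ∧ f 0 =ᶠ[𝓝 (c 0)] φ ∧
    f T =ᶠ[𝓝 (c T)] g

theorem ContinuesAlong.extend {c : ℝ → ℂ} (hc : Continuous c) {φ g g' : ℂ → ℂ} {T T' : ℝ}
    (h0 : 0 ≤ T) (hT : T ≤ T') (h : ContinuesAlong c φ g T)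
    (hg : ∀ t ∈ Icc T T', AnalyticAt ℂ g (c t)) (hg' : g =ᶠ[𝓝 (c T')] g') :
    ContinuesAlong c φ g' T' := by
  obtain ⟨f, hf, hf0, hfT⟩ := h
  refine ⟨_, hf.extend hc hT hg hfT, by simpa [h0] using hf0, ?_⟩
  by_cases h1 : T' ≤ T
  · obtain rfl := le_antisymm hT h1
    simpa using hfT.trans hg'
  · simpa [h1] using hg'

theorem ContinuesAlong.zero {c : ℝ → ℂ} {φ g : ℂ → ℂ} (hc : ∀ t ≤ 0, c t = c 0)
    (hφ : AnalyticAt ℂ φ (c 0)) (hg : φ =ᶠ[𝓝 (c 0)] g) : ContinuesAlong c φ g 0 :=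
  ⟨fun _ => φ, IsContinuationOn.const fun t _ => by rw [hc _ (min_le_right t 0)]; exact hφ,
    EventuallyEq.rfl, hg⟩

section causalPaths

/-! ### Causal paths and the splitting flow -/

/-- The causal cone of `ℝ × ℂ`. -/
def InCone (u : ℝ × ℂ) : Prop := ‖u.2‖ ≤ u.1

theorem InCone.add {u v : ℝ × ℂ} (hu : InCone u) (hv : InCone v) : InCone (u + v) :=
  (norm_add_le _ _).trans (add_le_add hu hv)

theorem InCone.smul {u : ℝ × ℂ} (hu : InCone u) {a : ℝ} (ha : 0 ≤ a) : InCone (a • u) := by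
  have h := mul_le_mul_of_nonneg_left hu ha
  simpa [InCone, norm_smul, abs_of_nonneg ha] using h

theorem inCone_zero : InCone 0 := by simp [InCone]

/-- A causal path: a path `t ↦ (ℓ, c)` with `‖c t' - c t‖ ≤ ℓ t' - ℓ t` for `t ≤ t'`, constant
before time `0` and after time `1`. -/
structure IsCausal (q : ℝ → ℝ × ℂ) : Prop where
  continuous : Continuous q
  inCone : ∀ t t', t ≤ t' → InCone (q t' - q t)
  left : ∀ t ≤ 0, q t = q 0
  right : ∀ t, 1 ≤ t → q t = q 1

variable {K K' : Set (ℝ × ℂ)}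

/-- The proportion of the motion which is given to the first variable. -/
def splitRatio (K K' : Set (ℝ × ℂ)) (z p : ℝ × ℂ) : ℝ :=
  Metric.infDist p K / (Metric.infDist p K + Metric.infDist (z - p) K')

section splitRatio

variable {z p : ℝ × ℂ} {m : ℝ}

theorem splitRatio_nonneg : 0 ≤ splitRatio K K' z p :=
  div_nonneg Metric.infDist_nonneg (add_nonneg Metric.infDist_nonneg Metric.infDist_nonneg)

theorem splitRatio_le_one : splitRatio K K' z p ≤ 1 :=
  div_le_one_of_le₀ (le_add_of_nonneg_right Metric.infDist_nonneg)
    (add_nonneg Metric.infDist_nonneg Metric.infDist_nonneg)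

/-- The denominator of the ratio is at least `m`, so the speed given to `p` is at most its distance
to `K` divided by `m`: the point slows down as it approaches the obstacle. -/
theorem mul_splitRatio_le (hm : 0 < m)
    (h : m ≤ Metric.infDist p K + Metric.infDist (z - p) K') :
    m * splitRatio K K' z p ≤ Metric.infDist p K := by
  have h1 : 0 < Metric.infDist p K + Metric.infDist (z - p) K' := hm.trans_le h
  rw [splitRatio, mul_div_assoc', div_le_iff₀ h1, mul_comm m]
  exact mul_le_mul_of_nonneg_left h Metric.infDist_nonneg

theorem mul_one_sub_splitRatio_le (hm : 0 < m)
    (h : m ≤ Metric.infDist p K + Metric.infDist (z - p) K') :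
    m * (1 - splitRatio K K' z p) ≤ Metric.infDist (z - p) K' := by
  have h1 : 0 < Metric.infDist p K + Metric.infDist (z - p) K' := hm.trans_le h
  rw [splitRatio, one_sub_div h1.ne', mul_div_assoc', div_le_iff₀ h1, add_sub_cancel_left,
    mul_comm m]
  exact mul_le_mul_of_nonneg_left h Metric.infDist_nonneg

theorem continuous_splitRatio (hm : 0 < m)
    (h : ∀ p, m ≤ Metric.infDist p K + Metric.infDist (z - p) K') :
    Continuous (splitRatio K K' z) := by
  have h1 : Continuous fun p : ℝ × ℂ => Metric.infDist p K := Metric.continuous_infDist_pt K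
  have h2 : Continuous fun p : ℝ × ℂ => Metric.infDist (z - p) K' :=
    (Metric.continuous_infDist_pt K').comp (by fun_prop)
  exact h1.div (h1.add h2) fun p => (hm.trans_le (h p)).ne'

/-- The displacement has norm at most `a * m / 2`, that is, at most half of the distance to `K`. -/
theorem infDist_add_smul_pos {w : ℝ × ℂ} {a : ℝ} (ha : 0 ≤ a)
    (h : m * a ≤ Metric.infDist p K) (hp : 0 < Metric.infDist p K) (hw : ‖w‖ ≤ m / 2) :
    0 < Metric.infDist (p + a • w) K := by
  have h1 := Metric.infDist_le_infDist_add_dist (s := K) (x := p) (y := p + a • w)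
  have h2 : dist p (p + a • w) = a * ‖w‖ := by
    rw [dist_eq_norm, sub_add_cancel_left, norm_neg, norm_smul, Real.norm_of_nonneg ha]
  have h3 : a * ‖w‖ ≤ a * (m / 2) := mul_le_mul_of_nonneg_left hw ha
  nlinarith

end splitRatio

/-- The state of the splitting flow when the path `q` is followed up to time `T`. -/
structure IsFlow (K K' : Set (ℝ × ℂ)) (q : ℝ → ℝ × ℂ) (T : ℝ) (X : ℝ → ℝ → ℝ × ℂ) : Prop where
  continuous : Continuous fun a : ℝ × ℝ => X a.1 a.2
  inCone : ∀ s ∈ Icc (0 : ℝ) 1, ∀ t t', t ≤ t' → InCone (X s t' - X s t)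
  inCone_compl : ∀ s ∈ Icc (0 : ℝ) 1, ∀ t t', t ≤ t' →
    InCone ((q (min t' T) - X s t') - (q (min t T) - X s t))
  left : ∀ s, ∀ t ≤ 0, X s t = X s 0
  right : ∀ s, ∀ t, T ≤ t → X s t = X s T
  pos : ∀ s ∈ Ioc (0 : ℝ) 1, ∀ t, 0 < Metric.infDist (X s t) K
  pos_compl : ∀ s ∈ Ico (0 : ℝ) 1, ∀ t, 0 < Metric.infDist (q (min t T) - X s t) K'
  zero : ∀ t, X 0 t = 0
  one : ∀ t, X 1 t = q (min t T)
  init : ∀ s, X s 0 = s • q 0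

theorem IsFlow.exists_zero {q : ℝ → ℝ × ℂ} (hq : IsCausal q)
    (h1 : ∀ s ∈ Ioc (0 : ℝ) 1, 0 < Metric.infDist (s • q 0) K)
    (h2 : ∀ s ∈ Ioc (0 : ℝ) 1, 0 < Metric.infDist (s • q 0) K') :
    ∃ X, IsFlow K K' q 0 X := by
  have hl : ∀ t, q (min t 0) = q 0 := fun t => hq.left _ (min_le_right _ _)
  refine ⟨fun s _ => s • q 0, by fun_prop, fun s hs t t' _ => by simpa using inCone_zero,
    fun s hs t t' _ => by simpa [hl] using inCone_zero, fun _ _ _ => rfl, fun _ _ _ => rfl,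
    fun s hs t => h1 s hs, fun s hs t => ?_, by simp, by simp [hl], by simp⟩
  rw [hl]
  have := h2 (1 - s) ⟨by linarith [hs.2], by linarith [hs.1]⟩
  simpa [sub_smul] using this

/-- An explicit Euler step: the ratio keeps on `[T, T']` its value at time `T`. Causality persists
because the added increments are nonnegative multiples of those of `q`; avoidance persists because
`q` moves by at most `m / 2`. -/
theorem IsFlow.step {q : ℝ → ℝ × ℂ} (hq : IsCausal q) (hK : (0 : ℝ × ℂ) ∈ K)
    (hK' : (0 : ℝ × ℂ) ∈ K') {m : ℝ} (hm : 0 < m)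
    (h : ∀ t p, m ≤ Metric.infDist p K + Metric.infDist (q t - p) K') {T T' : ℝ} (h0 : 0 ≤ T)
    (hT : T ≤ T') (hd : ∀ t ∈ Icc T T', ‖q t - q T‖ ≤ m / 2) {X : ℝ → ℝ → ℝ × ℂ}
    (hX : IsFlow K K' q T X) : ∃ X', IsFlow K K' q T' X' := by
  set θ : ℝ → ℝ := fun s => splitRatio K K' (q T) (X s T) with hθ
  -- Time truncated to `[T, T']`: the correction `θ s • (q (κ t) - q T)` vanishes before `T` and is
  -- frozen after `T'`, so one formula serves for all times.
  set κ : ℝ → ℝ := fun t => max T (min t T') with hκ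
  have hκ1 : ∀ t ≤ T, κ t = T := fun t ht => max_eq_left ((min_le_left _ _).trans ht)
  have hκ2 : ∀ t, T ≤ t → κ t = min t T' := fun t ht => max_eq_right (le_min ht hT)
  have hκm : Monotone κ := fun a b hab => max_le_max le_rfl (min_le_min hab le_rfl)
  have hκI : ∀ t, κ t ∈ Icc T T' := fun t => ⟨le_max_left _ _, max_le hT (min_le_right _ _)⟩
  have hqm : ∀ t, q (min t T') = q (min t T) + (q (κ t) - q T) := by
    intro t
    rcases le_total t T with ht | ht
    · rw [hκ1 t ht, min_eq_left ht, min_eq_left (ht.trans hT)]; abel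
    · rw [hκ2 t ht, min_eq_right ht]; abel
  have hw : ∀ t t', t ≤ t' → InCone ((q (κ t') - q T) - (q (κ t) - q T)) := fun t t' ht => by
    rw [sub_sub_sub_cancel_right]; exact hq.inCone _ _ (hκm ht)
  have hθ0 : ∀ s, 0 ≤ θ s := fun s => splitRatio_nonneg
  have hθ1 : ∀ s, 0 ≤ 1 - θ s := fun s => sub_nonneg.2 splitRatio_le_one
  have hθc : Continuous θ :=
    (continuous_splitRatio hm (h T)).comp (hX.continuous.comp (by fun_prop : Continuous fun s => (s, T)))
  -- The two extreme flow lines are rigid: the line `s = 0` sits at `0 ∈ K` and receives nothing,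
  -- the line `s = 1` has complement `0 ∈ K'` and receives the whole motion.
  have hθz : θ 0 = 0 := by
    simp [hθ, hX.zero, splitRatio, Metric.infDist_zero_of_mem hK]
  have hθo : θ 1 = 1 := by
    have h3 := h T (q T)
    rw [sub_self, Metric.infDist_zero_of_mem hK', add_zero] at h3
    simp [hθ, hX.one, splitRatio, Metric.infDist_zero_of_mem hK', (hm.trans_le h3).ne']
  have hcompl : ∀ s t, q (min t T') - (X s t + θ s • (q (κ t) - q T)) =
      (q (min t T) - X s t) + (1 - θ s) • (q (κ t) - q T) := by
    intro s t
    rw [hqm t, sub_smul, one_smul]; abel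
  refine ⟨fun s t => X s t + θ s • (q (κ t) - q T), ?_, ?_, ?_, ?_, ?_, ?_, ?_, ?_, ?_, ?_⟩
  · have h1 := hX.continuous
    have h2 := hq.continuous
    have h3 : Continuous κ := by fun_prop
    fun_prop
  · intro s hs t t' ht
    have := (hX.inCone s hs t t' ht).add ((hw t t' ht).smul (hθ0 s))
    convert this using 1
    rw [smul_sub (θ s) (_ - _) (_ - _)]; abel
  · intro s hs t t' ht
    have := (hX.inCone_compl s hs t t' ht).add ((hw t t' ht).smul (hθ1 s))
    simp only [hcompl]
    convert this using 1
    rw [smul_sub (1 - θ s) (_ - _) (_ - _)]; abel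
  · intro s t ht
    simp only [hX.left s t ht, hκ1 t (ht.trans h0), hκ1 0 h0]
  · intro s t ht
    simp only [hX.right s t (hT.trans ht), hX.right s T' hT, hκ2 t (hT.trans ht), hκ2 T' hT,
      min_eq_right ht, min_self]
  · intro s hs t
    rcases le_total t T with ht | ht
    · simpa [hκ1 t ht] using hX.pos s hs t
    · simp only [hX.right s t ht]
      exact infDist_add_smul_pos (hθ0 s) (mul_splitRatio_le hm (h T _)) (hX.pos s hs T)
        (hd _ (hκI t))
  · intro s hs t
    simp only [hcompl]
    rcases le_total t T with ht | ht
    · simpa [hκ1 t ht] using hX.pos_compl s hs t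
    · have h5 := hX.pos_compl s hs T
      rw [min_self] at h5
      simp only [hX.right s t ht, min_eq_right ht]
      exact infDist_add_smul_pos (hθ1 s) (mul_one_sub_splitRatio_le hm (h T _)) h5
        (hd _ (hκI t))
  · intro t
    simp [hX.zero, hθz]
  · intro t
    simp only [hX.one, hθo, one_smul, hqm t]
  · intro s
    simp [hX.init, hκ1 0 h0]

theorem IsFlow.exists_flow {q : ℝ → ℝ × ℂ} (hq : IsCausal q)
    (hK : (0 : ℝ × ℂ) ∈ K) (hK' : (0 : ℝ × ℂ) ∈ K') {m : ℝ} (hm : 0 < m)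
    (h : ∀ t p, m ≤ Metric.infDist p K + Metric.infDist (q t - p) K')
    (h1 : ∀ s ∈ Ioc (0 : ℝ) 1, 0 < Metric.infDist (s • q 0) K)
    (h2 : ∀ s ∈ Ioc (0 : ℝ) 1, 0 < Metric.infDist (s • q 0) K') :
    ∃ X, IsFlow K K' q 1 X := by
  -- The margin `m` does not depend on the step, so uniform continuity of `q` makes `N + 1` equal
  -- steps suffice.
  have huc := (isCompact_Icc (a := (0 : ℝ)) (b := 1)).uniformContinuousOn_of_continuous
    hq.continuous.continuousOn
  obtain ⟨δ, hδ, hd⟩ := Metric.uniformContinuousOn_iff.1 huc (m / 2) (by linarith)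
  obtain ⟨N, hN⟩ := exists_nat_one_div_lt hδ
  have hN1 : (0 : ℝ) < N + 1 := by positivity
  have key : ∀ k : ℕ, k ≤ N + 1 → ∃ X, IsFlow K K' q (k / (N + 1)) X := by
    intro k
    induction k with
    | zero => intro _; simpa using IsFlow.exists_zero hq h1 h2
    | succ k ih =>
      intro hk
      obtain ⟨X, hX⟩ := ih (by omega)
      have hkN : ((k + 1 : ℕ) : ℝ) ≤ N + 1 := by exact_mod_cast hk
      have e1 : ((k + 1 : ℕ) : ℝ) / (N + 1) = k / (N + 1) + 1 / (N + 1) := by push_cast; ring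
      have e2 : ((k + 1 : ℕ) : ℝ) / (N + 1) ≤ 1 := div_le_one_of_le₀ hkN hN1.le
      have e3 : (0 : ℝ) ≤ k / (N + 1) := by positivity
      have e4 : (0 : ℝ) < 1 / (N + 1) := by positivity
      refine hX.step hq hK hK' hm h e3 (by linarith) fun t ht => ?_
      have := hd t ⟨e3.trans ht.1, ht.2.trans e2⟩ (k / (N + 1)) ⟨e3, by linarith⟩ (by
        rw [Real.dist_eq, abs_of_nonneg (by linarith [ht.1])]
        linarith [ht.2])
      rw [dist_eq_norm] at this
      exact this.le
  have := key (N + 1) le_rfl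
  rwa [Nat.cast_add, Nat.cast_one, div_self hN1.ne'] at this

/-- Almost nearest points `a ∈ K` to `p` and `b ∈ K'` to `z - p` add up to a point of `K''` close to
`z`. This is the only use of additivity of the singular sets: `p` and `z - p` cannot both approach
their obstacles while `z` stays away from `K''`. -/
theorem le_infDist_add_infDist {K'' : Set (ℝ × ℂ)} (hK : K.Nonempty) (hK' : K'.Nonempty)
    (hadd : ∀ a ∈ K, ∀ b ∈ K', a + b ∈ K'') {z : ℝ × ℂ} (p : ℝ × ℂ) :
    Metric.infDist z K'' ≤ Metric.infDist p K + Metric.infDist (z - p) K' := by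
  by_contra! hlt
  have h1 : Metric.infDist p K < Metric.infDist z K'' - Metric.infDist (z - p) K' := by linarith
  obtain ⟨a, ha, hpa⟩ := (Metric.infDist_lt_iff hK).1 h1
  have h2 : Metric.infDist (z - p) K' < Metric.infDist z K'' - dist p a := by linarith
  obtain ⟨b, hb, hpb⟩ := (Metric.infDist_lt_iff hK').1 h2
  have h3 := Metric.infDist_le_dist_of_mem (hadd a ha b hb) (x := z)
  have h4 : dist z (a + b) ≤ dist p a + dist (z - p) b := by
    rw [dist_eq_norm, dist_eq_norm, dist_eq_norm]
    calc ‖z - (a + b)‖ = ‖(p - a) + (z - p - b)‖ := by congr 1; abel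
      _ ≤ _ := norm_add_le _ _
  linarith

theorem IsCausal.exists_le_infDist {q : ℝ → ℝ × ℂ} (hq : IsCausal q) (hK : IsClosed K)
    (hne : K.Nonempty) (h : ∀ t, q t ∉ K) : ∃ m > 0, ∀ t, m ≤ Metric.infDist (q t) K := by
  have hc : ContinuousOn (fun t => Metric.infDist (q t) K) (Icc 0 1) :=
    ((Metric.continuous_infDist_pt K).comp hq.continuous).continuousOn
  obtain ⟨t₀, ht₀, hmin⟩ := isCompact_Icc.exists_isMinOn ⟨0, by simp⟩ hc
  refine ⟨_, (hK.notMem_iff_infDist_pos hne).1 (h t₀), fun t => ?_⟩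
  rcases le_total t 0 with h0 | h0
  · rw [hq.left t h0]; exact hmin ⟨le_rfl, zero_le_one⟩
  rcases le_total t 1 with h1 | h1
  · exact hmin ⟨h0, h1⟩
  · rw [hq.right t h1]; exact hmin ⟨zero_le_one, le_rfl⟩

end causalPaths

/-! ### Integrals along polygonal lines -/

/-- Differentiation under the integral sign. No hypothesis on the `ζ`-derivative is needed: Cauchy's
estimate on discs of radius `r / 2` bounds it by `C / (r / 2)`, where `C` bounds `F` on a compact
set. -/
theorem analyticOnNhd_intervalIntegral {F : ℝ → ℂ → ℂ} {U : Set ℂ} (hU : IsOpen U)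
    (hF : ContinuousOn (fun a : ℝ × ℂ => F a.1 a.2) (Icc 0 1 ×ˢ U))
    (hd : ∀ τ ∈ Icc (0 : ℝ) 1, DifferentiableOn ℂ (F τ) U) :
    AnalyticOnNhd ℂ (fun ζ => ∫ τ in (0 : ℝ)..1, F τ ζ) U := by
  refine DifferentiableOn.analyticOnNhd (fun ζ₀ hζ₀ => ?_) hU
  obtain ⟨r, hr, hrU⟩ := Metric.nhds_basis_closedBall.mem_iff.1 (hU.mem_nhds hζ₀)
  have hcomp : IsCompact (Icc (0 : ℝ) 1 ×ˢ Metric.closedBall ζ₀ r) :=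
    isCompact_Icc.prod (isCompact_closedBall _ _)
  obtain ⟨C, hC⟩ := hcomp.exists_bound_of_continuousOn
    (hF.mono (prod_mono le_rfl hrU))
  have huI : uIoc (0 : ℝ) 1 ⊆ Icc 0 1 := by
    rw [uIoc_of_le zero_le_one]; exact Ioc_subset_Icc_self
  have hcont : ∀ ζ ∈ U, ContinuousOn (fun τ => F τ ζ) (Icc 0 1) := fun ζ hζ =>
    hF.comp (continuousOn_id.prodMk continuousOn_const) fun τ hτ => ⟨hτ, hζ⟩
  have hmeas : ∀ ζ ∈ U, MeasureTheory.AEStronglyMeasurable (fun τ => F τ ζ)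
      (MeasureTheory.volume.restrict (uIoc 0 1)) := fun ζ hζ =>
    ((hcont ζ hζ).mono huI).aestronglyMeasurable measurableSet_uIoc
  have hU2 : ∀ ζ ∈ Metric.ball ζ₀ (r / 2), Metric.closedBall ζ (r / 2) ⊆ Metric.closedBall ζ₀ r := by
    intro ζ hζ
    refine Metric.closedBall_subset_closedBall' ?_
    linarith [Metric.mem_ball.1 hζ]
  have hmem : ∀ ζ ∈ Metric.ball ζ₀ (r / 2), ζ ∈ U := fun ζ hζ =>
    hrU (hU2 ζ hζ (Metric.mem_closedBall_self (by linarith)))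
  have hder : ∀ τ ∈ Icc (0 : ℝ) 1, ∀ ζ ∈ Metric.ball ζ₀ (r / 2),
      HasDerivAt (F τ) (deriv (F τ) ζ) ζ := fun τ hτ ζ hζ =>
    ((hd τ hτ).differentiableAt (hU.mem_nhds (hmem ζ hζ))).hasDerivAt
  refine (intervalIntegral.hasDerivAt_integral_of_dominated_loc_of_deriv_le (𝕜 := ℂ)
    (F := fun ζ τ => F τ ζ) (F' := fun ζ τ => deriv (F τ) ζ) (bound := fun _ => C / (r / 2))
    (Metric.ball_mem_nhds ζ₀ (half_pos hr)) ?_ ?_ ?_ ?_ ?_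
    ?_).2.differentiableAt.differentiableWithinAt
  · filter_upwards [hU.mem_nhds hζ₀] with ζ hζ using hmeas ζ hζ
  · exact (hcont ζ₀ hζ₀).intervalIntegrable_of_Icc zero_le_one
  · -- the derivative is a limit of difference quotients
    obtain ⟨u, hu, hu0⟩ : ∃ u : ℕ → ℂ, (∀ n, ζ₀ + u n ∈ Metric.ball ζ₀ (r / 2) ∧ u n ≠ 0) ∧
        Tendsto u atTop (𝓝 0) := by
      have hpos : ∀ n : ℕ, 0 < r / 2 / (n + 2 : ℝ) := fun n => by positivity
      refine ⟨fun n => ((r / 2 / (n + 2) : ℝ) : ℂ), fun n => ⟨?_, ?_⟩, ?_⟩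
      · rw [Metric.mem_ball, dist_eq_norm, add_sub_cancel_left, Complex.norm_real,
          Real.norm_of_nonneg (hpos n).le]
        refine div_lt_self (by linarith) ?_
        have : (0 : ℝ) ≤ n := n.cast_nonneg
        linarith
      · exact Complex.ofReal_ne_zero.2 (hpos n).ne'
      · have h1 : Tendsto (fun n : ℕ => r / 2 / (n + 2 : ℝ)) atTop (𝓝 0) :=
          Tendsto.div_atTop tendsto_const_nhds
            (tendsto_atTop_add_const_right _ _ tendsto_natCast_atTop_atTop)
        exact (Complex.continuous_ofReal.tendsto' 0 0 (by simp)).comp h1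
    refine aestronglyMeasurable_of_tendsto_ae atTop
      (f := fun n τ => (u n)⁻¹ • (F τ (ζ₀ + u n) - F τ ζ₀))
      (fun n => (((hmeas _ (hmem _ (hu n).1)).sub (hmeas _ hζ₀)).const_smul (u n)⁻¹ :)) ?_
    refine (MeasureTheory.ae_restrict_iff' measurableSet_uIoc).2 (Eventually.of_forall fun τ hτ => ?_)
    have h1 := (hder τ (huI hτ) ζ₀ (Metric.mem_ball_self (half_pos hr))).tendsto_slope_zero
    exact h1.comp (tendsto_nhdsWithin_iff.2 ⟨hu0, Eventually.of_forall fun n => (hu n).2⟩)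
  · refine Eventually.of_forall fun τ hτ ζ hζ => ?_
    refine Complex.norm_deriv_le_of_forall_mem_sphere_norm_le (half_pos hr) ?_ ?_
    · refine ((hd τ (huI hτ)).mono ?_).diffContOnCl (s := Metric.ball ζ (r / 2))
      rw [closure_ball _ (half_pos hr).ne']
      exact (hU2 ζ hζ).trans hrU
    · intro z hz
      exact hC (τ, z) ⟨huI hτ, hU2 ζ hζ (Metric.sphere_subset_closedBall hz)⟩
  · simp
  · exact Eventually.of_forall fun τ hτ ζ hζ => hder τ (huI hτ) ζ hζ

/-- The integral of `u` along the segment `[a, b]`. -/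
def segInt (u : ℂ → ℂ) (a b : ℂ) : ℂ := ∫ τ in (0 : ℝ)..1, u (a + τ * (b - a)) * (b - a)

theorem segment_point_mem {S : Set ℂ} (hS : Convex ℝ S) {a b : ℂ} (ha : a ∈ S) (hb : b ∈ S) {τ : ℝ}
    (hτ : τ ∈ Icc (0 : ℝ) 1) : a + τ * (b - a) ∈ S := by
  have := hS.add_smul_sub_mem ha hb hτ
  simpa using this

theorem segInt_eq_sub {u P : ℂ → ℂ} {S : Set ℂ} (hS : Convex ℝ S) (hu : ContinuousOn u S)
    (hP : ∀ z ∈ S, HasDerivAt P (u z) z) {a b : ℂ} (ha : a ∈ S) (hb : b ∈ S) :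
    segInt u a b = P b - P a := by
  have hd : ∀ τ ∈ uIcc (0 : ℝ) 1,
      HasDerivAt (fun τ : ℝ => P (a + τ * (b - a))) (u (a + τ * (b - a)) * (b - a)) τ := by
    intro τ hτ
    rw [uIcc_of_le zero_le_one] at hτ
    have h1 : HasDerivAt (fun τ : ℝ => a + (τ : ℂ) * (b - a)) (b - a) τ := by
      simpa using ((Complex.ofRealCLM.hasDerivAt (x := τ)).mul_const (b - a)).const_add a
    exact (hP _ (segment_point_mem hS ha hb hτ)).comp τ h1
  have hc : ContinuousOn (fun τ : ℝ => u (a + τ * (b - a)) * (b - a)) (uIcc 0 1) := by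
    rw [uIcc_of_le zero_le_one]
    exact (hu.comp (by fun_prop) fun τ hτ => segment_point_mem hS ha hb hτ).mul continuousOn_const
  have := intervalIntegral.integral_eq_sub_of_hasDerivAt hd hc.intervalIntegrable
  simpa [segInt] using this

theorem segInt_congr {u v : ℂ → ℂ} {S : Set ℂ} (hS : Convex ℝ S) (h : EqOn u v S) {a b : ℂ}
    (ha : a ∈ S) (hb : b ∈ S) : segInt u a b = segInt v a b := by
  refine intervalIntegral.integral_congr fun τ hτ => ?_
  rw [uIcc_of_le zero_le_one] at hτ
  simp only [h (segment_point_mem hS ha hb hτ)]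

/-- Moving the vertices of a polygonal line inside discs of holomorphy does not change the
integral. -/
theorem sum_segInt_eq {M : ℕ} {X : ℕ → ℂ} {R : ℕ → ℝ} {u : ℕ → ℂ → ℂ} {a b : ℕ → ℂ}
    (hu : ∀ j < M, DifferentiableOn ℂ (u j) (Metric.ball (X j) (R j)))
    (ha : ∀ j < M, a j ∈ Metric.ball (X j) (R j) ∧ a (j + 1) ∈ Metric.ball (X j) (R j))
    (hb : ∀ j < M, b j ∈ Metric.ball (X j) (R j) ∧ b (j + 1) ∈ Metric.ball (X j) (R j))
    (heq : ∀ j, j + 1 < M →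
      EqOn (u j) (u (j + 1)) (Metric.ball (X j) (R j) ∩ Metric.ball (X (j + 1)) (R (j + 1))))
    (h0 : a 0 = b 0) (hM : a M = b M) :
    ∑ j ∈ Finset.range M, segInt (u j) (a j) (a (j + 1)) =
      ∑ j ∈ Finset.range M, segInt (u j) (b j) (b (j + 1)) := by
  have hP : ∀ j, ∃ P : ℂ → ℂ, j < M → ∀ z ∈ Metric.ball (X j) (R j), HasDerivAt P (u j z) z := by
    intro j
    by_cases hj : j < M
    · obtain ⟨P, hP⟩ := (hu j hj).isExactOn_ball
      exact ⟨P, fun _ => hP⟩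
    · exact ⟨0, fun h => absurd h hj⟩
  choose P hP using hP
  have hI : ∀ j < M, ∀ x ∈ Metric.ball (X j) (R j), ∀ y ∈ Metric.ball (X j) (R j),
      segInt (u j) x y = P j y - P j x := fun j hj x hx y hy =>
    segInt_eq_sub (convex_ball _ _) (hu j hj).continuousOn (hP j hj) hx hy
  -- the discrepancy at the vertices
  have key : ∀ k, k ≤ M → ∑ j ∈ Finset.range k, segInt (u j) (a j) (a (j + 1)) -
      ∑ j ∈ Finset.range k, segInt (u j) (b j) (b (j + 1)) =
      if k = 0 then 0 else segInt (u (k - 1)) (b k) (a k) := by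
    intro k
    induction k with
    | zero => simp
    | succ k ih =>
      intro hk
      have hk' : k < M := hk
      rw [Finset.sum_range_succ, Finset.sum_range_succ, add_sub_add_comm, ih hk'.le]
      simp only [Nat.succ_ne_zero, if_false, Nat.add_sub_cancel]
      rw [hI k hk' _ (ha k hk').1 _ (ha k hk').2, hI k hk' _ (hb k hk').1 _ (hb k hk').2,
        hI k hk' _ (hb k hk').2 _ (ha k hk').2]
      rcases Nat.eq_zero_or_pos k with rfl | hk0
      · simp [h0]
      · obtain ⟨i, rfl⟩ := Nat.exists_eq_succ_of_ne_zero hk0.ne'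
        simp only [Nat.succ_eq_add_one, Nat.succ_ne_zero, if_false, Nat.add_sub_cancel]
        have hi : i < M := by omega
        -- The discrepancy segment `[b, a]` at this vertex lies in both consecutive discs, so its
        -- integral may be computed with the next function, after which the primitives cancel.
        rw [segInt_congr ((convex_ball _ _).inter (convex_ball _ _)) (heq i hk')
          ⟨(hb i hi).2, (hb _ hk').1⟩ ⟨(ha i hi).2, (ha _ hk').1⟩,
          hI _ hk' _ (hb _ hk').1 _ (ha _ hk').1]
        ring
  have h := key M le_rfl
  rcases Nat.eq_zero_or_pos M with rfl | hM0
  · simp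
  · rw [if_neg hM0.ne', hM] at h
    have : segInt (u (M - 1)) (b M) (b M) = 0 := by simp [segInt]
    rw [this] at h
    exact sub_eq_zero.1 h

/-- The convolution product at `0`. -/
def conv₀ (φ ψ : ℂ → ℂ) (ζ : ℂ) : ℂ := segInt (fun η => φ η * ψ (ζ - η)) 0 ζ

theorem conv_add_center (ω : ℂ) (φ ψ : ℂ → ℂ) (z : ℂ) :
    conv ω φ ψ (ω + z) = conv₀ (fun x => φ (ω + x)) (fun x => ψ (ω + x)) z := by
  simp only [conv, conv₀, segInt]
  refine intervalIntegral.integral_congr fun t _ => ?_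
  simp only [add_sub_cancel_left, sub_zero, zero_add]
  rw [show ω + z + ω - (ω + (t : ℂ) * z) = ω + (z - t * z) by ring]

theorem analyticOnNhd_conv₀ {φ ψ : ℂ → ℂ} {r : ℝ} (hφ : AnalyticOnNhd ℂ φ (Metric.ball 0 r))
    (hψ : AnalyticOnNhd ℂ ψ (Metric.ball 0 r)) : AnalyticOnNhd ℂ (conv₀ φ ψ) (Metric.ball 0 r) := by
  have hm : ∀ τ ∈ Icc (0 : ℝ) 1, ∀ ζ ∈ Metric.ball (0 : ℂ) r, (τ : ℂ) * ζ ∈ Metric.ball (0 : ℂ) r := by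
    intro τ hτ ζ hζ
    rw [mem_ball_zero_iff] at hζ ⊢
    rw [norm_mul, Complex.norm_real, Real.norm_of_nonneg hτ.1]
    exact (mul_le_of_le_one_left (norm_nonneg _) hτ.2).trans_lt hζ
  have hm' : ∀ τ ∈ Icc (0 : ℝ) 1, ∀ ζ ∈ Metric.ball (0 : ℂ) r,
      ζ - (τ : ℂ) * ζ ∈ Metric.ball (0 : ℂ) r := by
    intro τ hτ ζ hζ
    have := hm (1 - τ) ⟨by linarith [hτ.2], by linarith [hτ.1]⟩ ζ hζ
    rwa [Complex.ofReal_sub, sub_mul, Complex.ofReal_one, one_mul] at this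
  have := analyticOnNhd_intervalIntegral (F := fun τ ζ => φ (τ * ζ) * ψ (ζ - τ * ζ) * ζ)
    Metric.isOpen_ball ?_ ?_ (U := Metric.ball 0 r)
  · convert this using 2 with ζ
    simp [conv₀, segInt]
  · refine ContinuousOn.mul (ContinuousOn.mul ?_ ?_) (by fun_prop)
    · exact hφ.continuousOn.comp (by fun_prop) fun a ha => hm a.1 ha.1 a.2 ha.2
    · exact hψ.continuousOn.comp (by fun_prop) fun a ha => hm' a.1 ha.1 a.2 ha.2
  · intro τ hτ
    refine DifferentiableOn.mul (DifferentiableOn.mul ?_ ?_) (by fun_prop)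
    · exact hφ.differentiableOn.comp (by fun_prop) fun a ha => hm τ hτ a ha
    · exact hψ.differentiableOn.comp (by fun_prop) fun a ha => hm' τ hτ a ha

/-! ### Continuation of a convolution product -/

/-- The integral of `G(η) H(ζ - η)` along the polygonal line with vertices `v 0, …, v (M - 1), ζ`,
where the factors `G j`, `H j` are used on the `j`-th segment. -/
def polyConv (M : ℕ) (G H : ℕ → ℂ → ℂ) (v : ℕ → ℂ) (ζ : ℂ) : ℂ :=
  ∑ j ∈ Finset.range M, segInt (fun η => G j η * H j (ζ - η))
    (Function.update v M ζ j) (Function.update v M ζ (j + 1))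

/-- The germs `g s t` at `x s t` and `h s t` at `c t - x s t`, for `t ∈ I`, are given by functions
`G j`, `H j` holomorphic in discs, as long as `s` is in the `j`-th interval of length `1 / M`. -/
structure IsCells (x : ℝ → ℝ → ℂ) (c : ℝ → ℂ) (g h : ℝ → ℝ → ℂ → ℂ) (M : ℕ) (I : Set ℝ)
    (X Y : ℕ → ℂ) (R : ℕ → ℝ) (G H : ℕ → ℂ → ℂ) : Prop where
  pos : ∀ j < M, 0 < R j
  left : ∀ j < M, AnalyticOnNhd ℂ (G j) (Metric.ball (X j) (R j))
  right : ∀ j < M, AnalyticOnNhd ℂ (H j) (Metric.ball (Y j) (R j))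
  mem_left : ∀ j < M, ∀ s ∈ Icc ((j : ℝ) / M) ((j + 1 : ℕ) / M), ∀ t ∈ I,
    x s t ∈ Metric.ball (X j) (R j / 16)
  mem_right : ∀ j < M, ∀ s ∈ Icc ((j : ℝ) / M) ((j + 1 : ℕ) / M), ∀ t ∈ I,
    c t - x s t ∈ Metric.ball (Y j) (R j / 16)
  germ_left : ∀ j < M, ∀ s ∈ Icc ((j : ℝ) / M) ((j + 1 : ℕ) / M), ∀ t ∈ I,
    g s t =ᶠ[𝓝 (x s t)] G j
  germ_right : ∀ j < M, ∀ s ∈ Icc ((j : ℝ) / M) ((j + 1 : ℕ) / M), ∀ t ∈ I,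
    h s t =ᶠ[𝓝 (c t - x s t)] H j

theorem eqOn_inter_ball {f g : ℂ → ℂ} {x y z : ℂ} {r r' : ℝ}
    (hf : AnalyticOnNhd ℂ f (Metric.ball x r)) (hg : AnalyticOnNhd ℂ g (Metric.ball y r'))
    (h : f =ᶠ[𝓝 z] g) (hz : z ∈ Metric.ball x r) (hz' : z ∈ Metric.ball y r') :
    EqOn f g (Metric.ball x r ∩ Metric.ball y r') :=
  (hf.mono inter_subset_left).eqOn_of_preconnected_of_eventuallyEq (hg.mono inter_subset_right)
    ((convex_ball _ _).inter (convex_ball _ _)).isPreconnected ⟨hz, hz'⟩ h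

namespace IsCells

variable {x : ℝ → ℝ → ℂ} {c : ℝ → ℂ} {g h : ℝ → ℝ → ℂ → ℂ} {M : ℕ} {I : Set ℝ}
  {X Y : ℕ → ℂ} {R : ℕ → ℝ} {G H : ℕ → ℂ → ℂ}

theorem left_mem (j : ℕ) : (j : ℝ) / M ∈ Icc ((j : ℝ) / M) ((j + 1 : ℕ) / M) :=
  ⟨le_rfl, by gcongr; simp⟩

theorem right_mem (j : ℕ) : ((j + 1 : ℕ) : ℝ) / M ∈ Icc ((j : ℝ) / M) ((j + 1 : ℕ) / M) :=
  ⟨by gcongr; simp, le_rfl⟩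

theorem eventually_close (hC : IsCells x c g h M I X Y R G H) (z : ℂ) :
    ∀ᶠ ζ in 𝓝 z, ∀ j ∈ Finset.range M, ζ ∈ Metric.ball z (R j / 16) :=
  (Filter.eventually_all_finset _).2 fun j hj => Metric.ball_mem_nhds _
    (by linarith [hC.pos j (Finset.mem_range.1 hj)])

/-- The last vertex is replaced by `ζ`, which is within `R j / 16` of `c t = x 1 t`, itself within
`R j / 16` of the centre; the other vertices are grid points. The vertices may be taken at a time
`T` other than the time `t` of the end. -/
theorem vertex_mem (hC : IsCells x c g h M I X Y R G H) (hx1 : ∀ t, x 1 t = c t) {t T : ℝ}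
    (ht : t ∈ I) (hT : T ∈ I) {j : ℕ} (hj : j < M) {ζ : ℂ} (hζ : ζ ∈ Metric.ball (c t) (R j / 16)) :
    Function.update (fun i : ℕ => x (i / M) T) M ζ j ∈ Metric.ball (X j) (R j / 2) ∧
    Function.update (fun i : ℕ => x (i / M) T) M ζ (j + 1) ∈ Metric.ball (X j) (R j / 2) := by
  have hR := hC.pos j hj
  have hsub : Metric.ball (X j) (R j / 16) ⊆ Metric.ball (X j) (R j / 2) :=
    Metric.ball_subset_ball (by linarith)
  constructor
  · rw [Function.update_of_ne hj.ne]
    exact hsub (hC.mem_left j hj _ (left_mem j) T hT)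
  · by_cases hjM : j + 1 = M
    · have h1 := hC.mem_left j hj _ (right_mem j) t ht
      have hM : (M : ℝ) ≠ 0 := by exact_mod_cast (Nat.zero_lt_of_lt hj).ne'
      rw [hjM, div_self hM, hx1] at h1
      rw [hjM, Function.update_self]
      rw [Metric.mem_ball] at *
      linarith [dist_triangle ζ (c t) (X j)]
    · rw [Function.update_of_ne hjM]
      exact hsub (hC.mem_left j hj _ (right_mem j) T hT)

/-- Three errors of at most `R j / 16` are added to `R j / 2`, for a total below `R j`: the second
factor is defined at `ζ - η` all along the `j`-th segment. -/
theorem sub_mem (hC : IsCells x c g h M I X Y R G H) {t : ℝ} (ht : t ∈ I) {j : ℕ} (hj : j < M)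
    {ζ η : ℂ} (hζ : ζ ∈ Metric.ball (c t) (R j / 16)) (hη : η ∈ Metric.ball (X j) (R j / 2)) :
    ζ - η ∈ Metric.ball (Y j) (R j) := by
  have h1 := hC.mem_left j hj _ (left_mem j) t ht
  have h2 := hC.mem_right j hj _ (left_mem j) t ht
  have hR := hC.pos j hj
  simp only [Metric.mem_ball, dist_eq_norm] at *
  calc ‖ζ - η - Y j‖ = ‖(ζ - c t) + (c t - x (j / M) t - Y j) + (x (j / M) t - X j) - (η - X j)‖ := by
        congr 1; ring
    _ ≤ ‖ζ - c t‖ + ‖c t - x (j / M) t - Y j‖ + ‖x (j / M) t - X j‖ + ‖η - X j‖ :=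
        (norm_sub_le _ _).trans (add_le_add_left (norm_add₃_le) _)
    _ < _ := by linarith

theorem differentiable_update (v : ℕ → ℂ) (M j : ℕ) :
    Differentiable ℂ fun ζ => Function.update v M ζ j := by
  by_cases h : j = M
  · subst h; simp
  · simp [Function.update_of_ne h]

theorem analyticAt_polyConv (hC : IsCells x c g h M I X Y R G H) (hx1 : ∀ t, x 1 t = c t) {t T : ℝ}
    (ht : t ∈ I) (hT : T ∈ I) :
    AnalyticAt ℂ (polyConv M G H fun i => x (i / M) T) (c t) := by
  refine Finset.analyticAt_fun_sum _ fun j hj => ?_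
  have hj := Finset.mem_range.1 hj
  have hR := hC.pos j hj
  set v : ℂ → ℕ → ℂ := fun ζ => Function.update (fun i : ℕ => x (i / M) T) M ζ with hv
  have hvd : ∀ j, Differentiable ℂ fun ζ => v ζ j := fun j => differentiable_update _ M j
  have hvc : ∀ j, Continuous fun ζ => v ζ j := fun j => (hvd j).continuous
  have hp : ∀ τ ∈ Icc (0 : ℝ) 1, ∀ ζ ∈ Metric.ball (c t) (R j / 16),
      v ζ j + τ * (v ζ (j + 1) - v ζ j) ∈ Metric.ball (X j) (R j / 2) := fun τ hτ ζ hζ =>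
    segment_point_mem (convex_ball _ _) (hC.vertex_mem hx1 ht hT hj hζ).1
      (hC.vertex_mem hx1 ht hT hj hζ).2 hτ
  have hsub : Metric.ball (X j) (R j / 2) ⊆ Metric.ball (X j) (R j) :=
    Metric.ball_subset_ball (by linarith)
  refine analyticOnNhd_intervalIntegral (U := Metric.ball (c t) (R j / 16)) Metric.isOpen_ball
    (F := fun τ ζ => G j (v ζ j + τ * (v ζ (j + 1) - v ζ j)) *
      H j (ζ - (v ζ j + τ * (v ζ (j + 1) - v ζ j))) * (v ζ (j + 1) - v ζ j)) ?_ ?_ _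
      (Metric.mem_ball_self (by linarith))
  · have h1 := hvc j
    have h2 := hvc (j + 1)
    have h3 : Continuous fun a : ℝ × ℂ => v a.2 j + a.1 * (v a.2 (j + 1) - v a.2 j) := by fun_prop
    refine ContinuousOn.mul (ContinuousOn.mul ?_ ?_) (by fun_prop)
    · exact (hC.left j hj).continuousOn.comp h3.continuousOn fun a ha =>
        hsub (hp a.1 ha.1 a.2 ha.2)
    · exact (hC.right j hj).continuousOn.comp (continuous_snd.sub h3).continuousOn fun a ha =>
        hC.sub_mem ht hj ha.2 (hp a.1 ha.1 a.2 ha.2)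
  · intro τ hτ
    have h1 := hvd j
    have h2 := hvd (j + 1)
    have h3 : Differentiable ℂ fun ζ => v ζ j + τ * (v ζ (j + 1) - v ζ j) := by fun_prop
    refine DifferentiableOn.mul (DifferentiableOn.mul ?_ ?_) (h2.sub h1).differentiableOn
    · exact (hC.left j hj).differentiableOn.comp h3.differentiableOn fun a ha =>
        hsub (hp τ hτ a ha)
    · exact (hC.right j hj).differentiableOn.comp (differentiable_id.sub h3).differentiableOn
        fun a ha => hC.sub_mem ht hj ha (hp τ hτ a ha)

/-- Within one time cell the vertices move inside fixed discs. The integrands of neighbouring cells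
agree on overlaps, since both continue the germ at the common parameter `(j + 1) / M`, so Cauchy's
theorem applies. -/
theorem polyConv_shift (hC : IsCells x c g h M I X Y R G H) (hx0 : ∀ t, x 0 t = 0)
    (hx1 : ∀ t, x 1 t = c t) {t T T' : ℝ} (ht : t ∈ I) (hT : T ∈ I) (hT' : T' ∈ I) :
    polyConv M G H (fun i => x (i / M) T) =ᶠ[𝓝 (c t)] polyConv M G H (fun i => x (i / M) T') := by
  filter_upwards [hC.eventually_close (c t)] with ζ hζ
  replace hζ := fun j hj => hζ j (Finset.mem_range.2 hj)
  have hsub : ∀ j < M, Metric.ball (X j) (R j / 2) ⊆ Metric.ball (X j) (R j) := fun j hj =>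
    Metric.ball_subset_ball (by linarith [hC.pos j hj])
  have hsub' : ∀ j < M, Metric.ball (X j) (R j / 16) ⊆ Metric.ball (X j) (R j) := fun j hj =>
    Metric.ball_subset_ball (by linarith [hC.pos j hj])
  have hsub'' : ∀ j < M, Metric.ball (Y j) (R j / 16) ⊆ Metric.ball (Y j) (R j) := fun j hj =>
    Metric.ball_subset_ball (by linarith [hC.pos j hj])
  refine sum_segInt_eq (X := X) (R := fun j => R j / 2) (fun j hj => ?_)
    (fun j hj => hC.vertex_mem hx1 ht hT hj (hζ j hj))
    (fun j hj => hC.vertex_mem hx1 ht hT' hj (hζ j hj)) (fun j hj => ?_) ?_ ?_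
  · refine ((hC.left j hj).differentiableOn.mono (hsub j hj)).mul ?_
    exact (hC.right j hj).differentiableOn.comp (by fun_prop) fun η hη => hC.sub_mem ht hj (hζ j hj) hη
  · intro η hη
    have hj' : j < M := by omega
    have m1 := right_mem (M := M) j
    have m2 := left_mem (M := M) (j + 1)
    have e1 := eqOn_inter_ball (hC.left j hj') (hC.left _ hj)
      ((hC.germ_left j hj' _ m1 t ht).symm.trans (hC.germ_left _ hj _ m2 t ht))
      (hsub' j hj' (hC.mem_left j hj' _ m1 t ht)) (hsub' _ hj (hC.mem_left _ hj _ m2 t ht))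
      ⟨hsub j hj' hη.1, hsub _ hj hη.2⟩
    have e2 := eqOn_inter_ball (hC.right j hj') (hC.right _ hj)
      ((hC.germ_right j hj' _ m1 t ht).symm.trans (hC.germ_right _ hj _ m2 t ht))
      (hsub'' j hj' (hC.mem_right j hj' _ m1 t ht)) (hsub'' _ hj (hC.mem_right _ hj _ m2 t ht))
      ⟨hC.sub_mem ht hj' (hζ j hj') hη.1, hC.sub_mem ht hj (hζ _ hj) hη.2⟩
    simp only [e1, e2]
  · rcases Nat.eq_zero_or_pos M with h0 | h0
    · simp [h0]
    · simp [Function.update_of_ne h0.ne, hx0]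
  · simp

/-- At a time common to two cells the vertices are the same, and the two choices of functions extend
the same germs at `x (j / M) T` and `c T - x (j / M) T`. -/
theorem polyConv_change (hC : IsCells x c g h M I X Y R G H) {I' : Set ℝ} {X' Y' : ℕ → ℂ}
    {R' : ℕ → ℝ} {G' H' : ℕ → ℂ → ℂ} (hC' : IsCells x c g h M I' X' Y' R' G' H')
    (hx1 : ∀ t, x 1 t = c t) {T : ℝ} (hT : T ∈ I) (hT' : T ∈ I') :
    polyConv M G H (fun i => x (i / M) T) =ᶠ[𝓝 (c T)] polyConv M G' H' (fun i => x (i / M) T) := by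
  filter_upwards [hC.eventually_close (c T), hC'.eventually_close (c T)] with ζ hζ hζ'
  replace hζ := fun j hj => hζ j (Finset.mem_range.2 hj)
  replace hζ' := fun j hj => hζ' j (Finset.mem_range.2 hj)
  refine Finset.sum_congr rfl fun j hj => ?_
  have hj := Finset.mem_range.1 hj
  have hR := hC.pos j hj
  have hR' := hC'.pos j hj
  have v1 := hC.vertex_mem hx1 hT hT hj (hζ j hj)
  have v2 := hC'.vertex_mem hx1 hT' hT' hj (hζ' j hj)
  have m1 := left_mem (M := M) j
  refine segInt_congr ((convex_ball (X j) (R j / 2)).inter (convex_ball (X' j) (R' j / 2)))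
    (fun η hη => ?_) ⟨v1.1, v2.1⟩ ⟨v1.2, v2.2⟩
  have e1 := eqOn_inter_ball (hC.left j hj) (hC'.left j hj)
    ((hC.germ_left j hj _ m1 T hT).symm.trans (hC'.germ_left j hj _ m1 T hT'))
    (Metric.ball_subset_ball (by linarith) (hC.mem_left j hj _ m1 T hT))
    (Metric.ball_subset_ball (by linarith) (hC'.mem_left j hj _ m1 T hT'))
    ⟨Metric.ball_subset_ball (by linarith) hη.1, Metric.ball_subset_ball (by linarith) hη.2⟩
  have e2 := eqOn_inter_ball (hC.right j hj) (hC'.right j hj)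
    ((hC.germ_right j hj _ m1 T hT).symm.trans (hC'.germ_right j hj _ m1 T hT'))
    (Metric.ball_subset_ball (by linarith) (hC.mem_right j hj _ m1 T hT))
    (Metric.ball_subset_ball (by linarith) (hC'.mem_right j hj _ m1 T hT'))
    ⟨hC.sub_mem hT hj (hζ j hj) hη.1, hC'.sub_mem hT' hj (hζ' j hj) hη.2⟩
  simp only [e1, e2]

/-- At time `0` the grid points lie on the segment `[0, c 0]` and the germs are `φ` and `ψ`
themselves. The integrand then has one primitive on a disc containing all the vertices, and the sum
telescopes. -/
theorem polyConv_init (hC : IsCells x c g h M I X Y R G H) (hM : 0 < M) {φ ψ : ℂ → ℂ} {r : ℝ}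
    (hφ : AnalyticOnNhd ℂ φ (Metric.ball 0 r)) (hψ : AnalyticOnNhd ℂ ψ (Metric.ball 0 r))
    (hx1 : ∀ t, x 1 t = c t) (hI : 0 ∈ I) (hc : ‖c 0‖ < r)
    (hx : ∀ s ∈ Icc (0 : ℝ) 1, x s 0 = s * c 0)
    (hg : ∀ s ∈ Icc (0 : ℝ) 1, g s 0 =ᶠ[𝓝 (x s 0)] φ)
    (hh : ∀ s ∈ Icc (0 : ℝ) 1, h s 0 =ᶠ[𝓝 (c 0 - x s 0)] ψ) :
    polyConv M G H (fun i => x (i / M) 0) =ᶠ[𝓝 (c 0)] conv₀ φ ψ := by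
  have hM' : (0 : ℝ) < M := by exact_mod_cast hM
  have hjI : ∀ j ≤ M, (j : ℝ) / M ∈ Icc (0 : ℝ) 1 := fun j hj =>
    ⟨by positivity, div_le_one_of_le₀ (by exact_mod_cast hj) hM'.le⟩
  -- The disc centred at the midpoint `ζ / 2` is invariant under `η ↦ ζ - η`, and the radius `r -
  -- ‖ζ‖ / 2` keeps it inside `D(0, r)`; both factors are therefore holomorphic on it.
  have hball : ∀ {ζ η : ℂ}, η ∈ Metric.ball (ζ / 2) (r - ‖ζ‖ / 2) →
      η ∈ Metric.ball 0 r ∧ ζ - η ∈ Metric.ball 0 r := by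
    intro ζ η hη
    rw [Metric.mem_ball, dist_eq_norm] at hη
    simp only [mem_ball_zero_iff]
    have e : ‖ζ / 2‖ = ‖ζ‖ / 2 := by simp
    have h1 := norm_add_le (η - ζ / 2) (ζ / 2)
    have h2 := norm_sub_le (ζ / 2) (η - ζ / 2)
    rw [sub_add_cancel] at h1
    rw [show ζ / 2 - (η - ζ / 2) = ζ - η by ring] at h2
    constructor <;> linarith
  have hvert : ∀ᶠ ζ in 𝓝 (c 0), ∀ j ∈ Finset.range M,
      x (j / M) 0 ∈ Metric.ball (ζ / 2) (r - ‖ζ‖ / 2) := by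
    refine (Filter.eventually_all_finset _).2 fun j hj => ?_
    have hs := hjI j (Finset.mem_range.1 hj).le
    have hlt : dist (x (j / M) 0) (c 0 / 2) < r - ‖c 0‖ / 2 := by
      rw [hx _ hs, dist_eq_norm, show ((j / M : ℝ) : ℂ) * c 0 - c 0 / 2 =
        ((j / M - 1 / 2 : ℝ) : ℂ) * c 0 by push_cast; ring, norm_mul, Complex.norm_real]
      have h1 : ‖(j / M - 1 / 2 : ℝ)‖ ≤ 1 / 2 := by
        rw [Real.norm_eq_abs, abs_le]; constructor <;> linarith [hs.1, hs.2]
      nlinarith [norm_nonneg (c 0)]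
    have hcont : Continuous fun ζ : ℂ => r - ‖ζ‖ / 2 - dist (x (j / M) 0) (ζ / 2) := by fun_prop
    filter_upwards [hcont.continuousAt.eventually (lt_mem_nhds (sub_pos.2 hlt))] with ζ hζ
    rw [Metric.mem_ball]; linarith
  filter_upwards [hC.eventually_close (c 0), hvert,
    Metric.isOpen_ball.mem_nhds (mem_ball_zero_iff.2 hc)] with ζ hζ hv hζr
  rw [mem_ball_zero_iff] at hζr
  set v := Function.update (fun i : ℕ => x (i / M) 0) M ζ with hvdef
  have hζm : ζ ∈ Metric.ball (ζ / 2) (r - ‖ζ‖ / 2) := by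
    rw [Metric.mem_ball, dist_eq_norm, show ζ - ζ / 2 = ζ / 2 by ring, norm_div]
    simp only [Complex.norm_ofNat]
    linarith
  have hvm : ∀ j ≤ M, v j ∈ Metric.ball (ζ / 2) (r - ‖ζ‖ / 2) := by
    intro j hj
    rcases hj.eq_or_lt with rfl | hj
    · rw [hvdef, Function.update_self]; exact hζm
    · rw [hvdef, Function.update_of_ne hj.ne]; exact hv j (Finset.mem_range.2 hj)
  have hdiff : DifferentiableOn ℂ (fun η => φ η * ψ (ζ - η)) (Metric.ball (ζ / 2) (r - ‖ζ‖ / 2)) :=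
    (hφ.differentiableOn.mono fun η hη => (hball hη).1).mul
      (hψ.differentiableOn.comp (by fun_prop) fun η hη => (hball hη).2)
  obtain ⟨P, hP⟩ := hdiff.isExactOn_ball
  have h1 : polyConv M G H (fun i => x (i / M) 0) ζ =
      ∑ j ∈ Finset.range M, (P (v (j + 1)) - P (v j)) := by
    refine Finset.sum_congr rfl fun j hj => ?_
    have hζj := hζ j hj
    have hj := Finset.mem_range.1 hj
    have hR := hC.pos j hj
    have v1 := hC.vertex_mem hx1 hI hI hj hζj
    have m1 := left_mem (M := M) j
    have hs := hjI j hj.le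
    rw [← segInt_eq_sub (convex_ball _ _) hdiff.continuousOn hP (hvm j hj.le) (hvm (j + 1) hj)]
    refine segInt_congr ((convex_ball (X j) (R j / 2)).inter (convex_ball (ζ / 2) (r - ‖ζ‖ / 2)))
      (fun η hη => ?_) ⟨v1.1, hvm j hj.le⟩ ⟨v1.2, hvm (j + 1) hj⟩
    have hx0 := hball (hv j (Finset.mem_range.2 hj))
    have hn : x (j / M) 0 ∈ Metric.ball 0 r ∧ c 0 - x (j / M) 0 ∈ Metric.ball 0 r := by
      refine ⟨hx0.1, ?_⟩
      rw [hx _ hs, mem_ball_zero_iff, show c 0 - ((j / M : ℝ) : ℂ) * c 0 =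
        ((1 - j / M : ℝ) : ℂ) * c 0 by push_cast; ring, norm_mul, Complex.norm_real,
        Real.norm_of_nonneg (by linarith [hs.2])]
      exact (mul_le_of_le_one_left (norm_nonneg _) (by linarith [hs.1])).trans_lt hc
    have e1 := eqOn_inter_ball (hC.left j hj) hφ
      ((hC.germ_left j hj _ m1 0 hI).symm.trans (hg _ hs))
      (Metric.ball_subset_ball (by linarith) (hC.mem_left j hj _ m1 0 hI)) hn.1
      ⟨Metric.ball_subset_ball (by linarith) hη.1, (hball hη.2).1⟩
    have e2 := eqOn_inter_ball (hC.right j hj) hψ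
      ((hC.germ_right j hj _ m1 0 hI).symm.trans (hh _ hs))
      (Metric.ball_subset_ball (by linarith) (hC.mem_right j hj _ m1 0 hI)) hn.2
      ⟨hC.sub_mem hI hj hζj hη.1, (hball hη.2).2⟩
    simp only [e1, e2]
  have hv0 : v 0 = 0 := by
    rw [hvdef, Function.update_of_ne hM.ne]
    simpa using hx 0 ⟨le_rfl, zero_le_one⟩
  rw [h1, Finset.sum_range_sub (fun j => P (v j)), hv0, conv₀,
    segInt_eq_sub (convex_ball _ _) hdiff.continuousOn hP (hv0 ▸ hvm 0 hM.le) hζm,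
    hvdef, Function.update_self]

end IsCells

/-- The germ `φ` at `0`, holomorphic in `D(0, r)`, can be continued along every causal path which
starts in that disc and avoids `K`. -/
def HasContinuation (K : Set (ℝ × ℂ)) (r : ℝ) (φ : ℂ → ℂ) : Prop :=
  ∀ q, IsCausal q → (∀ t, q t ∉ K) → InCone (q 0) → (q 0).1 < r →
    ∃ f, IsContinuationOn (fun t => (q t).2) f univ ∧ f 0 =ᶠ[𝓝 (q 0).2] φ

theorem eventually_initial {P : Type*} [TopologicalSpace P] {x : P → ℂ} {f : P → ℂ → ℂ} {φ : ℂ → ℂ}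
    (hx : Continuous x) (h : ∀ p, f p =ᶠ[𝓝 (x p)] φ) (p₀ : P) :
    ∀ᶠ p in 𝓝 p₀, f p =ᶠ[𝓝 (x p)] f p₀ := by
  filter_upwards [eventually_eventuallyEq_comp (h p₀) (hx.tendsto p₀)] with p hp
  exact (h p).trans hp.symm

/-- By coherence, each point of the square has a neighbourhood `W a` on which the germs come from
those at `a` and the positions move by less than `r a / 16`. A mesh below the Lebesgue number of
this cover puts every cell inside one `W a`. -/
theorem IsCells.exists_grid {x : ℝ → ℝ → ℂ} {c : ℝ → ℂ} {g h : ℝ → ℝ → ℂ → ℂ}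
    (hx : Continuous fun a : ℝ × ℝ => x a.1 a.2) (hc : Continuous c)
    (hg : ∀ s, IsContinuationOn (x s) (g s) univ)
    (hh : ∀ s, IsContinuationOn (fun t => c t - x s t) (h s) univ)
    (hg0 : ∀ s₀, ∀ᶠ s in 𝓝 s₀, g s 0 =ᶠ[𝓝 (x s 0)] g s₀ 0)
    (hh0 : ∀ s₀, ∀ᶠ s in 𝓝 s₀, h s 0 =ᶠ[𝓝 (c 0 - x s 0)] h s₀ 0) :
    ∃ M : ℕ, 0 < M ∧ ∀ k : ℕ, ∃ (X Y : ℕ → ℂ) (R : ℕ → ℝ) (G H : ℕ → ℂ → ℂ), k < M →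
      IsCells x c g h M (Icc ((k : ℝ) / M) ((k + 1 : ℕ) / M)) X Y R G H := by
  have hy : Continuous fun a : ℝ × ℝ => c a.2 - x a.1 a.2 := by fun_prop
  have hr : ∀ a : ℝ × ℝ, ∃ r > 0, AnalyticOnNhd ℂ (g a.1 a.2) (Metric.ball (x a.1 a.2) r) ∧
      AnalyticOnNhd ℂ (h a.1 a.2) (Metric.ball (c a.2 - x a.1 a.2) r) := by
    intro a
    obtain ⟨r, hr, h1⟩ := exists_ball_of_analyticAt (hg a.1 a.2 trivial).1
    obtain ⟨r', hr', h2⟩ := exists_ball_of_analyticAt (hh a.1 a.2 trivial).1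
    exact ⟨min r r', lt_min hr hr', h1.mono (Metric.ball_subset_ball (min_le_left _ _)),
      h2.mono (Metric.ball_subset_ball (min_le_right _ _))⟩
  choose r hr0 hr1 hr2 using hr
  set W : ℝ × ℝ → Set (ℝ × ℝ) := fun a => {b | x b.1 b.2 ∈ Metric.ball (x a.1 a.2) (r a / 16) ∧
    c b.2 - x b.1 b.2 ∈ Metric.ball (c a.2 - x a.1 a.2) (r a / 16) ∧
    g b.1 b.2 =ᶠ[𝓝 (x b.1 b.2)] g a.1 a.2 ∧ h b.1 b.2 =ᶠ[𝓝 (c b.2 - x b.1 b.2)] h a.1 a.2}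
    with hWdef
  have hW : ∀ a, W a ∈ 𝓝 a := by
    intro a
    have hra : 0 < r a / 16 := by linarith [hr0 a]
    filter_upwards [hx.continuousAt.eventually_mem (Metric.ball_mem_nhds _ hra),
      hy.continuousAt.eventually_mem (Metric.ball_mem_nhds _ hra),
      IsContinuationOn.coherent hx hg a.1 (hg0 a.1) a.2,
      IsContinuationOn.coherent (c := fun s t => c t - x s t) hy hh a.1 (hh0 a.1) a.2]
      with b h1 h2 h3 h4 using ⟨h1, h2, h3, h4⟩
  obtain ⟨δ, hδ, hδW⟩ := lebesgue_number_lemma_of_metric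
    (isCompact_Icc (a := (0 : ℝ × ℝ)) (b := 1)) (fun a => isOpen_interior (s := W a))
    (fun a _ => mem_iUnion.2 ⟨a, mem_interior_iff_mem_nhds.2 (hW a)⟩)
  obtain ⟨N, hN⟩ := exists_nat_one_div_lt hδ
  have hM0 : (0 : ℝ) < (N + 1 : ℕ) := by positivity
  rw [← Nat.cast_succ] at hN
  refine ⟨N + 1, N.succ_pos, fun k => ?_⟩
  -- The index bounds are kept inside the existential so that `choose` yields a function of all `j`;
  -- the value outside the grid is arbitrary.
  have hcell : ∀ j : ℕ, ∃ a, k < N + 1 → j < N + 1 →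
      ∀ s ∈ Icc ((j : ℝ) / (N + 1 : ℕ)) ((j + 1 : ℕ) / (N + 1 : ℕ)),
      ∀ t ∈ Icc ((k : ℝ) / (N + 1 : ℕ)) ((k + 1 : ℕ) / (N + 1 : ℕ)), (s, t) ∈ W a := by
    intro j
    by_cases hjk : k < N + 1 ∧ j < N + 1
    · have hI : ∀ i : ℕ, i < N + 1 → (i : ℝ) / (N + 1 : ℕ) ∈ Icc (0 : ℝ) 1 := fun i hi =>
        ⟨by positivity, div_le_one_of_le₀ (by exact_mod_cast hi.le) hM0.le⟩
      obtain ⟨a, ha⟩ := hδW (((j : ℝ) / (N + 1 : ℕ)), ((k : ℝ) / (N + 1 : ℕ)))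
        ⟨⟨(hI j hjk.2).1, (hI k hjk.1).1⟩, ⟨(hI j hjk.2).2, (hI k hjk.1).2⟩⟩
      have hd : ∀ (i : ℕ), ∀ u ∈ Icc ((i : ℝ) / (N + 1 : ℕ)) ((i + 1 : ℕ) / (N + 1 : ℕ)),
          dist u ((i : ℝ) / (N + 1 : ℕ)) < δ := by
        intro i u hu
        rw [Real.dist_eq, abs_of_nonneg (sub_nonneg.2 hu.1)]
        have : ((i + 1 : ℕ) : ℝ) / (N + 1 : ℕ) = i / (N + 1 : ℕ) + 1 / (N + 1 : ℕ) := by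
          push_cast; ring
        linarith [hu.2]
      exact ⟨a, fun _ _ s hs t ht => interior_subset (ha (by
        rw [Metric.mem_ball, Prod.dist_eq]
        exact max_lt (hd j s hs) (hd k t ht)))⟩
    · exact ⟨0, fun h1 h2 => absurd ⟨h1, h2⟩ hjk⟩
  choose a ha using hcell
  refine ⟨fun j => x (a j).1 (a j).2, fun j => c (a j).2 - x (a j).1 (a j).2, fun j => r (a j),
    fun j => g (a j).1 (a j).2, fun j => h (a j).1 (a j).2, fun hk => ?_⟩
  exact ⟨fun j _ => hr0 _, fun j _ => hr1 _, fun j _ => hr2 _,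
    fun j hj s hs t ht => (ha j hk hj s hs t ht).1,
    fun j hj s hs t ht => (ha j hk hj s hs t ht).2.1,
    fun j hj s hs t ht => (ha j hk hj s hs t ht).2.2.1,
    fun j hj s hs t ht => (ha j hk hj s hs t ht).2.2.2⟩

/-- **Continuation of a convolution product.** -/
theorem HasContinuation.conv₀ {K K' K'' : Set (ℝ × ℂ)} {r : ℝ} {φ ψ : ℂ → ℂ}
    (hφ : AnalyticOnNhd ℂ φ (Metric.ball 0 r)) (hψ : AnalyticOnNhd ℂ ψ (Metric.ball 0 r))
    (hcφ : HasContinuation K r φ) (hcψ : HasContinuation K' r ψ)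
    (hK : IsClosed K) (hK' : IsClosed K') (hK'' : IsClosed K'')
    (h0 : (0 : ℝ × ℂ) ∈ K) (h0' : (0 : ℝ × ℂ) ∈ K') (h0'' : ∀ a : ℝ, 0 ≤ a → (a, (0 : ℂ)) ∈ K'')
    (hKr : ∀ a ∈ K, a.1 < r → a.2 = 0) (hKr' : ∀ a ∈ K', a.1 < r → a.2 = 0)
    (hadd : ∀ a ∈ K, ∀ b ∈ K', a + b ∈ K'') : HasContinuation K'' r (conv₀ φ ψ) := by
  intro q hq hqK hq0 hqr
  obtain ⟨m, hm, hmq⟩ := hq.exists_le_infDist hK'' ⟨_, h0'' 0 le_rfl⟩ hqK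
  have hq01 : 0 ≤ (q 0).1 := (norm_nonneg _).trans hq0
  -- The half-line above `0` lies in `K''`, so a path avoiding `K''` starts off the centre.
  have hq02 : (q 0).2 ≠ 0 := fun h => hqK 0 (by
    have := h0'' _ hq01
    rwa [← h] at this)
  have hs1 : ∀ s ∈ Icc (0 : ℝ) 1, s * (q 0).1 < r := fun s hs =>
    (mul_le_of_le_one_left hq01 hs.2).trans_lt hqr
  -- The initial positions `s • q 0`, `s > 0`, have height below `r` and nonzero position, and below
  -- height `r` the obstacles have only points over `0`.
  have hray : ∀ L : Set (ℝ × ℂ), IsClosed L → (0 : ℝ × ℂ) ∈ L → (∀ a ∈ L, a.1 < r → a.2 = 0) →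
      ∀ s ∈ Ioc (0 : ℝ) 1, 0 < Metric.infDist (s • q 0) L := by
    intro L hL hL0 hLr s hs
    refine (hL.notMem_iff_infDist_pos ⟨_, hL0⟩).1 fun hmem => ?_
    have := hLr _ hmem (by simpa using hs1 s ⟨hs.1.le, hs.2⟩)
    rcases smul_eq_zero.1 (by simpa using this : s • (q 0).2 = 0) with h | h
    · exact hs.1.ne' h
    · exact hq02 h
  obtain ⟨Z, hZ⟩ := IsFlow.exists_flow (K := K) (K' := K') hq h0 h0' hm
    (fun t p => (hmq t).trans (le_infDist_add_infDist ⟨_, h0⟩ ⟨_, h0'⟩ hadd p))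
    (hray K hK h0 hKr) (hray K' hK' h0' hKr')
  set κ : ℝ → ℝ := fun s => max 0 (min s 1) with hκ
  have hκI : ∀ s, κ s ∈ Icc (0 : ℝ) 1 := fun s =>
    ⟨le_max_left _ _, max_le zero_le_one (min_le_right _ _)⟩
  have hκe : ∀ s ∈ Icc (0 : ℝ) 1, κ s = s := fun s hs => by simp [hκ, hs.1, hs.2]
  have hκc : Continuous κ := by fun_prop
  have hqm : ∀ t, q (min t 1) = q t := fun t => by
    rcases le_total t 1 with h | h
    · rw [min_eq_left h]
    · rw [min_eq_right h, hq.right t h]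
  set c : ℝ → ℂ := fun t => (q t).2 with hcdef
  set x : ℝ → ℝ → ℂ := fun s t => (Z (κ s) t).2 with hxdef
  have hcc : Continuous c := continuous_snd.comp hq.continuous
  have hZc : Continuous fun a : ℝ × ℝ => Z (κ a.1) a.2 :=
    hZ.continuous.comp (by fun_prop : Continuous fun a : ℝ × ℝ => (κ a.1, a.2))
  have hxc : Continuous fun a : ℝ × ℝ => x a.1 a.2 := continuous_snd.comp hZc
  have hcone : ∀ s ∈ Icc (0 : ℝ) 1, InCone (s • q 0) := fun s hs => hq0.smul hs.1
  -- continuations of the factors along the flow lines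
  have hgex : ∀ s, ∃ f, IsContinuationOn (x s) f univ ∧ f 0 =ᶠ[𝓝 (x s 0)] φ := by
    intro s
    rcases (hκI s).1.eq_or_lt with h | h
    -- The extreme line stays at `0 ∈ K`, so the continuation hypothesis is not applicable; the germ
    -- `φ` itself is used. The other extreme is treated likewise with `ψ`.
    · have hx0 : ∀ t, x s t = 0 := fun t => by simp [hxdef, ← h, hZ.zero]
      refine ⟨fun _ => φ, IsContinuationOn.const fun t _ => ?_, EventuallyEq.rfl⟩
      rw [hx0 t]
      exact hφ 0 (Metric.mem_ball_self (hq01.trans_lt hqr))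
    · refine hcφ (Z (κ s)) ⟨hZc.comp (by fun_prop : Continuous fun t => (s, t)),
        hZ.inCone _ (hκI s), hZ.left _, hZ.right _⟩ (fun t => ?_) ?_ ?_
      · exact (hK.notMem_iff_infDist_pos ⟨_, h0⟩).2 (hZ.pos _ ⟨h, (hκI s).2⟩ t)
      · rw [hZ.init]; exact hcone _ (hκI s)
      · rw [hZ.init]; simpa using hs1 _ (hκI s)
  have hhex : ∀ s, ∃ f, IsContinuationOn (fun t => c t - x s t) f univ ∧
      f 0 =ᶠ[𝓝 (c 0 - x s 0)] ψ := by
    intro s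
    rcases (hκI s).2.eq_or_lt with h | h
    · have hx0 : ∀ t, c t - x s t = 0 := fun t => by simp [hxdef, h, hZ.one, hqm, hcdef]
      refine ⟨fun _ => ψ, IsContinuationOn.const fun t _ => ?_, EventuallyEq.rfl⟩
      rw [hx0 t]
      exact hψ 0 (Metric.mem_ball_self (hq01.trans_lt hqr))
    · have h2 : q 0 - Z (κ s) 0 = (1 - κ s) • q 0 := by rw [hZ.init, sub_smul, one_smul]
      have h3 : 1 - κ s ∈ Icc (0 : ℝ) 1 := ⟨by linarith [(hκI s).2], by linarith [(hκI s).1]⟩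
      refine hcψ (fun t => q t - Z (κ s) t) ⟨hq.continuous.sub
        (hZc.comp (by fun_prop : Continuous fun t => (s, t))), fun t t' ht => ?_, fun t ht => ?_,
        fun t ht => ?_⟩ (fun t => ?_) ?_ ?_
      · simpa only [hqm] using hZ.inCone_compl _ (hκI s) t t' ht
      · simp only [hq.left t ht, hZ.left _ t ht]
      · simp only [hq.right t ht, hZ.right _ t ht]
      · have := hZ.pos_compl _ ⟨(hκI s).1, h⟩ t
        rw [hqm] at this
        exact (hK'.notMem_iff_infDist_pos ⟨_, h0'⟩).2 this
      · simp only [h2]; exact hcone _ h3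
      · simp only [h2]; simpa using hs1 _ h3
  choose g hg hg0 using hgex
  choose h hh hh0 using hhex
  have hx0c : Continuous fun s => x s 0 := hxc.comp (by fun_prop : Continuous fun s : ℝ => (s, (0 : ℝ)))
  obtain ⟨M, hM, hgrid⟩ := IsCells.exists_grid hxc hcc hg hh (eventually_initial hx0c hg0)
    (eventually_initial (continuous_const.sub hx0c) hh0)
  choose X Y R G H hC using hgrid
  have hM' : (0 : ℝ) < M := by exact_mod_cast hM
  have hx0 : ∀ t, x 0 t = 0 := fun t => by
    simp [hxdef, hκe 0 ⟨le_rfl, zero_le_one⟩, hZ.zero]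
  have hx1 : ∀ t, x 1 t = c t := fun t => by
    simp [hxdef, hκe 1 ⟨zero_le_one, le_rfl⟩, hZ.one, hqm, hcdef]
  have hxs : ∀ s ∈ Icc (0 : ℝ) 1, x s 0 = s * c 0 := fun s hs => by
    simp [hxdef, hκe s hs, hZ.init, hcdef]
  have hc0r : ‖c 0‖ < r := lt_of_le_of_lt hq0 hqr
  have key : ∀ k < M, ContinuesAlong c (Resurgence.conv₀ φ ψ)
      (polyConv M (G k) (H k) fun i => x (i / M) (k / M)) (k / M) := by
    intro k
    induction k with
    | zero =>
      intro hk
      have h1 := (hC 0 hk).polyConv_init hM hφ hψ hx1 (by simp) hc0r hxs (fun s _ => hg0 s)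
        (fun s _ => hh0 s)
      simp only [Nat.cast_zero, zero_div] at h1 ⊢
      exact ContinuesAlong.zero (fun t ht => by simp only [hcdef, hq.left t ht])
        (analyticOnNhd_conv₀ hφ hψ _ (mem_ball_zero_iff.2 hc0r)) h1.symm
    | succ k ih =>
      intro hk
      have hk' : k < M := by omega
      have m1 := IsCells.left_mem (M := M) k
      have m2 := IsCells.right_mem (M := M) k
      have m3 := IsCells.left_mem (M := M) (k + 1)
      -- Across the `k`-th time cell the integral with vertices frozen at `k / M` is analytic along
      -- `c`. At the end of the cell the vertices are moved to `(k + 1) / M`, then the discs are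
      -- exchanged for those of the next cell.
      refine (ih hk').extend hcc (by positivity) m1.2
        (fun t ht => (hC k hk').analyticAt_polyConv hx1 ht m1) ?_
      exact ((hC k hk').polyConv_shift hx0 hx1 m2 m1 m2).trans
        ((hC k hk').polyConv_change (hC _ hk) hx1 m2 m3)
  obtain ⟨N, rfl⟩ := Nat.exists_eq_succ_of_ne_zero hM.ne'
  have m1 := IsCells.left_mem (M := N.succ) N
  obtain ⟨f, hf, hf0, -⟩ := (key N N.lt_succ_self).extend hcc (by positivity) m1.2
    (fun t ht => (hC N N.lt_succ_self).analyticAt_polyConv hx1 ht m1) EventuallyEq.rfl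
  refine ⟨f, ?_, hf0⟩
  rw [← Nat.succ_eq_add_one, div_self hM'.ne'] at hf
  have : (fun t => c (min t 1)) = c := funext fun t => by simp only [hcdef, hqm]
  rwa [this] at hf

section piecewisePaths

/-! ### Piecewise `C¹` paths and their length -/

namespace IsSubdivision

variable {n : ℕ} {σ : ℕ → ℝ}

theorem mono (h : IsSubdivision n σ) {i j : ℕ} (hij : i ≤ j) (hj : j ≤ n) : σ i ≤ σ j := by
  induction j, hij using Nat.le_induction with
  | base => exact le_rfl
  | succ j hij ih => exact (ih (by omega)).trans (h.2.2 j (by omega)).le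

theorem mem_Icc (h : IsSubdivision n σ) {i : ℕ} (hi : i ≤ n) : σ i ∈ Icc (0 : ℝ) 1 :=
  ⟨h.1 ▸ h.mono (Nat.zero_le i) hi, h.2.1 ▸ h.mono hi le_rfl⟩

theorem Icc_subset (h : IsSubdivision n σ) {i : ℕ} (hi : i < n) :
    Icc (σ i) (σ (i + 1)) ⊆ Icc 0 1 :=
  Icc_subset_Icc (h.mem_Icc hi.le).1 (h.mem_Icc (Nat.succ_le_of_lt hi)).2

theorem exists_mem (h : IsSubdivision n σ) {x : ℝ} (hx : x ∈ Icc (0 : ℝ) 1) :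
    ∃ i < n, x ∈ Icc (σ i) (σ (i + 1)) := by
  by_contra! hcon
  have key : ∀ k ≤ n, σ k ≤ x := by
    intro k
    induction k with
    | zero => intro _; rw [h.1]; exact hx.1
    | succ k ih =>
      intro hk
      by_contra! hlt
      exact hcon k hk ⟨ih (by omega), hlt.le⟩
  have hn := key n le_rfl
  rw [h.2.1] at hn
  have hx1 : x = 1 := le_antisymm hx.2 hn
  have h0 : n ≠ 0 := by
    rintro rfl
    have := h.1.symm.trans h.2.1
    norm_num at this
  obtain ⟨k, rfl⟩ := Nat.exists_eq_succ_of_ne_zero h0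
  exact hcon k k.lt_succ_self ⟨key k (by omega), by rw [← Nat.succ_eq_add_one, h.2.1, hx1]⟩

theorem unit : IsSubdivision 1 fun i => (i : ℝ) := ⟨by simp, by simp, fun i _ => by simp⟩

theorem Ioo_subset (h : IsSubdivision n σ) {x : ℝ} (hx : x ∈ Ioo (0 : ℝ) 1)
    (hF : x ∉ σ '' Iic n) : ∃ i < n, x ∈ Ioo (σ i) (σ (i + 1)) := by
  obtain ⟨i, hi, hxi⟩ := h.exists_mem (Ioo_subset_Icc_self hx)
  refine ⟨i, hi, lt_of_le_of_ne hxi.1 fun h' => hF ⟨i, hi.le, h'⟩,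
    lt_of_le_of_ne hxi.2 fun h' => hF ⟨i + 1, Nat.succ_le_of_lt hi, h'.symm⟩⟩

theorem continuousOn (h : IsSubdivision n σ) {E : Type*} [TopologicalSpace E] {f : ℝ → E}
    (hf : ∀ i < n, ContinuousOn f (Icc (σ i) (σ (i + 1)))) : ContinuousOn f (Icc 0 1) := by
  have key : ∀ k ≤ n, ContinuousOn f (Icc (σ 0) (σ k)) := by
    intro k
    induction k with
    | zero => intro _; simp
    | succ k ih =>
      intro hk
      rw [← Icc_union_Icc_eq_Icc (h.mono (Nat.zero_le k) (by omega)) (h.2.2 k hk).le]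
      exact (ih (by omega)).union_of_isClosed (hf k hk) isClosed_Icc isClosed_Icc
  have := key n le_rfl
  rwa [h.1, h.2.1] at this

end IsSubdivision

/-- `γ` is `C¹` on the intervals of a subdivision, with derivative `D i` on the `i`-th one. -/
structure PwDeriv (n : ℕ) (σ : ℕ → ℝ) (D : ℕ → ℝ → ℂ) (γ : ℝ → ℂ) : Prop where
  isSubdivision : IsSubdivision n σ
  continuousOn : ∀ i < n, ContinuousOn (D i) (Icc (σ i) (σ (i + 1)))
  hasDeriv : ∀ i < n, ∀ s ∈ Icc (σ i) (σ (i + 1)),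
    HasDerivWithinAt γ (D i s) (Icc (σ i) (σ (i + 1))) s

namespace PwDeriv

variable {n : ℕ} {σ : ℕ → ℝ} {D : ℕ → ℝ → ℂ} {γ : ℝ → ℂ}

theorem piecewiseC1 (h : PwDeriv n σ D γ) : PiecewiseC1 γ := by
  refine ⟨h.isSubdivision.continuousOn fun i hi s hs => (h.hasDeriv i hi s hs).continuousWithinAt,
    n, σ, h.isSubdivision, fun i hi => ?_⟩
  have hu := uniqueDiffOn_Icc (h.isSubdivision.2.2 i hi)
  rw [contDiffOn_one_iff_derivWithin hu]
  exact ⟨fun s hs => (h.hasDeriv i hi s hs).differentiableWithinAt,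
    (h.continuousOn i hi).congr fun s hs => (h.hasDeriv i hi s hs).derivWithin (hu s hs)⟩

theorem hasDerivAt (h : PwDeriv n σ D γ) {i : ℕ} (hi : i < n) {s : ℝ}
    (hs : s ∈ Ioo (σ i) (σ (i + 1))) : HasDerivAt γ (D i s) s :=
  (h.hasDeriv i hi s (Ioo_subset_Icc_self hs)).hasDerivAt (Icc_mem_nhds hs.1 hs.2)

theorem deriv_eqOn (h : PwDeriv n σ D γ) {i : ℕ} (hi : i < n) :
    EqOn (D i) (deriv γ) (Ioo (σ i) (σ (i + 1))) := fun _ hs => (h.hasDerivAt hi hs).deriv.symm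

theorem intervalIntegrable (h : PwDeriv n σ D γ) :
    IntervalIntegrable (deriv γ) MeasureTheory.volume 0 1 := by
  have := IntervalIntegrable.trans_iterate (f := deriv γ) (μ := MeasureTheory.volume) (a := σ)
    (n := n) fun i hi => by
      have hle := (h.isSubdivision.2.2 i hi).le
      refine ((h.continuousOn i hi).intervalIntegrable_of_Icc hle).congr_uIoo ?_
      rw [uIoo_of_le hle]
      exact h.deriv_eqOn hi
  rwa [h.isSubdivision.1, h.isSubdivision.2.1] at this

/-- The derivative data `D i` are continuous up to the subdivision points, unlike `deriv γ`; this
form of the length is the one that varies continuously in a homotopy. -/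
theorem pathLength_eq (h : PwDeriv n σ D γ) :
    pathLength γ = ∑ i ∈ Finset.range n, ∫ s in σ i..σ (i + 1), ‖D i s‖ := by
  have h1 : ∀ i < n, IntervalIntegrable (fun s => ‖deriv γ s‖) MeasureTheory.volume (σ i)
      (σ (i + 1)) := fun i hi => by
    refine h.intervalIntegrable.norm.mono_set ?_
    rw [uIcc_of_le (h.isSubdivision.2.2 i hi).le, uIcc_of_le zero_le_one]
    exact h.isSubdivision.Icc_subset hi
  rw [pathLength, ← h.isSubdivision.1, ← h.isSubdivision.2.1,
    ← intervalIntegral.sum_integral_adjacent_intervals h1]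
  refine Finset.sum_congr rfl fun i hi => ?_
  have hi := Finset.mem_range.1 hi
  refine intervalIntegral.integral_congr_Ioo_of_le (h.isSubdivision.2.2 i hi).le fun s hs => ?_
  simp only [h.deriv_eqOn hi hs]

end PwDeriv

variable {γ : ℝ → ℂ}

theorem PiecewiseC1.exists_pwDeriv (h : PiecewiseC1 γ) : ∃ n σ D, PwDeriv n σ D γ := by
  obtain ⟨-, n, σ, hσ, hd⟩ := h
  refine ⟨n, σ, fun i => derivWithin γ (Icc (σ i) (σ (i + 1))), hσ, fun i hi => ?_, fun i hi s hs => ?_⟩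
  · exact (hd i hi).continuousOn_derivWithin (uniqueDiffOn_Icc (hσ.2.2 i hi)) le_rfl
  · exact ((hd i hi).differentiableOn one_ne_zero s hs).hasDerivWithinAt

theorem PiecewiseC1.intervalIntegrable (h : PiecewiseC1 γ) :
    IntervalIntegrable (deriv γ) MeasureTheory.volume 0 1 := by
  obtain ⟨n, σ, D, hD⟩ := h.exists_pwDeriv
  exact hD.intervalIntegrable

theorem PiecewiseC1.congr {γ' : ℝ → ℂ} (h : PiecewiseC1 γ) (he : EqOn γ γ' (Icc 0 1)) :
    PiecewiseC1 γ' := by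
  obtain ⟨hc, n, σ, hσ, hd⟩ := h
  exact ⟨hc.congr he.symm, n, σ, hσ, fun i hi => (hd i hi).congr fun s hs =>
    (he (hσ.Icc_subset hi hs)).symm⟩

/-- The length of the restriction of `γ` to `[0, s]`. -/
def runLength (γ : ℝ → ℂ) (s : ℝ) : ℝ := ∫ t in (0 : ℝ)..s, ‖deriv γ t‖

theorem runLength_zero : runLength γ 0 = 0 := by simp [runLength]

theorem runLength_one : runLength γ 1 = pathLength γ := rfl

theorem pathLength_nonneg : 0 ≤ pathLength γ :=
  intervalIntegral.integral_nonneg zero_le_one fun _ _ => norm_nonneg _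

theorem PiecewiseC1.continuousOn_runLength (h : PiecewiseC1 γ) :
    ContinuousOn (runLength γ) (Icc 0 1) := by
  have := intervalIntegral.continuousOn_primitive_interval (f := fun t => ‖deriv γ t‖)
    (μ := MeasureTheory.volume) (a := 0) (b := 1) ?_
  · rwa [uIcc_of_le zero_le_one] at this
  · rw [uIcc_of_le zero_le_one, ← intervalIntegrable_iff_integrableOn_Icc_of_le zero_le_one]
    exact h.intervalIntegrable.norm

theorem PiecewiseC1.norm_sub_le (h : PiecewiseC1 γ) {a b : ℝ} (ha : 0 ≤ a) (hab : a ≤ b)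
    (hb : b ≤ 1) : ‖γ b - γ a‖ ≤ runLength γ b - runLength γ a := by
  obtain ⟨n, σ, D, hD⟩ := h.exists_pwDeriv
  have hI : ∀ {x y : ℝ}, 0 ≤ x → x ≤ y → y ≤ 1 →
      IntervalIntegrable (deriv γ) MeasureTheory.volume x y := fun hx hxy hy =>
    h.intervalIntegrable.mono_set (by
      rw [uIcc_of_le hxy, uIcc_of_le zero_le_one]; exact Icc_subset_Icc hx hy)
  have h1 : ∫ t in a..b, deriv γ t = γ b - γ a := by
    refine MeasureTheory.integral_eq_of_hasDerivAt_off_countable_of_le γ (deriv γ) hab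
      (s := σ '' Iic n) ((finite_Iic n).image σ).countable (h.1.mono (Icc_subset_Icc ha hb))
      (fun x hx => ?_) (hI ha hab hb)
    obtain ⟨i, hi, hxi⟩ := hD.isSubdivision.Ioo_subset ⟨ha.trans_lt hx.1.1, hx.1.2.trans_le hb⟩ hx.2
    exact (hD.hasDerivAt hi hxi).differentiableAt.hasDerivAt
  rw [runLength, runLength, intervalIntegral.integral_interval_sub_left
    (hI le_rfl (ha.trans hab) hb).norm (hI le_rfl ha (hab.trans hb)).norm, ← h1]
  exact intervalIntegral.norm_integral_le_integral_norm hab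

theorem PiecewiseC1.runLength_mono (h : PiecewiseC1 γ) : MonotoneOn (runLength γ) (Icc 0 1) :=
  fun _ ha _ hb hab => sub_nonneg.1 ((norm_nonneg _).trans (h.norm_sub_le ha.1 hab hb.2))

theorem PiecewiseC1.dist_le (h : PiecewiseC1 γ) {t : ℝ} (ht : t ∈ Icc (0 : ℝ) 1) :
    ‖γ t - γ 0‖ ≤ pathLength γ := by
  have h1 := h.norm_sub_le le_rfl ht.1 ht.2
  have h2 := h.runLength_mono ht ⟨zero_le_one, le_rfl⟩ ht.2
  rw [runLength_zero, sub_zero] at h1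
  exact h1.trans h2

/-- The length is bounded by the variation of a monotone function which dominates the path. -/
theorem pathLength_le_of_dominated {m : ℝ → ℝ}
    (h : ∀ a ∈ Icc (0 : ℝ) 1, ∀ b ∈ Icc (0 : ℝ) 1, a ≤ b → ‖γ b - γ a‖ ≤ m b - m a) :
    pathLength γ ≤ m 1 - m 0 := by
  have hm : MonotoneOn m (Icc 0 1) := fun a ha b hb hab =>
    sub_nonneg.1 ((norm_nonneg _).trans (h a ha b hb hab))
  have hm' : MonotoneOn m (uIcc 0 1) := by rwa [uIcc_of_le zero_le_one]
  have h01 : 0 ≤ m 1 - m 0 := sub_nonneg.2 (hm (by simp) (by simp) zero_le_one)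
  -- For a monotone function the integral of the derivative is at most the increment; no absolute
  -- continuity of `m` is required.
  have h1 := hm'.intervalIntegral_deriv_mem_uIcc
  rw [uIcc_of_le h01] at h1
  refine le_trans ?_ h1.2
  have h2 := hm'.intervalIntegrable_deriv
  rw [pathLength, intervalIntegral.integral_of_le zero_le_one,
    intervalIntegral.integral_of_le zero_le_one]
  rw [intervalIntegrable_iff_integrableOn_Ioc_of_le zero_le_one] at h2
  refine MeasureTheory.integral_mono_of_nonneg (Eventually.of_forall fun _ => norm_nonneg _) h2 ?_
  have h3 : ∀ᵐ x : ℝ, x ≠ 1 := by simp [MeasureTheory.ae_iff]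
  refine (MeasureTheory.ae_restrict_iff' measurableSet_Ioc).2 ?_
  filter_upwards [hm.ae_differentiableWithinAt_of_mem, h3] with x hx hx1 hxI
  have hxo : x ∈ Ioo (0 : ℝ) 1 := ⟨hxI.1, lt_of_le_of_ne hxI.2 hx1⟩
  have hxc := Ioo_subset_Icc_self hxo
  have hmd := ((hx hxc).differentiableAt (Icc_mem_nhds hxo.1 hxo.2)).hasDerivAt
  have hev : ∀ᶠ t in 𝓝[>] (0 : ℝ), 0 < t ∧ x + t ∈ Icc (0 : ℝ) 1 := by
    filter_upwards [Ioo_mem_nhdsGT (sub_pos.2 hxo.2)] with t ht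
    exact ⟨ht.1, by linarith [ht.1, hxo.1], by linarith [ht.2]⟩
  by_cases hd : DifferentiableAt ℝ γ x
  · have hγd := hd.hasDerivAt
    refine le_of_tendsto_of_tendsto hγd.tendsto_slope_zero_right.norm
      hmd.tendsto_slope_zero_right ?_
    filter_upwards [hev] with t ht
    rw [norm_smul, norm_inv, Real.norm_of_nonneg ht.1.le, smul_eq_mul]
    exact mul_le_mul_of_nonneg_left (h x hxc _ ht.2 (by linarith [ht.1]))
      (inv_nonneg.2 ht.1.le)
  -- Where `γ` is not differentiable, `deriv γ` has the default value `0`, and the derivative of `m`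
  -- is nonnegative.
  · rw [deriv_zero_of_not_differentiableAt hd, norm_zero]
    refine ge_of_tendsto hmd.tendsto_slope_zero_right ?_
    filter_upwards [hev] with t ht
    exact mul_nonneg (inv_nonneg.2 ht.1.le)
      (sub_nonneg.2 (hm hxc ht.2 (by linarith [ht.1])))

theorem PiecewiseC1.pathLength_congr {γ' : ℝ → ℂ} (he : EqOn γ γ' (Icc 0 1)) :
    pathLength γ = pathLength γ' := by
  refine intervalIntegral.integral_congr_Ioo_of_le zero_le_one fun s hs => ?_
  have : γ =ᶠ[𝓝 s] γ' := he.eventuallyEq_of_mem (Icc_mem_nhds hs.1 hs.2)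
  simp only [this.deriv_eq]

/-! ### Segments and concatenations -/

theorem hasDerivAt_lineMap (a b : ℂ) (s : ℝ) :
    HasDerivAt (fun t : ℝ => AffineMap.lineMap a b t) (b - a) s := AffineMap.hasDerivAt_lineMap

theorem pwDeriv_lineMap (a b : ℂ) :
    PwDeriv 1 (fun i => (i : ℝ)) (fun _ _ => b - a) fun t => AffineMap.lineMap a b t :=
  ⟨IsSubdivision.unit, fun _ _ => continuousOn_const,
    fun _ _ s _ => (hasDerivAt_lineMap a b s).hasDerivWithinAt⟩

theorem lineMap_sub (a b : ℂ) (s t : ℝ) :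
    AffineMap.lineMap a b t - AffineMap.lineMap a b s = (t - s) • (b - a) := by
  simp only [AffineMap.lineMap_apply, vsub_eq_sub, vadd_eq_add, sub_smul]; ring

theorem pathLength_lineMap_le (a b : ℂ) :
    pathLength (fun t => AffineMap.lineMap a b t) ≤ ‖b - a‖ := by
  have := pathLength_le_of_dominated (γ := fun t => AffineMap.lineMap a b t)
    (m := fun t => t * ‖b - a‖) fun s _ t _ hst => by
      rw [lineMap_sub, norm_smul, Real.norm_of_nonneg (sub_nonneg.2 hst), sub_mul]
  simpa using this

theorem concat_left {γ₁ γ₂ : ℝ → ℂ} {t : ℝ} (ht : t ≤ 1 / 2) : concat γ₁ γ₂ t = γ₁ (2 * t) :=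
  if_pos ht

theorem concat_right {γ₁ γ₂ : ℝ → ℂ} (h : γ₁ 1 = γ₂ 0) {t : ℝ} (ht : 1 / 2 ≤ t) :
    concat γ₁ γ₂ t = γ₂ (2 * t - 1) := by
  rcases ht.eq_or_lt with rfl | ht
  · rw [concat_left le_rfl]; norm_num [h]
  · exact if_neg (not_le.2 ht)

/-- The subdivision `σ 0 / 2, …, σ n / 2, 1`. -/
def halfSubdivision (n : ℕ) (σ : ℕ → ℝ) (i : ℕ) : ℝ := if i ≤ n then σ i / 2 else 1

theorem IsSubdivision.half {n : ℕ} {σ : ℕ → ℝ} (h : IsSubdivision n σ) :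
    IsSubdivision (n + 1) (halfSubdivision n σ) := by
  refine ⟨by simp [halfSubdivision, h.1], by simp [halfSubdivision], fun i hi => ?_⟩
  rcases (Nat.lt_succ_iff.1 hi).lt_or_eq with h1 | rfl
  · have := h.2.2 i h1
    simp only [halfSubdivision, h1.le, Nat.succ_le_of_lt h1, if_true]
    linarith
  · simp only [halfSubdivision, le_refl, if_true, h.2.1]
    norm_num

theorem halfSubdivision_lt {n : ℕ} {σ : ℕ → ℝ} {i : ℕ} (hi : i < n) :
    halfSubdivision n σ i = σ i / 2 ∧ halfSubdivision n σ (i + 1) = σ (i + 1) / 2 := by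
  simp [halfSubdivision, hi.le, Nat.succ_le_of_lt hi]

theorem halfSubdivision_last {n : ℕ} {σ : ℕ → ℝ} (h : IsSubdivision n σ) :
    halfSubdivision n σ n = 1 / 2 ∧ halfSubdivision n σ (n + 1) = 1 := by
  simp [halfSubdivision, h.2.1]

/-- The derivative of a concatenation with a segment. -/
def concatDeriv (n : ℕ) (D : ℕ → ℝ → ℂ) (w : ℂ) (i : ℕ) (s : ℝ) : ℂ :=
  if i < n then (2 : ℂ) * D i (2 * s) else 2 * w

theorem two_mul_mem {n : ℕ} {σ : ℕ → ℝ} {i : ℕ} (hi : i < n) {s : ℝ}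
    (hs : s ∈ Icc (halfSubdivision n σ i) (halfSubdivision n σ (i + 1))) :
    2 * s ∈ Icc (σ i) (σ (i + 1)) := by
  rw [(halfSubdivision_lt hi).1, (halfSubdivision_lt hi).2] at hs
  exact ⟨by linarith [hs.1], by linarith [hs.2]⟩

theorem PwDeriv.concat_lineMap {n : ℕ} {σ : ℕ → ℝ} {D : ℕ → ℝ → ℂ} (h : PwDeriv n σ D γ) (ξ : ℂ) :
    PwDeriv (n + 1) (halfSubdivision n σ) (concatDeriv n D (ξ - γ 1))
      (concat γ fun t => AffineMap.lineMap (γ 1) ξ t) := by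
  refine ⟨h.isSubdivision.half, fun i hi => ?_, fun i hi s hs => ?_⟩
  · by_cases h1 : i < n
    · have e : concatDeriv n D (ξ - γ 1) i = fun s => 2 * D i (2 * s) := by
        funext s; simp [concatDeriv, h1]
      rw [e]
      exact continuousOn_const.mul ((h.continuousOn i h1).comp (by fun_prop)
        fun s hs => two_mul_mem h1 hs)
    · have e : concatDeriv n D (ξ - γ 1) i = fun _ => 2 * (ξ - γ 1) := by
        funext s; simp [concatDeriv, h1]
      rw [e]
      exact continuousOn_const
  · by_cases h1 : i < n
    · simp only [concatDeriv, h1, if_true]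
      have hle : ∀ u ∈ Icc (halfSubdivision n σ i) (halfSubdivision n σ (i + 1)), u ≤ 1 / 2 := by
        intro u hu
        have := (two_mul_mem h1 hu).2.trans (h.isSubdivision.mem_Icc (Nat.succ_le_of_lt h1)).2
        linarith
      have h2 : HasDerivWithinAt (fun u : ℝ => 2 * u) 2
          (Icc (halfSubdivision n σ i) (halfSubdivision n σ (i + 1))) s := by
        simpa using ((hasDerivAt_id s).const_mul (2 : ℝ)).hasDerivWithinAt
      have h3 := (h.hasDeriv i h1 _ (two_mul_mem h1 hs)).scomp s h2 fun u hu => two_mul_mem h1 hu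
      have h4 := h3.congr (f₁ := concat γ fun t => AffineMap.lineMap (γ 1) ξ t)
        (fun u hu => concat_left (hle u hu)) (concat_left (hle s hs))
      simpa using h4
    · simp only [concatDeriv, h1, if_false]
      obtain rfl : i = n := by omega
      rw [(halfSubdivision_last h.isSubdivision).1, (halfSubdivision_last h.isSubdivision).2] at hs ⊢
      have h2 : HasDerivAt (fun u : ℝ => 2 * u - 1) 2 s := by
        simpa using ((hasDerivAt_id s).const_mul (2 : ℝ)).sub_const 1
      have h3 := ((hasDerivAt_lineMap (γ 1) ξ (2 * s - 1)).scomp s h2).hasDerivWithinAt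
        (s := Icc (1 / 2) 1)
      have h4 := h3.congr (f₁ := concat γ fun t => AffineMap.lineMap (γ 1) ξ t)
        (fun u hu => concat_right (by simp) hu.1) (concat_right (by simp) hs.1)
      simpa using h4

theorem PiecewiseC1.concat_lineMap (h : PiecewiseC1 γ) (ξ : ℂ) :
    PiecewiseC1 (concat γ fun t => AffineMap.lineMap (γ 1) ξ t) := by
  obtain ⟨n, σ, D, hD⟩ := h.exists_pwDeriv
  exact (hD.concat_lineMap ξ).piecewiseC1

/-- The dominating function is the distance travelled: the running length of `γ` at time `min (2 *
t) 1`, plus the part of the segment already covered. -/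
theorem PiecewiseC1.pathLength_concat_le (h : PiecewiseC1 γ) (ξ : ℂ) :
    pathLength (concat γ fun t => AffineMap.lineMap (γ 1) ξ t) ≤ pathLength γ + ‖ξ - γ 1‖ := by
  have := pathLength_le_of_dominated (γ := concat γ fun t => AffineMap.lineMap (γ 1) ξ t)
    (m := fun t => runLength γ (min (2 * t) 1) + max (2 * t - 1) 0 * ‖ξ - γ 1‖) fun a ha b hb hab => ?_
  · norm_num [runLength_zero, runLength_one] at this
    exact this
  have hle : ∀ a ∈ Icc (0 : ℝ) (1 / 2), ∀ b ∈ Icc (0 : ℝ) (1 / 2), a ≤ b →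
      ‖γ (2 * b) - γ (2 * a)‖ ≤ runLength γ (2 * b) - runLength γ (2 * a) := fun a ha b hb hab =>
    h.norm_sub_le (by linarith [ha.1]) (by linarith) (by linarith [hb.2])
  have hri : ∀ c d : ℝ, c ≤ d → ‖(AffineMap.lineMap (γ 1) ξ d : ℂ) - AffineMap.lineMap (γ 1) ξ c‖ ≤
      (d - c) * ‖ξ - γ 1‖ := fun c d hcd => by
    rw [lineMap_sub, norm_smul, Real.norm_of_nonneg (sub_nonneg.2 hcd)]
  have hj : γ 1 = AffineMap.lineMap (γ 1) ξ (0 : ℝ) := by simp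
  have eL : ∀ {u : ℝ}, u ≤ 1 / 2 → min (2 * u) 1 = 2 * u ∧ max (2 * u - 1) 0 = 0 := fun hu =>
    ⟨min_eq_left (by linarith), max_eq_right (by linarith)⟩
  have eR : ∀ {u : ℝ}, 1 / 2 ≤ u → min (2 * u) 1 = 1 ∧ max (2 * u - 1) 0 = 2 * u - 1 := fun hu =>
    ⟨min_eq_right (by linarith), max_eq_left (by linarith)⟩
  rcases le_total b (1 / 2) with h1 | h1
  · have h2 := hab.trans h1
    simp only [concat_left h1, concat_left h2, eL h1, eL h2]
    have := hle a ⟨ha.1, h2⟩ b ⟨hb.1, h1⟩ hab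
    simpa using this
  rcases le_total a (1 / 2) with h2 | h2
  · simp only [concat_right hj h1, concat_left h2, eR h1, eL h2]
    have e1 := hle a ⟨ha.1, h2⟩ (1 / 2) (by norm_num) h2
    have e2 := hri 0 (2 * b - 1) (by linarith)
    rw [← hj] at e2
    have e3 := norm_add_le ((AffineMap.lineMap (γ 1) ξ (2 * b - 1) : ℂ) - γ 1) (γ 1 - γ (2 * a))
    rw [sub_add_sub_cancel] at e3
    norm_num at e1
    linarith
  · simp only [concat_right hj h1, concat_right hj h2, eR h1, eR h2]
    have := hri (2 * a - 1) (2 * b - 1) (by linarith)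
    linarith

end piecewisePaths

section allowedPaths

/-! ### Allowed paths -/

/-- `γ` either is constant or stays at `ω` for some time and then never comes back. -/
def Departs (ω : ℂ) (γ : ℝ → ℂ) : Prop :=
  (∀ t ∈ Icc (0 : ℝ) 1, γ t = ω) ∨
    ∃ t₀ ∈ Ico (0 : ℝ) 1, (∀ t ∈ Icc 0 t₀, γ t = ω) ∧ ∀ t ∈ Ioc t₀ 1, γ t ≠ ω

variable {ω : ℂ} {Ω : DiscreteFilteredSet ω} {γ γ' : ℝ → ℂ} {L : ℝ}

/-- Separates the way of leaving `ω`, which does not involve `L`, from the avoidance of `Ω_L \ {ω}`,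
which is stable under small perturbations. Membership in `D(ω, L)` follows from the length. -/
theorem allowedAt_iff : AllowedAt Ω L γ ↔ γ 0 = ω ∧ PiecewiseC1 γ ∧ pathLength γ < L ∧
    Departs ω γ ∧ ∀ t ∈ Icc (0 : ℝ) 1, γ t ∉ Ω.level L \ {ω} := by
  constructor
  · rintro ⟨h0, hp, hL, h⟩
    refine ⟨h0, hp, hL, ?_⟩
    rcases h with h | ⟨t₀, ht₀, h1, h2⟩
    · exact ⟨Or.inl h, fun t ht hm => hm.2 (h t ht)⟩
    · refine ⟨Or.inr ⟨t₀, ht₀, h1, fun t ht he => (h2 t ht).2 ?_⟩, fun t ht hm => ?_⟩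
      · rw [he]; exact Ω.center_mem (pathLength_nonneg.trans_lt hL)
      · rcases le_or_gt t t₀ with h3 | h3
        · exact hm.2 (h1 t ⟨ht.1, h3⟩)
        · exact (h2 t ⟨h3, ht.2⟩).2 hm.1
  · rintro ⟨h0, hp, hL, h, hΩ⟩
    refine ⟨h0, hp, hL, h.imp_right ?_⟩
    rintro ⟨t₀, ht₀, h1, h2⟩
    refine ⟨t₀, ht₀, h1, fun t ht => ⟨?_, fun hm => ?_⟩⟩
    · have := hp.dist_le ⟨ht₀.1.trans ht.1.le, ht.2⟩
      rw [h0] at this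
      rw [Metric.mem_ball, dist_eq_norm]
      exact this.trans_lt hL
    · exact hΩ t ⟨ht₀.1.trans ht.1.le, ht.2⟩ ⟨hm, h2 t ht⟩

theorem AllowedAt.allowed (h : AllowedAt Ω L γ) : Allowed Ω γ :=
  ⟨L, pathLength_nonneg.trans_lt h.2.2.1, h⟩

theorem Allowed.zero (h : Allowed Ω γ) : γ 0 = ω := by
  obtain ⟨L, -, h⟩ := h
  exact h.1

theorem Allowed.piecewiseC1 (h : Allowed Ω γ) : PiecewiseC1 γ := by
  obtain ⟨L, -, h⟩ := h
  exact h.2.1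

theorem Allowed.departs (h : Allowed Ω γ) : Departs ω γ := by
  obtain ⟨L, -, h⟩ := h
  exact (allowedAt_iff.1 h).2.2.2.1

theorem AllowedAt.mono {L' : ℝ} (h : AllowedAt Ω L γ) (h1 : pathLength γ < L') (h2 : L' ≤ L) :
    AllowedAt Ω L' γ := by
  rw [allowedAt_iff] at h ⊢
  exact ⟨h.1, h.2.1, h1, h.2.2.2.1, fun t ht hm =>
    h.2.2.2.2 t ht ⟨Ω.level_mono _ _ (pathLength_nonneg.trans_lt h1) h2 hm.1, hm.2⟩⟩

theorem AllowedAt.congr (h : AllowedAt Ω L γ) (he : EqOn γ γ' (Icc 0 1)) : AllowedAt Ω L γ' := by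
  obtain ⟨h0, hp, hL, h⟩ := h
  refine ⟨by rw [← he (by simp)]; exact h0, hp.congr he, PiecewiseC1.pathLength_congr he ▸ hL, ?_⟩
  rcases h with h | ⟨t₀, ht₀, h1, h2⟩
  · exact Or.inl fun t ht => he ht ▸ h t ht
  · exact Or.inr ⟨t₀, ht₀, fun t ht => he ⟨ht.1, ht.2.trans ht₀.2.le⟩ ▸ h1 t ht,
      fun t ht => he ⟨ht₀.1.trans ht.1.le, ht.2⟩ ▸ h2 t ht⟩

/-- The departure is delicate only near the initial stay at `ω`; a modification after a time `a` is
harmless as long as it does not touch `ω`. -/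
theorem Departs.of_eqOn (h : Departs ω γ) {a : ℝ} (ha : a ∈ Icc (0 : ℝ) 1)
    (he : ∀ t ∈ Icc 0 a, γ' t = γ t) (hne : ∀ t ∈ Icc a 1, γ' t ≠ ω) : Departs ω γ' := by
  have hγa : γ a ≠ ω := he a ⟨ha.1, le_rfl⟩ ▸ hne a ⟨le_rfl, ha.2⟩
  rcases h with h | ⟨t₀, ht₀, h1, h2⟩
  · exact absurd (h a ha) hγa
  · have h3 : t₀ < a := lt_of_not_ge fun h3 => hγa (h1 a ⟨ha.1, h3⟩)
    refine Or.inr ⟨t₀, ht₀, fun t ht => ?_, fun t ht => ?_⟩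
    · rw [he t ⟨ht.1, ht.2.trans h3.le⟩]; exact h1 t ht
    · rcases le_total t a with h4 | h4
      · rw [he t ⟨ht₀.1.trans ht.1.le, h4⟩]; exact h2 t ht
      · exact hne t ⟨h4, ht.2⟩

/-- The class of `γ` if it is allowed, the base point otherwise. -/
def clOf (Ω : DiscreteFilteredSet ω) (γ : ℝ → ℂ) : Surface Ω :=
  open Classical in if h : Allowed Ω γ then cl ⟨γ, h⟩ else basePoint Ω

theorem clOf_eq (h : Allowed Ω γ) : clOf Ω γ = cl ⟨γ, h⟩ := dif_pos h

theorem clOf_coe (α : AllowedPath Ω) : clOf Ω α.1 = cl α := clOf_eq α.2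

theorem proj_clOf (h : Allowed Ω γ) : proj (clOf Ω γ) = γ 1 := by rw [clOf_eq h]; rfl

/-- Continuity and derivatives of a homotopy. -/
structure HomotopyData (H : ℝ → ℝ → ℂ) (n : ℕ) (σ : ℕ → ℝ) (D : ℕ → ℝ × ℝ → ℂ) : Prop where
  continuousOn : ContinuousOn (fun q : ℝ × ℝ => H q.1 q.2) (Icc 0 1 ×ˢ Icc 0 1)
  isSubdivision : IsSubdivision n σ
  continuousOn_deriv : ∀ i < n, ContinuousOn (D i) (Icc (σ i) (σ (i + 1)) ×ˢ Icc 0 1)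
  hasDeriv : ∀ i < n, ∀ s ∈ Icc (σ i) (σ (i + 1)), ∀ t ∈ Icc (0 : ℝ) 1,
    HasDerivWithinAt (fun s' => H s' t) (D i (s, t)) (Icc (σ i) (σ (i + 1))) s

theorem HomotopyData.pwDeriv {H : ℝ → ℝ → ℂ} {n : ℕ} {σ : ℕ → ℝ} {D : ℕ → ℝ × ℝ → ℂ}
    (h : HomotopyData H n σ D) {t : ℝ} (ht : t ∈ Icc (0 : ℝ) 1) :
    PwDeriv n σ (fun i s => D i (s, t)) fun s => H s t :=
  ⟨h.isSubdivision, fun i hi => (h.continuousOn_deriv i hi).comp (by fun_prop) fun _ hs => ⟨hs, ht⟩,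
    fun i hi s hs => h.hasDeriv i hi s hs t ht⟩

theorem HomotopyData.isHomotopy {H : ℝ → ℝ → ℂ} {n : ℕ} {σ : ℕ → ℝ} {D : ℕ → ℝ × ℝ → ℂ}
    (h : HomotopyData H n σ D) (ha : ∀ t ∈ Icc (0 : ℝ) 1, Allowed Ω fun s => H s t) :
    IsHomotopy Ω H :=
  ⟨h.continuousOn, ⟨n, σ, D, h.isSubdivision, fun i hi =>
    ⟨h.continuousOn_deriv i hi, h.hasDeriv i hi⟩⟩, ha⟩

theorem IsHomotopy.exists_data {H : ℝ → ℝ → ℂ} (h : IsHomotopy Ω H) :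
    ∃ n σ D, HomotopyData H n σ D := by
  obtain ⟨hc, ⟨n, σ, D, hσ, hD⟩, -⟩ := h
  exact ⟨n, σ, D, hc, hσ, fun i hi => (hD i hi).1, fun i hi => (hD i hi).2⟩

theorem IsHomotopy.clOf_eq {H : ℝ → ℝ → ℂ} (h : IsHomotopy Ω H)
    (he : ∀ t ∈ Icc (0 : ℝ) 1, H 1 t = H 1 0) :
    clOf Ω (fun s => H s 0) = clOf Ω (fun s => H s 1) := by
  have h0 := h.2.2 0 (by simp)
  have h1 := h.2.2 1 (by simp)
  rw [Resurgence.clOf_eq h0, Resurgence.clOf_eq h1]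
  exact Quot.sound ⟨H, h, fun _ _ => rfl, fun _ _ => rfl, fun t ht => (h.2.2 t ht).zero, he⟩

theorem PwDeriv.homotopyData_const {n : ℕ} {σ : ℕ → ℝ} {D : ℕ → ℝ → ℂ} (h : PwDeriv n σ D γ) :
    HomotopyData (fun s _ => γ s) n σ fun i q => D i q.1 :=
  ⟨h.piecewiseC1.1.comp (by fun_prop) fun _ hq => hq.1, h.isSubdivision,
    fun i hi => (h.continuousOn i hi).comp (by fun_prop) fun _ hq => hq.1,
    fun i hi s hs _ _ => h.hasDeriv i hi s hs⟩

/-- Values outside `[0, 1]` are absorbed by a constant homotopy, since homotopies are compared with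
paths on `[0, 1]` only. -/
theorem clOf_congr (h : Allowed Ω γ) (he : EqOn γ γ' (Icc 0 1)) : clOf Ω γ = clOf Ω γ' := by
  have h' : Allowed Ω γ' := by
    obtain ⟨L, hL, h⟩ := h
    exact ⟨L, hL, h.congr he⟩
  obtain ⟨n, σ, D, hD⟩ := h.piecewiseC1.exists_pwDeriv
  rw [clOf_eq h, clOf_eq h']
  exact Quot.sound ⟨fun s _ => γ s, hD.homotopyData_const.isHomotopy fun _ _ => h, fun _ _ => rfl,
    fun s hs => he hs, fun _ _ => h.zero, fun _ _ => rfl⟩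

/-! ### Perturbation of homotopies -/

/-- `χ` goes from `0` to `1`, and is `C¹` on the intervals of a subdivision. -/
structure IsCutoff (n : ℕ) (σ : ℕ → ℝ) (χ : ℝ → ℝ) (χ' : ℕ → ℝ → ℝ) : Prop where
  continuous : Continuous χ
  zero : χ 0 = 0
  one : χ 1 = 1
  continuousOn_deriv : ∀ i < n, ContinuousOn (χ' i) (Icc (σ i) (σ (i + 1)))
  hasDeriv : ∀ i < n, ∀ s ∈ Icc (σ i) (σ (i + 1)),
    HasDerivWithinAt χ (χ' i s) (Icc (σ i) (σ (i + 1))) s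

/-- The homotopy `H` with the end moved by `v`. -/
def perturb (H : ℝ → ℝ → ℂ) (χ₁ χ₂ : ℝ → ℝ) (v : ℂ) (s t : ℝ) : ℂ :=
  H s t + (((1 - t) * χ₁ s + t * χ₂ s : ℝ) : ℂ) * v

/-- Truncation of `x` to `[a, b]`. -/
def clamp (a b x : ℝ) : ℝ := max a (min x b)

theorem clamp_mem {a b : ℝ} (h : a ≤ b) (x : ℝ) : clamp a b x ∈ Icc a b :=
  ⟨le_max_left _ _, max_le h (min_le_right _ _)⟩

theorem clamp_eq {a b x : ℝ} (h : x ∈ Icc a b) : clamp a b x = x := by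
  rw [clamp, min_eq_left h.2, max_eq_right h.1]

theorem continuous_clamp (a b : ℝ) : Continuous (clamp a b) := by
  unfold clamp; fun_prop

section perturb

variable {H : ℝ → ℝ → ℂ} {n : ℕ} {σ : ℕ → ℝ} {D : ℕ → ℝ × ℝ → ℂ} {χ₁ χ₂ : ℝ → ℝ}
  {χ₁' χ₂' : ℕ → ℝ → ℝ}

theorem HomotopyData.perturb (h : HomotopyData H n σ D) (h₁ : IsCutoff n σ χ₁ χ₁')
    (h₂ : IsCutoff n σ χ₂ χ₂') (v : ℂ) : HomotopyData (perturb H χ₁ χ₂ v) n σ fun i q =>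
      D i q + (((1 - q.2) * χ₁' i q.1 + q.2 * χ₂' i q.1 : ℝ) : ℂ) * v := by
  have c1 := h₁.continuous
  have c2 := h₂.continuous
  refine ⟨h.continuousOn.add (Continuous.continuousOn (by fun_prop)), h.isSubdivision,
    fun i hi => ?_, fun i hi s hs t ht => ?_⟩
  · have d1 : ContinuousOn (fun q : ℝ × ℝ => χ₁' i q.1) (Icc (σ i) (σ (i + 1)) ×ˢ Icc 0 1) :=
      (h₁.continuousOn_deriv i hi).comp (by fun_prop) fun _ hq => hq.1
    have d2 : ContinuousOn (fun q : ℝ × ℝ => χ₂' i q.1) (Icc (σ i) (σ (i + 1)) ×ˢ Icc 0 1) :=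
      (h₂.continuousOn_deriv i hi).comp (by fun_prop) fun _ hq => hq.1
    have d3 : ContinuousOn (fun q : ℝ × ℝ => (1 - q.2) * χ₁' i q.1 + q.2 * χ₂' i q.1)
        (Icc (σ i) (σ (i + 1)) ×ˢ Icc 0 1) :=
      ((continuousOn_const.sub continuousOn_snd).mul d1).add (continuousOn_snd.mul d2)
    exact (h.continuousOn_deriv i hi).add
      ((Complex.continuous_ofReal.comp_continuousOn d3).mul continuousOn_const)
  · have e1 := ((h₁.hasDeriv i hi s hs).const_mul (1 - t)).add
      ((h₂.hasDeriv i hi s hs).const_mul t)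
    exact (h.hasDeriv i hi s hs t ht).add (e1.ofReal_comp.mul_const v)

/-- The bound `L` depends on `t`, but the one at `t₀` still works for `(v, t)` near `(0, t₀)`: the
length is continuous in `(v, t)` and avoiding a finite set on a compact interval is an open
condition. Compactness in `t` then gives one neighbourhood of `v = 0`. -/
theorem HomotopyData.eventually_avoid (h : HomotopyData H n σ D) (h₁ : IsCutoff n σ χ₁ χ₁')
    (h₂ : IsCutoff n σ χ₂ χ₂') (ha : ∀ t ∈ Icc (0 : ℝ) 1, Allowed Ω fun s => H s t) :
    ∀ᶠ v in 𝓝 (0 : ℂ), ∀ t ∈ Icc (0 : ℝ) 1, ∃ L,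
      pathLength (fun s => Resurgence.perturb H χ₁ χ₂ v s t) < L ∧
      ∀ s ∈ Icc (0 : ℝ) 1, Resurgence.perturb H χ₁ χ₂ v s t ∉ Ω.level L \ {ω} := by
  have c1 := h₁.continuous
  have c2 := h₂.continuous
  have k01 := continuous_clamp 0 1
  -- The repeated membership is needed because neighbourhoods of `t₀` in `ℝ` contain times outside
  -- `[0, 1]`, about which `H` says nothing.
  suffices hsuff : ∀ᶠ v in 𝓝 (0 : ℂ), ∀ t ∈ Icc (0 : ℝ) 1, t ∈ Icc (0 : ℝ) 1 → ∃ L,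
      pathLength (fun s => Resurgence.perturb H χ₁ χ₂ v s t) < L ∧
      ∀ s ∈ Icc (0 : ℝ) 1, Resurgence.perturb H χ₁ χ₂ v s t ∉ Ω.level L \ {ω} from
    hsuff.mono fun v hv t ht => hv t ht ht
  refine isCompact_Icc.eventually_forall_of_forall_eventually fun t₀ ht₀ => ?_
  obtain ⟨L, hL0, hL⟩ := ha t₀ ht₀
  rw [allowedAt_iff] at hL
  -- the length is a continuous function
  set E : ℕ → (ℂ × ℝ) → ℝ → ℂ := fun i z s => D i (clamp (σ i) (σ (i + 1)) s, clamp 0 1 z.2) +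
    (((1 - clamp 0 1 z.2) * χ₁' i (clamp (σ i) (σ (i + 1)) s) +
      clamp 0 1 z.2 * χ₂' i (clamp (σ i) (σ (i + 1)) s) : ℝ) : ℂ) * z.1 with hE
  have hEc : ∀ i < n, Continuous fun q : (ℂ × ℝ) × ℝ => E i q.1 q.2 := by
    intro i hi
    have ki := continuous_clamp (σ i) (σ (i + 1))
    have hle := (h.isSubdivision.2.2 i hi).le
    have d0 : Continuous fun q : (ℂ × ℝ) × ℝ =>
        D i (clamp (σ i) (σ (i + 1)) q.2, clamp 0 1 q.1.2) :=
      (h.continuousOn_deriv i hi).comp_continuous (by fun_prop)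
        fun q => ⟨clamp_mem hle _, clamp_mem zero_le_one _⟩
    have d1 : Continuous fun q : (ℂ × ℝ) × ℝ => χ₁' i (clamp (σ i) (σ (i + 1)) q.2) :=
      (h₁.continuousOn_deriv i hi).comp_continuous (by fun_prop) fun q => clamp_mem hle _
    have d2 : Continuous fun q : (ℂ × ℝ) × ℝ => χ₂' i (clamp (σ i) (σ (i + 1)) q.2) :=
      (h₂.continuousOn_deriv i hi).comp_continuous (by fun_prop) fun q => clamp_mem hle _
    have d3 : Continuous fun q : (ℂ × ℝ) × ℝ => clamp 0 1 q.1.2 := k01.comp (by fun_prop)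
    exact d0.add ((Complex.continuous_ofReal.comp
      (((continuous_const.sub d3).mul d1).add (d3.mul d2))).mul (by fun_prop))
  set Λ : ℂ × ℝ → ℝ := fun z => ∑ i ∈ Finset.range n, ∫ s in σ i..σ (i + 1), ‖E i z s‖ with hΛ
  have hΛc : Continuous Λ := by
    refine continuous_finsetSum _ fun i hi => ?_
    exact intervalIntegral.continuous_parametric_intervalIntegral_of_continuous'
      (f := fun z s => ‖E i z s‖) (hEc i (Finset.mem_range.1 hi)).norm _ _
  have hΛe : ∀ v, ∀ t ∈ Icc (0 : ℝ) 1,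
      pathLength (fun s => Resurgence.perturb H χ₁ χ₂ v s t) = Λ (v, t) := by
    intro v t ht
    rw [((h.perturb h₁ h₂ v).pwDeriv ht).pathLength_eq]
    refine Finset.sum_congr rfl fun i hi => intervalIntegral.integral_congr fun s hs => ?_
    rw [uIcc_of_le (h.isSubdivision.2.2 i (Finset.mem_range.1 hi)).le] at hs
    simp only [hE, clamp_eq hs, clamp_eq ht]
  have hlen : Λ (0, t₀) < L := by
    rw [← hΛe 0 t₀ ht₀]
    simpa [Resurgence.perturb] using hL.2.2.1
  -- the path avoids the singular points
  have hHc : Continuous fun q : (ℂ × ℝ) × ℝ =>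
      H (clamp 0 1 q.2) (clamp 0 1 q.1.2) + (((1 - clamp 0 1 q.1.2) * χ₁ (clamp 0 1 q.2) +
        clamp 0 1 q.1.2 * χ₂ (clamp 0 1 q.2) : ℝ) : ℂ) * q.1.1 := by
    have d0 : Continuous fun q : (ℂ × ℝ) × ℝ => H (clamp 0 1 q.2) (clamp 0 1 q.1.2) :=
      h.continuousOn.comp_continuous (f := fun q : (ℂ × ℝ) × ℝ => (clamp 0 1 q.2, clamp 0 1 q.1.2))
        (by fun_prop) fun q => ⟨clamp_mem zero_le_one _, clamp_mem zero_le_one _⟩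
    exact d0.add (by fun_prop)
  have hopen : IsOpen (Ω.level L \ {ω})ᶜ :=
    ((Ω.finite_level L hL0).subset sdiff_subset).isClosed.isOpen_compl
  have hav : ∀ᶠ z : ℂ × ℝ in 𝓝 (0, t₀), ∀ s ∈ Icc (0 : ℝ) 1,
      H (clamp 0 1 s) (clamp 0 1 z.2) + (((1 - clamp 0 1 z.2) * χ₁ (clamp 0 1 s) +
        clamp 0 1 z.2 * χ₂ (clamp 0 1 s) : ℝ) : ℂ) * z.1 ∈ (Ω.level L \ {ω})ᶜ := by
    refine isCompact_Icc.eventually_forall_of_forall_eventually fun s hs => ?_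
    refine hHc.continuousAt.eventually_mem (hopen.mem_nhds ?_)
    simpa [clamp_eq hs, clamp_eq ht₀] using hL.2.2.2.2 s hs
  filter_upwards [hav, hΛc.continuousAt.eventually (gt_mem_nhds hlen)] with z hz1 hz2 hz
  refine ⟨L, by rw [hΛe _ _ hz]; exact hz2, fun s hs => ?_⟩
  have := hz1 s hs
  rwa [clamp_eq hs, clamp_eq hz] at this

/-- Moving slightly the common end of all the paths of a homotopy. -/
theorem HomotopyData.eventually_clOf_eq (h : HomotopyData H n σ D) (h₁ : IsCutoff n σ χ₁ χ₁')
    (h₂ : IsCutoff n σ χ₂ χ₂') (ha : ∀ t ∈ Icc (0 : ℝ) 1, Allowed Ω fun s => H s t)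
    (he : ∀ t ∈ Icc (0 : ℝ) 1, H 1 t = H 1 0)
    (hd : ∀ᶠ v in 𝓝 (0 : ℂ), ∀ t ∈ Icc (0 : ℝ) 1,
      Departs ω fun s => Resurgence.perturb H χ₁ χ₂ v s t) :
    ∀ᶠ v in 𝓝 (0 : ℂ), Allowed Ω (fun s => H s 0 + χ₁ s * v) ∧
      Allowed Ω (fun s => H s 1 + χ₂ s * v) ∧
      clOf Ω (fun s => H s 0 + χ₁ s * v) = clOf Ω (fun s => H s 1 + χ₂ s * v) := by
  filter_upwards [h.eventually_avoid h₁ h₂ ha, hd] with v hv1 hv2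
  have hall : ∀ t ∈ Icc (0 : ℝ) 1, Allowed Ω fun s => Resurgence.perturb H χ₁ χ₂ v s t := by
    intro t ht
    obtain ⟨L, hL1, hL2⟩ := hv1 t ht
    refine AllowedAt.allowed (L := L) (allowedAt_iff.2 ⟨?_,
      ((h.perturb h₁ h₂ v).pwDeriv ht).piecewiseC1, hL1, hv2 t ht, hL2⟩)
    have := (ha t ht).zero
    simp [Resurgence.perturb, h₁.zero, h₂.zero, this]
  have e0 : (fun s => Resurgence.perturb H χ₁ χ₂ v s 0) = fun s => H s 0 + χ₁ s * v := by
    funext s; simp [Resurgence.perturb]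
  have e1 : (fun s => Resurgence.perturb H χ₁ χ₂ v s 1) = fun s => H s 1 + χ₂ s * v := by
    funext s; simp [Resurgence.perturb]
  have key := ((h.perturb h₁ h₂ v).isHomotopy hall).clOf_eq fun t ht => by
    simp [Resurgence.perturb, h₁.one, h₂.one, he t ht]
  have a0 := hall 0 (by simp)
  have a1 := hall 1 (by simp)
  rw [e0] at a0 key
  rw [e1] at a1 key
  exact ⟨a0, a1, key⟩

/-- Nothing changes on `[0, a]`, where the cutoffs vanish, and on the compact set `[a, 1] × [0, 1]`
the homotopy stays away from `ω`. -/
theorem HomotopyData.eventually_departs (h : HomotopyData H n σ D)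
    (hc₁ : Continuous χ₁) (hc₂ : Continuous χ₂)
    (ha : ∀ t ∈ Icc (0 : ℝ) 1, Allowed Ω fun s => H s t) {a : ℝ} (ha01 : a ∈ Icc (0 : ℝ) 1)
    (hne : ∀ t ∈ Icc (0 : ℝ) 1, ∀ s ∈ Icc a 1, H s t ≠ ω)
    (hz : ∀ s ∈ Icc 0 a, χ₁ s = 0 ∧ χ₂ s = 0) :
    ∀ᶠ v in 𝓝 (0 : ℂ), ∀ t ∈ Icc (0 : ℝ) 1,
      Departs ω fun s => Resurgence.perturb H χ₁ χ₂ v s t := by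
  have k01 := continuous_clamp 0 1
  have hHc : Continuous fun q : ℂ × ℝ × ℝ =>
      H (clamp 0 1 q.2.1) (clamp 0 1 q.2.2) + (((1 - clamp 0 1 q.2.2) * χ₁ (clamp 0 1 q.2.1) +
        clamp 0 1 q.2.2 * χ₂ (clamp 0 1 q.2.1) : ℝ) : ℂ) * q.1 := by
    have d0 : Continuous fun q : ℂ × ℝ × ℝ => H (clamp 0 1 q.2.1) (clamp 0 1 q.2.2) :=
      h.continuousOn.comp_continuous
        (f := fun q : ℂ × ℝ × ℝ => (clamp 0 1 q.2.1, clamp 0 1 q.2.2))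
        (by fun_prop) fun q => ⟨clamp_mem zero_le_one _, clamp_mem zero_le_one _⟩
    exact d0.add (by fun_prop)
  have key : ∀ᶠ v in 𝓝 (0 : ℂ), ∀ q ∈ Icc a 1 ×ˢ Icc (0 : ℝ) 1,
      H (clamp 0 1 q.1) (clamp 0 1 q.2) + (((1 - clamp 0 1 q.2) * χ₁ (clamp 0 1 q.1) +
        clamp 0 1 q.2 * χ₂ (clamp 0 1 q.1) : ℝ) : ℂ) * v ∈ ({ω} : Set ℂ)ᶜ := by
    refine (isCompact_Icc.prod isCompact_Icc).eventually_forall_of_forall_eventually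
      fun q hq => ?_
    refine hHc.continuousAt.eventually_mem (isOpen_compl_singleton.mem_nhds ?_)
    have hq1 : q.1 ∈ Icc (0 : ℝ) 1 := ⟨ha01.1.trans hq.1.1, hq.1.2⟩
    simpa [clamp_eq hq1, clamp_eq hq.2] using hne q.2 hq.2 q.1 hq.1
  filter_upwards [key] with v hv t ht
  refine (ha t ht).departs.of_eqOn ha01 (fun s hs => ?_) fun s hs => ?_
  · simp [Resurgence.perturb, hz s hs]
  · have := hv (s, t) ⟨hs, ht⟩
    rwa [clamp_eq (⟨ha01.1.trans hs.1, hs.2⟩ : s ∈ Icc (0 : ℝ) 1), clamp_eq ht] at this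

end perturb

/-! ### Cutoff functions -/

/-- A `C¹` function with value `1` at `1` which vanishes on `(-∞, 1 - δ]`. -/
def bump (δ s : ℝ) : ℝ := (max 0 (1 - (1 - s) / δ)) ^ 2

theorem hasDerivAt_sq_max (x : ℝ) : HasDerivAt (fun y : ℝ => (max 0 y) ^ 2) (2 * max 0 x) x := by
  have hpos : ∀ y : ℝ, HasDerivAt (fun y : ℝ => y ^ 2) (2 * y) y := fun y => by
    simpa using hasDerivAt_pow 2 y
  rcases lt_trichotomy x 0 with h | rfl | h
  · rw [max_eq_left h.le, mul_zero]
    refine (hasDerivAt_const x (0 : ℝ)).congr_of_eventuallyEq ?_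
    filter_upwards [Iio_mem_nhds h] with y hy
    rw [max_eq_left (le_of_lt hy)]; norm_num
  · rw [max_self, mul_zero]
    rw [hasDerivAt_iff_isLittleO_nhds_zero]
    have := (hasDerivAt_iff_isLittleO_nhds_zero.1 (hpos 0))
    refine Asymptotics.IsBigO.trans_isLittleO (Asymptotics.IsBigO.of_bound 1 ?_) this
    refine Eventually.of_forall fun y => ?_
    rcases le_total y 0 with hy | hy
    · simp [max_eq_left hy]; positivity
    · simp [max_eq_right hy]
  · rw [max_eq_right h.le]
    refine (hpos x).congr_of_eventuallyEq ?_
    filter_upwards [Ioi_mem_nhds h] with y hy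
    rw [max_eq_right (le_of_lt hy)]

theorem isCutoff_bump {n : ℕ} {σ : ℕ → ℝ} {δ : ℝ} (hδ : δ ∈ Ioc (0 : ℝ) 1) :
    IsCutoff n σ (bump δ) fun _ s => 2 * max 0 (1 - (1 - s) / δ) * δ⁻¹ := by
  refine ⟨by unfold bump; fun_prop, ?_, by simp [bump],
    fun i hi => Continuous.continuousOn (by fun_prop), fun i hi s hs => ?_⟩
  · have : 1 ≤ 1 / δ := by rw [le_div_iff₀ hδ.1]; simpa using hδ.2
    rw [bump, max_eq_left (by simpa using this)]; norm_num
  · have h1 : HasDerivAt (fun s : ℝ => 1 - (1 - s) / δ) δ⁻¹ s := by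
      have := (((hasDerivAt_id s).const_sub 1).div_const δ).const_sub 1
      simpa [neg_div] using this
    exact ((hasDerivAt_sq_max _).comp s h1).hasDerivWithinAt

theorem bump_eq_zero {δ s : ℝ} (hδ : 0 < δ) (hs : s ≤ 1 - δ) : bump δ s = 0 := by
  have : 1 ≤ (1 - s) / δ := by rw [le_div_iff₀ hδ]; linarith
  rw [bump, max_eq_left (by linarith)]; norm_num

theorem bump_mem {δ s : ℝ} (hδ : δ ∈ Ioc (0 : ℝ) 1) (hs : s ∈ Icc (0 : ℝ) 1) :
    0 ≤ bump δ s ∧ bump δ s ≤ s := by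
  refine ⟨sq_nonneg _, ?_⟩
  have h1 : 1 - s ≤ (1 - s) / δ := by
    rw [le_div_iff₀ hδ.1]; nlinarith [hδ.2, hs.2]
  have h2 : max 0 (1 - (1 - s) / δ) ≤ s := max_le hs.1 (by linarith)
  have h3 : 0 ≤ max 0 (1 - (1 - s) / δ) := le_max_left _ _
  rw [bump, sq]
  nlinarith [hs.2]

end allowedPaths

section localSections

/-! ### Local sections of the projection -/

variable {ω : ℂ} {Ω : DiscreteFilteredSet ω} {γ p : ℝ → ℂ} {L L₂ : ℝ} {U : Set ℂ}

theorem HomotopyData.eventually_clOf_bump {H : ℝ → ℝ → ℂ} {n : ℕ} {σ : ℕ → ℝ}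
    {D : ℕ → ℝ × ℝ → ℂ} (h : HomotopyData H n σ D)
    (ha : ∀ t ∈ Icc (0 : ℝ) 1, Allowed Ω fun s => H s t)
    (he : ∀ t ∈ Icc (0 : ℝ) 1, H 1 t = H 1 0) {δ δ₁ δ₂ : ℝ} (hδ : δ ∈ Ioc (0 : ℝ) 1)
    (hne : ∀ t ∈ Icc (0 : ℝ) 1, ∀ s ∈ Icc (1 - δ) 1, H s t ≠ ω)
    (h₁ : δ₁ ∈ Ioc 0 δ) (h₂ : δ₂ ∈ Ioc 0 δ) :
    ∀ᶠ v in 𝓝 (0 : ℂ), clOf Ω (fun s => H s 0 + bump δ₁ s * v) =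
      clOf Ω (fun s => H s 1 + bump δ₂ s * v) := by
  have c1 := isCutoff_bump (n := n) (σ := σ) ⟨h₁.1, h₁.2.trans hδ.2⟩
  have c2 := isCutoff_bump (n := n) (σ := σ) ⟨h₂.1, h₂.2.trans hδ.2⟩
  refine (h.eventually_clOf_eq c1 c2 ha he (h.eventually_departs c1.continuous c2.continuous ha
    (a := 1 - δ) ⟨by linarith [hδ.2], by linarith [hδ.1]⟩ hne fun s hs => ?_)).mono
    fun v hv => hv.2.2
  exact ⟨bump_eq_zero h₁.1 (by linarith [hs.2, h₁.2]), bump_eq_zero h₂.1 (by linarith [hs.2, h₂.2])⟩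

/-- The width of the bump is immaterial: the constant homotopy is perturbed with one cutoff at time
`0` and the other at time `1`. -/
theorem eventually_clOf_bump (h : Allowed Ω γ) {δ δ₁ δ₂ : ℝ} (hδ : δ ∈ Ioc (0 : ℝ) 1)
    (hne : ∀ s ∈ Icc (1 - δ) 1, γ s ≠ ω) (h₁ : δ₁ ∈ Ioc 0 δ) (h₂ : δ₂ ∈ Ioc 0 δ) :
    ∀ᶠ v in 𝓝 (0 : ℂ), clOf Ω (fun s => γ s + bump δ₁ s * v) =
      clOf Ω (fun s => γ s + bump δ₂ s * v) := by
  obtain ⟨n, σ, D, hD⟩ := h.piecewiseC1.exists_pwDeriv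
  exact hD.homotopyData_const.eventually_clOf_bump (fun _ _ => h) (fun _ _ => rfl) hδ
    (fun _ _ => hne) h₁ h₂

theorem IsHomotopy.exists_ne {H : ℝ → ℝ → ℂ} (h : IsHomotopy Ω H)
    (hne : ∀ t ∈ Icc (0 : ℝ) 1, H 1 t ≠ ω) :
    ∃ δ ∈ Ioc (0 : ℝ) 1, ∀ t ∈ Icc (0 : ℝ) 1, ∀ s ∈ Icc (1 - δ) 1, H s t ≠ ω := by
  have k01 := continuous_clamp 0 1
  have hc : Continuous fun q : ℝ × ℝ => H (clamp 0 1 q.1) (clamp 0 1 q.2) :=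
    h.1.comp_continuous (f := fun q : ℝ × ℝ => (clamp 0 1 q.1, clamp 0 1 q.2))
      (by fun_prop) fun q => ⟨clamp_mem zero_le_one _, clamp_mem zero_le_one _⟩
  have key : ∀ᶠ s in 𝓝 (1 : ℝ), ∀ t ∈ Icc (0 : ℝ) 1,
      H (clamp 0 1 s) (clamp 0 1 t) ∈ ({ω} : Set ℂ)ᶜ := by
    refine isCompact_Icc.eventually_forall_of_forall_eventually fun t ht => ?_
    refine hc.continuousAt.eventually_mem (isOpen_compl_singleton.mem_nhds ?_)
    have : (1 : ℝ) ∈ Icc (0 : ℝ) 1 := by simp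
    simpa [clamp_eq this, clamp_eq ht] using hne t ht
  obtain ⟨ε, hε, hball⟩ := Metric.eventually_nhds_iff_ball.1 key
  refine ⟨min 1 (ε / 2), ⟨lt_min one_pos (half_pos hε), min_le_left _ _⟩, fun t ht s hs => ?_⟩
  have h1 := min_le_left 1 (ε / 2)
  have h2 := min_le_right 1 (ε / 2)
  have hs' : s ∈ Icc (0 : ℝ) 1 := ⟨by linarith [hs.1], hs.2⟩
  have := hball s (by
    rw [Metric.mem_ball, Real.dist_eq, abs_sub_comm, abs_of_nonneg (by linarith [hs.2])]
    linarith [hs.1]) t ht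
  rwa [clamp_eq hs', clamp_eq ht] at this

theorem Allowed.exists_ne (h : Allowed Ω γ) (hne : γ 1 ≠ ω) :
    ∃ δ ∈ Ioc (0 : ℝ) 1, ∀ s ∈ Icc (1 - δ) 1, γ s ≠ ω := by
  obtain ⟨n, σ, D, hD⟩ := h.piecewiseC1.exists_pwDeriv
  obtain ⟨δ, hδ, hδ'⟩ := (hD.homotopyData_const.isHomotopy fun _ _ => h).exists_ne fun _ _ => hne
  exact ⟨δ, hδ, hδ' 0 (by simp)⟩

/-- Equality in the quotient is a finite chain of homotopies, possibly reversed. Each link survives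
moving the common end by a narrow bump, and a chain uses the smallest width. -/
theorem exists_eventually_clOf_bump {α β : AllowedPath Ω} (h : cl α = cl β) (hne : α.1 1 ≠ ω) :
    ∃ δ ∈ Ioc (0 : ℝ) 1, ∀ δ' ∈ Ioc 0 δ, ∀ᶠ v in 𝓝 (0 : ℂ),
      clOf Ω (fun s => α.1 s + bump δ' s * v) = clOf Ω (fun s => β.1 s + bump δ' s * v) := by
  have hend : ∀ {α β : AllowedPath Ω}, Relation.EqvGen (Homotopic Ω) α β → α.1 1 = β.1 1 :=
    fun h => congrArg proj (Quot.eqvGen_sound h)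
  replace h := Quot.eqvGen_exact h
  induction h with
  | rel α β h =>
    obtain ⟨H, hH, h0, h1, hs, he⟩ := h
    have he' : ∀ t ∈ Icc (0 : ℝ) 1, H 1 t = H 1 0 := fun t ht => by
      rw [he t ht, he 0 (by simp)]
    obtain ⟨n, σ, D, hD⟩ := hH.exists_data
    obtain ⟨δ, hδ, hδ'⟩ := hH.exists_ne fun t ht => by rw [he t ht]; exact hne
    refine ⟨δ, hδ, fun δ' hd => ?_⟩
    have c1 := isCutoff_bump (n := n) (σ := σ) ⟨hd.1, hd.2.trans hδ.2⟩
    have key := hD.eventually_clOf_eq c1 c1 hH.2.2 he' (hD.eventually_departs c1.continuous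
      c1.continuous hH.2.2 (a := 1 - δ) ⟨by linarith [hδ.2], by linarith [hδ.1]⟩ hδ' fun s hs => by
        simp [bump_eq_zero hd.1 (by linarith [hs.2, hd.2] : s ≤ 1 - δ')])
    filter_upwards [key] with v hv
    exact ((clOf_congr hv.1 fun s hs => by simp only [h0 s hs]).symm.trans hv.2.2).trans
      (clOf_congr hv.2.1 fun s hs => by simp only [h1 s hs])
  | refl α => exact ⟨1, by simp, fun _ _ => Eventually.of_forall fun _ => rfl⟩
  | symm α β h ih =>
    obtain ⟨δ, hδ, h'⟩ := ih (by rwa [hend h])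
    exact ⟨δ, hδ, fun δ' hd => (h' δ' hd).mono fun _ hv => hv.symm⟩
  | trans α β γ h1 h2 ih1 ih2 =>
    obtain ⟨δ, hδ, h⟩ := ih1 hne
    obtain ⟨δ', hδ', h'⟩ := ih2 (by rwa [← hend h1])
    refine ⟨min δ δ', ⟨lt_min hδ.1 hδ'.1, (min_le_left _ _).trans hδ.2⟩, fun d hd => ?_⟩
    filter_upwards [h d ⟨hd.1, hd.2.trans (min_le_left _ _)⟩,
      h' d ⟨hd.1, hd.2.trans (min_le_right _ _)⟩] with v e1 e2
    exact e1.trans e2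

/-! Segments issued from the end of a path. -/

/-- The data of a basic open set around the class of the path `p`. -/
structure IsStarNhd (Ω : DiscreteFilteredSet ω) (p : ℝ → ℂ) (L L₂ : ℝ) (U : Set ℂ) : Prop where
  allowedAt : AllowedAt Ω L p
  pos : 0 < L₂
  add_lt : pathLength p + L₂ < L
  isOpen : IsOpen U
  mem : p 1 ∈ U
  star : StarConvex ℝ (p 1) U
  subset : U ⊆ Metric.ball (p 1) L₂ \ Ω.level L

/-- The product of `p` with the segment from its end to `ξ`. -/
def segConcat (p : ℝ → ℂ) (ξ : ℂ) : ℝ → ℂ := concat p fun t => AffineMap.lineMap (p 1) ξ t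

theorem segConcat_left {ξ : ℂ} {t : ℝ} (ht : t ≤ 1 / 2) : segConcat p ξ t = p (2 * t) :=
  concat_left ht

theorem segConcat_right {ξ : ℂ} {t : ℝ} (ht : 1 / 2 ≤ t) :
    segConcat p ξ t = AffineMap.lineMap (p 1) ξ (2 * t - 1) := concat_right (by simp) ht

theorem segConcat_one {ξ : ℂ} : segConcat p ξ 1 = ξ := by
  rw [segConcat_right (by norm_num)]; norm_num

theorem lineMap_mem_of_starConvex {x ξ : ℂ} (hU : StarConvex ℝ x U) (hξ : ξ ∈ U) {u : ℝ}
    (hu : u ∈ Icc (0 : ℝ) 1) : (AffineMap.lineMap x ξ u : ℂ) ∈ U := by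
  have := hU hξ (sub_nonneg.2 hu.2) hu.1 (sub_add_cancel 1 u)
  rw [AffineMap.lineMap_apply_module]
  exact this

theorem Departs.segConcat (h : Departs ω p) {ξ : ℂ}
    (hne : ∀ u ∈ Icc (0 : ℝ) 1, (AffineMap.lineMap (p 1) ξ u : ℂ) ≠ ω) :
    Departs ω (segConcat p ξ) := by
  have h1 : p 1 ≠ ω := by simpa using hne 0 (by simp)
  rcases h with h | ⟨t₀, ht₀, h2, h3⟩
  · exact absurd (h 1 (by simp)) h1
  · refine Or.inr ⟨t₀ / 2, ⟨by linarith [ht₀.1], by linarith [ht₀.2]⟩, fun t ht => ?_,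
      fun t ht => ?_⟩
    · rw [segConcat_left (by linarith [ht.2, ht₀.2])]
      exact h2 _ ⟨by linarith [ht.1], by linarith [ht.2]⟩
    · rcases le_total t (1 / 2) with h4 | h4
      · rw [segConcat_left h4]
        exact h3 _ ⟨by linarith [ht.1], by linarith⟩
      · rw [segConcat_right h4]
        exact hne _ ⟨by linarith, by linarith [ht.2]⟩

theorem AllowedAt.segConcat (h : AllowedAt Ω L p) {ξ : ℂ} (hl : pathLength p + ‖ξ - p 1‖ < L)
    (hav : ∀ u ∈ Icc (0 : ℝ) 1, (AffineMap.lineMap (p 1) ξ u : ℂ) ∉ Ω.level L) :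
    AllowedAt Ω L (segConcat p ξ) := by
  have hω := Ω.center_mem (pathLength_nonneg.trans_lt h.2.2.1)
  rw [allowedAt_iff] at h ⊢
  refine ⟨?_, h.2.1.concat_lineMap ξ, (h.2.1.pathLength_concat_le ξ).trans_lt hl,
    h.2.2.2.1.segConcat fun u hu he => hav u hu (he ▸ hω), fun t ht hm => ?_⟩
  · rw [segConcat_left (by norm_num), mul_zero, h.1]
  · rcases le_total t (1 / 2) with h4 | h4
    · rw [segConcat_left h4] at hm
      exact h.2.2.2.2 _ ⟨by linarith [ht.1], by linarith⟩ hm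
    · rw [segConcat_right h4] at hm
      exact hav _ ⟨by linarith, by linarith [ht.2]⟩ hm.1

theorem IsStarNhd.lineMap_notMem (h : IsStarNhd Ω p L L₂ U) {ξ : ℂ} (hξ : ξ ∈ U) {u : ℝ}
    (hu : u ∈ Icc (0 : ℝ) 1) : (AffineMap.lineMap (p 1) ξ u : ℂ) ∉ Ω.level L :=
  (h.subset (lineMap_mem_of_starConvex h.star hξ hu)).2

theorem IsStarNhd.allowedAt_segConcat (h : IsStarNhd Ω p L L₂ U) {ξ : ℂ} (hξ : ξ ∈ U) :
    AllowedAt Ω L (segConcat p ξ) := by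
  have := (h.subset hξ).1
  rw [Metric.mem_ball, dist_eq_norm] at this
  exact h.allowedAt.segConcat (by linarith [h.add_lt]) fun u hu => h.lineMap_notMem hξ hu

theorem IsStarNhd.center_mem (h : IsStarNhd Ω p L L₂ U) : ω ∈ Ω.level L :=
  Ω.center_mem (pathLength_nonneg.trans_lt h.allowedAt.2.2.1)

theorem IsStarNhd.ne (h : IsStarNhd Ω p L L₂ U) {ξ : ℂ} (hξ : ξ ∈ U) {t : ℝ}
    (ht : t ∈ Icc (1 / 2 : ℝ) 1) : segConcat p ξ t ≠ ω := fun he => by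
  rw [segConcat_right ht.1] at he
  exact h.lineMap_notMem hξ (u := 2 * t - 1) ⟨by linarith [ht.1], by linarith [ht.2]⟩
    (by rw [he]; exact h.center_mem)

/-- With this cutoff, perturbing `p · [p(1), ξ]` by `v` gives exactly `p · [p(1), ξ + v]`. -/
theorem isCutoff_half {n : ℕ} {σ : ℕ → ℝ} (hσ : IsSubdivision n σ) :
    IsCutoff (n + 1) (halfSubdivision n σ) (fun s => max 0 (2 * s - 1))
      fun i _ => if i < n then 0 else 2 := by
  refine ⟨by fun_prop, by norm_num, by norm_num, fun i hi => ?_, fun i hi s hs => ?_⟩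
  · by_cases h1 : i < n <;> simp only [h1, if_true, if_false] <;> exact continuousOn_const
  · by_cases h1 : i < n
    · simp only [h1, if_true]
      have e : ∀ u ∈ Icc (halfSubdivision n σ i) (halfSubdivision n σ (i + 1)),
          max 0 (2 * u - 1) = 0 := fun u hu => max_eq_left (by
        linarith [(two_mul_mem h1 hu).2, (hσ.mem_Icc (Nat.succ_le_of_lt h1)).2])
      exact (hasDerivWithinAt_const s _ (0 : ℝ)).congr e (e s hs)
    · simp only [h1, if_false]
      obtain rfl : i = n := by omega
      rw [(halfSubdivision_last hσ).1, (halfSubdivision_last hσ).2] at hs ⊢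
      have e : ∀ u ∈ Icc (1 / 2 : ℝ) 1, max 0 (2 * u - 1) = 2 * u - 1 := fun u hu =>
        max_eq_right (by linarith [hu.1])
      have h2 : HasDerivAt (fun u : ℝ => 2 * u - 1) 2 s := by
        simpa using ((hasDerivAt_id s).const_mul (2 : ℝ)).sub_const 1
      exact h2.hasDerivWithinAt.congr e (e s hs)

theorem IsStarNhd.eventually_clOf_eq (h : IsStarNhd Ω p L L₂ U) {ξ : ℂ} (hξ : ξ ∈ U) {δ : ℝ}
    (hδ : δ ∈ Ioc (0 : ℝ) (1 / 2)) :
    ∀ᶠ v in 𝓝 (0 : ℂ), clOf Ω (fun s => segConcat p ξ s + bump δ s * v) =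
      clOf Ω (segConcat p (ξ + v)) := by
  obtain ⟨n, σ, D, hD⟩ := h.allowedAt.2.1.exists_pwDeriv
  have hH := (hD.concat_lineMap ξ).homotopyData_const
  have hall : Allowed Ω (segConcat p ξ) := (h.allowedAt_segConcat hξ).allowed
  have c1 := isCutoff_bump (n := n + 1) (σ := halfSubdivision n σ) (δ := δ)
    ⟨hδ.1, by linarith [hδ.2]⟩
  have c2 := isCutoff_half hD.isSubdivision
  have key := hH.eventually_clOf_eq c1 c2 (fun _ _ => hall) (fun _ _ => rfl)
    (hH.eventually_departs c1.continuous c2.continuous (fun _ _ => hall) (a := 1 / 2)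
      (by norm_num) (fun _ _ s hs => h.ne hξ hs) fun s hs =>
        ⟨bump_eq_zero hδ.1 (by linarith [hs.2, hδ.2]), max_eq_left (by linarith [hs.2])⟩)
  filter_upwards [key] with v hv
  refine hv.2.2.trans (clOf_congr hv.2.1 fun s hs => ?_)
  change segConcat p ξ s + _ = _
  rcases le_total s (1 / 2) with h1 | h1
  · rw [segConcat_left h1, segConcat_left h1, max_eq_left (by linarith)]; simp
  · rw [segConcat_right h1, segConcat_right h1, max_eq_right (by linarith)]
    simp only [AffineMap.lineMap_apply_module', Complex.real_smul]
    ring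

/-! Segments issued from the centre. -/

/-- The data of a basic open set around the base point. -/
structure IsCentralNhd (Ω : DiscreteFilteredSet ω) (L : ℝ) (U : Set ℂ) : Prop where
  pos : 0 < L
  isOpen : IsOpen U
  mem : ω ∈ U
  star : StarConvex ℝ ω U
  subset : U ⊆ Metric.ball ω L \ (Ω.level L \ {ω})

/-- The segment from `ω` to `ξ`. -/
def ray (ω ξ : ℂ) (t : ℝ) : ℂ := AffineMap.lineMap ω ξ t

theorem ray_eq (ξ : ℂ) (t : ℝ) : ray ω ξ t = ω + t * (ξ - ω) := by
  simp [ray, AffineMap.lineMap_apply_module', add_comm]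

theorem ray_one (ξ : ℂ) : ray ω ξ 1 = ξ := by simp [ray]

theorem departs_ray (ξ : ℂ) : Departs ω (ray ω ξ) := by
  by_cases h : ξ = ω
  · exact Or.inl fun t _ => by simp [ray_eq, h]
  · refine Or.inr ⟨0, by simp, fun t ht => ?_, fun t ht he => ?_⟩
    · obtain rfl := le_antisymm ht.2 ht.1
      simp [ray_eq]
    · rw [ray_eq, add_eq_left, mul_eq_zero, sub_eq_zero] at he
      rcases he with he | he
      · exact ht.1.ne' (by exact_mod_cast he)
      · exact h he

theorem IsCentralNhd.allowedAt_ray (h : IsCentralNhd Ω L U) {ξ : ℂ} (hξ : ξ ∈ U) :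
    AllowedAt Ω L (ray ω ξ) := by
  have h1 := (h.subset hξ).1
  rw [Metric.mem_ball, dist_eq_norm] at h1
  exact allowedAt_iff.2 ⟨by simp [ray], (pwDeriv_lineMap ω ξ).piecewiseC1,
    (pathLength_lineMap_le ω ξ).trans_lt h1, departs_ray ξ, fun t ht =>
    (h.subset (lineMap_mem_of_starConvex h.star hξ ht)).2⟩

theorem isCutoff_id {n : ℕ} {σ : ℕ → ℝ} : IsCutoff n σ (fun s => s) fun _ _ => 1 :=
  ⟨continuous_id, rfl, rfl, fun _ _ => continuousOn_const,
    fun _ _ s _ => (hasDerivAt_id s).hasDerivWithinAt⟩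

/-- The cutoff `s ↦ s` does not vanish near `0`, so the departure is checked by hand: the
perturbation has norm at most `s * ‖v‖`, less than the distance `s * ‖ξ - ω‖` from the ray to `ω`.
This is where `bump δ s ≤ s` enters. -/
theorem eventually_clOf_ray {ξ : ℂ} (h : Allowed Ω (ray ω ξ)) (hne : ξ ≠ ω) {δ : ℝ}
    (hδ : δ ∈ Ioc (0 : ℝ) 1) :
    ∀ᶠ v in 𝓝 (0 : ℂ), clOf Ω (fun s => ray ω ξ s + bump δ s * v) = clOf Ω (ray ω (ξ + v)) := by
  have hH := (pwDeriv_lineMap ω ξ).homotopyData_const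
  have c1 := isCutoff_bump (n := 1) (σ := fun i => (i : ℝ)) hδ
  have key := hH.eventually_clOf_eq c1 isCutoff_id (fun _ _ => h) (fun _ _ => rfl) ?_
  · filter_upwards [key] with v hv
    refine hv.2.2.trans (clOf_congr hv.2.1 fun s hs => ?_)
    change ray ω ξ s + _ = _
    rw [ray_eq, ray_eq]; ring
  · have hpos : 0 < ‖ξ - ω‖ := norm_pos_iff.2 (sub_ne_zero.2 hne)
    filter_upwards [Metric.ball_mem_nhds (0 : ℂ) hpos] with v hv t ht
    rw [mem_ball_zero_iff] at hv
    refine Or.inr ⟨0, by simp, fun s hs => ?_, fun s hs he => ?_⟩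
    · obtain rfl := le_antisymm hs.2 hs.1
      simp [perturb, c1.zero]
    · have hb := bump_mem hδ ⟨hs.1.le, hs.2⟩
      change ray ω ξ s + (((1 - t) * bump δ s + t * s : ℝ) : ℂ) * v = ω at he
      rw [ray_eq, add_assoc, add_eq_left] at he
      have h1 : ‖(s : ℂ) * (ξ - ω)‖ = ‖(((1 - t) * bump δ s + t * s : ℝ) : ℂ) * v‖ := by
        rw [eq_neg_of_add_eq_zero_left he, norm_neg]
      have h2 : 0 ≤ (1 - t) * bump δ s + t * s :=
        add_nonneg (mul_nonneg (by linarith [ht.2]) hb.1) (mul_nonneg ht.1 hs.1.le)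
      have h3 : (1 - t) * bump δ s + t * s ≤ s := by
        nlinarith [mul_le_mul_of_nonneg_left hb.2 (by linarith [ht.2] : 0 ≤ 1 - t)]
      rw [norm_mul, norm_mul, Complex.norm_real, Complex.norm_real, Real.norm_of_nonneg h2,
        Real.norm_of_nonneg hs.1.le] at h1
      have h4 := mul_le_mul_of_nonneg_right h3 (norm_nonneg v)
      have h5 := mul_lt_mul_of_pos_left hv hs.1
      linarith

/-! Continuity of the local sections. -/

/-- It is enough to test the generating sets containing `cl α`. Membership provides another
representative, a ray or a product with a segment. The perturbed `α` is equivalent to the perturbed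
representative, hence to the ray or product with its end moved, which remains in the generating set.
-/
theorem tendsto_clOf_bump {α : AllowedPath Ω} {δ : ℝ} (hδ : δ ∈ Ioc (0 : ℝ) 1)
    (hne : ∀ s ∈ Icc (1 - δ) 1, α.1 s ≠ ω) :
    Tendsto (fun v => clOf Ω fun s => α.1 s + bump δ s * v) (𝓝 0) (𝓝 (cl α)) := by
  have hα1 : α.1 1 ≠ ω := hne 1 ⟨by linarith [hδ.1], le_rfl⟩
  -- comparison with another representative
  have comp : ∀ β : AllowedPath Ω, cl α = cl β → ∃ d > 0, ∀ δ' ∈ Ioc 0 d, ∀ᶠ v in 𝓝 (0 : ℂ),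
      clOf Ω (fun s => α.1 s + bump δ s * v) = clOf Ω (fun s => β.1 s + bump δ' s * v) := by
    intro β hβ
    obtain ⟨d, hd, h⟩ := exists_eventually_clOf_bump hβ hα1
    refine ⟨min d δ, lt_min hd.1 hδ.1, fun δ' hδ' => ?_⟩
    filter_upwards [h δ' ⟨hδ'.1, hδ'.2.trans (min_le_left _ _)⟩,
      eventually_clOf_bump α.2 hδ hne ⟨hδ.1, le_rfl⟩ ⟨hδ'.1, hδ'.2.trans (min_le_right _ _)⟩]
      with v h1 h2
    exact h2.trans h1
  refine (TopologicalSpace.tendsto_nhds_generateFrom_iff).2 ?_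
  rintro W (⟨L, U, hL, hU, hωU, hst, hsub, rfl⟩ | ⟨γ₁, L, L₂, U, hA, hL₂, hlt, hU, hmU, hst, hsub, rfl⟩)
    ⟨γ, hγ, ξ, hξ, he⟩
  · have hN : IsCentralNhd Ω L U := ⟨hL, hU, hωU, hst, hsub⟩
    have hall := (hN.allowedAt_ray hξ).allowed
    have hγ' : cl α = cl ⟨ray ω ξ, hall⟩ := by
      rw [hγ, ← clOf_coe γ, clOf_congr γ.2 he, ← clOf_eq hall]; rfl
    have hξω : ξ ≠ ω := by
      have : α.1 1 = ray ω ξ 1 := congrArg proj hγ'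
      rwa [← ray_one (ω := ω) ξ, ← this]
    obtain ⟨d, hd, h⟩ := comp _ hγ'
    have hmin : min d 1 ∈ Ioc (0 : ℝ) 1 := ⟨lt_min hd one_pos, min_le_right _ _⟩
    have hUv : ∀ᶠ v in 𝓝 (0 : ℂ), ξ + v ∈ U :=
      (continuous_const.add continuous_id).continuousAt.eventually_mem
        (hU.mem_nhds (by simpa using hξ))
    filter_upwards [h _ ⟨hmin.1, min_le_left _ _⟩, eventually_clOf_ray hall hξω hmin, hUv]
      with v h1 h2 h3
    have hall' := (hN.allowedAt_ray h3).allowed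
    exact ⟨⟨_, hall'⟩, (h1.trans h2).trans (clOf_eq hall'), ξ + v, h3, fun _ _ => rfl⟩
  · have hN : IsStarNhd Ω γ₁.1 L L₂ U := ⟨hA, hL₂, hlt, hU, hmU, hst, hsub⟩
    have hall := (hN.allowedAt_segConcat hξ).allowed
    have hγ' : cl α = cl ⟨segConcat γ₁.1 ξ, hall⟩ := by
      rw [hγ, ← clOf_coe γ, clOf_congr γ.2 he, ← clOf_eq hall]; rfl
    obtain ⟨d, hd, h⟩ := comp _ hγ'
    have hmin : min d (1 / 2) ∈ Ioc (0 : ℝ) (1 / 2) := ⟨lt_min hd (by norm_num), min_le_right _ _⟩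
    have hUv : ∀ᶠ v in 𝓝 (0 : ℂ), ξ + v ∈ U :=
      (continuous_const.add continuous_id).continuousAt.eventually_mem
        (hU.mem_nhds (by simpa using hξ))
    filter_upwards [h _ ⟨hmin.1, min_le_left _ _⟩, hN.eventually_clOf_eq hξ hmin, hUv]
      with v h1 h2 h3
    have hall' := (hN.allowedAt_segConcat h3).allowed
    exact ⟨⟨_, hall'⟩, (h1.trans h2).trans (clOf_eq hall'), ξ + v, h3, fun _ _ => rfl⟩

theorem tendsto_sub_nhds_zero (ξ : ℂ) : Tendsto (fun x => x - ξ) (𝓝 ξ) (𝓝 0) :=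
  (continuous_id.sub continuous_const).tendsto' _ _ (sub_self ξ)

theorem IsStarNhd.tendsto_clOf (h : IsStarNhd Ω p L L₂ U) {ξ : ℂ} (hξ : ξ ∈ U) :
    Tendsto (fun x => clOf Ω (segConcat p x)) (𝓝 ξ) (𝓝 (clOf Ω (segConcat p ξ))) := by
  have hall := (h.allowedAt_segConcat hξ).allowed
  rw [clOf_eq hall]
  refine ((tendsto_clOf_bump (α := ⟨_, hall⟩) (δ := 1 / 2) (by norm_num) fun s hs =>
    h.ne hξ ⟨by linarith [hs.1], hs.2⟩).comp (tendsto_sub_nhds_zero ξ)).congr' ?_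
  filter_upwards [(tendsto_sub_nhds_zero ξ).eventually
    (h.eventually_clOf_eq hξ (δ := 1 / 2) (by norm_num))] with x hx
  rw [add_sub_cancel] at hx
  exact hx

theorem IsCentralNhd.tendsto_clOf (h : IsCentralNhd Ω L U) {ξ : ℂ} (hξ : ξ ∈ U) :
    Tendsto (fun x => clOf Ω (ray ω x)) (𝓝 ξ) (𝓝 (clOf Ω (ray ω ξ))) := by
  have hall := (h.allowedAt_ray hξ).allowed
  rw [clOf_eq hall]
  by_cases hne : ξ = ω
  · subst hne
    refine (TopologicalSpace.tendsto_nhds_generateFrom_iff).2 ?_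
    rintro W (⟨L', U', hL, hU, hωU, hst, hsub, rfl⟩ |
      ⟨γ₁, L', L₂, U', hA, hL₂, hlt, hU, hmU, hst, hsub, rfl⟩) ⟨γ, hγ, x, hx, he⟩
    · have hN : IsCentralNhd Ω L' U' := ⟨hL, hU, hωU, hst, hsub⟩
      filter_upwards [hU.mem_nhds hωU] with y hy
      have hall' := (hN.allowedAt_ray hy).allowed
      exact ⟨⟨_, hall'⟩, clOf_eq hall', y, hy, fun _ _ => rfl⟩
    -- The base point lies in no generating set of the second kind, because the endpoints there
    -- avoid `Ω_L`, which contains the centre.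
    · exfalso
      have h1 : ray ξ ξ 1 = γ.1 1 := congrArg proj hγ
      have h2 : γ.1 1 = segConcat γ₁.1 x 1 := he (by simp)
      rw [ray_one, h2, segConcat_one] at h1
      exact (hsub hx).2 (h1 ▸ Ω.center_mem (pathLength_nonneg.trans_lt hA.2.2.1))
  · obtain ⟨δ, hδ, hδ'⟩ := hall.exists_ne (by rwa [ray_one])
    refine ((tendsto_clOf_bump (α := ⟨_, hall⟩) hδ hδ').comp (tendsto_sub_nhds_zero ξ)).congr' ?_
    filter_upwards [(tendsto_sub_nhds_zero ξ).eventually (eventually_clOf_ray hall hne hδ)]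
      with x hx
    rw [add_sub_cancel] at hx
    exact hx

/-- A holomorphic function on the surface is holomorphic along a local section. -/
theorem HolomorphicOnSurface.analyticAt {Φ : Surface Ω → ℂ} (hΦ : HolomorphicOnSurface Φ)
    {s : ℂ → Surface Ω} {ξ : ℂ} (hs : Tendsto s (𝓝 ξ) (𝓝 (s ξ)))
    (hp : ∀ᶠ x in 𝓝 ξ, proj (s x) = x) : AnalyticAt ℂ (fun x => Φ (s x)) ξ := by
  obtain ⟨f, hf, h⟩ := hΦ (s ξ)
  rw [hp.self_of_nhds] at hf
  refine hf.congr ?_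
  filter_upwards [hs.eventually h, hp] with x h1 h2
  rw [h1, h2]

/-- Both sections enter the neighbourhood where `Φ = f ∘ proj`; no local injectivity of `proj` is
involved. -/
theorem HolomorphicOnSurface.eventuallyEq {Φ : Surface Ω → ℂ} (hΦ : HolomorphicOnSurface Φ)
    {s s' : ℂ → Surface Ω} {ξ : ℂ} (he : s ξ = s' ξ) (hs : Tendsto s (𝓝 ξ) (𝓝 (s ξ)))
    (hs' : Tendsto s' (𝓝 ξ) (𝓝 (s' ξ))) (hp : ∀ᶠ x in 𝓝 ξ, proj (s x) = x)
    (hp' : ∀ᶠ x in 𝓝 ξ, proj (s' x) = x) : (fun x => Φ (s x)) =ᶠ[𝓝 ξ] fun x => Φ (s' x) := by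
  obtain ⟨f, -, h⟩ := hΦ (s ξ)
  filter_upwards [hs.eventually h, hs'.eventually (he ▸ h), hp, hp'] with x h1 h2 h3 h4
  rw [h1, h2, h3, h4]

end localSections

section reparametrization

/-! ### Reparametrization -/

variable {ω : ℂ} {Ω : DiscreteFilteredSet ω} {γ : ℝ → ℂ} {L : ℝ}

theorem Departs.comp (h : Departs ω γ) {τ : ℝ → ℝ} (hτ : ContinuousOn τ (Icc 0 1))
    (hm : MonotoneOn τ (Icc 0 1)) (h0 : τ 0 = 0) (h1 : MapsTo τ (Icc 0 1) (Icc 0 1)) :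
    Departs ω (γ ∘ τ) := by
  rcases h with h | ⟨t₀, ht₀, h2, h3⟩
  · exact Or.inl fun t ht => h _ (h1 ht)
  have hcl : IsClosed (Icc 0 1 ∩ τ ⁻¹' Iic t₀) := hτ.preimage_isClosed_of_isClosed isClosed_Icc
    isClosed_Iic
  have hK : IsCompact (Icc 0 1 ∩ τ ⁻¹' Iic t₀) :=
    isCompact_Icc.of_isClosed_subset hcl inter_subset_left
  -- The new departure time is the last `s` with `τ s ≤ t₀`, which exists by compactness. If it is
  -- `1`, the composite is constant.
  obtain ⟨s₀, ⟨hs₀, hs₀'⟩, hgr⟩ := hK.exists_isGreatest ⟨0, by simp, by simpa [h0] using ht₀.1⟩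
  have hle : ∀ t ∈ Icc 0 s₀, (γ ∘ τ) t = ω := fun t ht => by
    have ht' : t ∈ Icc (0 : ℝ) 1 := ⟨ht.1, ht.2.trans hs₀.2⟩
    exact h2 _ ⟨(h1 ht').1, (hm ht' hs₀ ht.2).trans hs₀'⟩
  rcases hs₀.2.eq_or_lt with rfl | hlt
  · exact Or.inl hle
  · refine Or.inr ⟨s₀, ⟨hs₀.1, hlt⟩, hle, fun t ht => ?_⟩
    have ht' : t ∈ Icc (0 : ℝ) 1 := ⟨hs₀.1.trans ht.1.le, ht.2⟩
    exact h3 _ ⟨lt_of_not_ge fun h4 => ht.1.not_ge (hgr ⟨ht', h4⟩), (h1 ht').2⟩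

theorem PiecewiseC1.pathLength_comp_le (h : PiecewiseC1 γ) {τ : ℝ → ℝ}
    (hm : MonotoneOn τ (Icc 0 1)) (h1 : MapsTo τ (Icc 0 1) (Icc 0 1)) :
    pathLength (γ ∘ τ) ≤ pathLength γ := by
  have i0 : (0 : ℝ) ∈ Icc (0 : ℝ) 1 := by simp
  have i1 : (1 : ℝ) ∈ Icc (0 : ℝ) 1 := by simp
  have := pathLength_le_of_dominated (γ := γ ∘ τ) (m := runLength γ ∘ τ) fun a ha b hb hab =>
    h.norm_sub_le (h1 ha).1 (hm ha hb hab) (h1 hb).2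
  have h2 := h.runLength_mono (h1 i1) i1 (h1 i1).2
  have h3 := h.runLength_mono i0 (h1 i0) (h1 i0).1
  rw [runLength_zero] at h3
  rw [runLength_one] at h2
  simp only [Function.comp] at this
  linarith!

theorem AllowedAt.comp (h : AllowedAt Ω L γ) {τ : ℝ → ℝ} (hτ : ContinuousOn τ (Icc 0 1))
    (hm : MonotoneOn τ (Icc 0 1)) (h0 : τ 0 = 0) (h1 : MapsTo τ (Icc 0 1) (Icc 0 1))
    (hp : PiecewiseC1 (γ ∘ τ)) : AllowedAt Ω L (γ ∘ τ) := by
  rw [allowedAt_iff] at h ⊢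
  exact ⟨by simp [h0, h.1], hp, (h.2.1.pathLength_comp_le hm h1).trans_lt h.2.2.1,
    h.2.2.2.1.comp hτ hm h0 h1, fun t ht => h.2.2.2.2 _ (h1 ht)⟩

/-! ### Reparametrizations with zero speed at the corners -/

/-- A bump supported in `[0, 1]`, of integral `1`. -/
def smoothStepDeriv (x : ℝ) : ℝ := 6 * (clamp 0 1 x * (1 - clamp 0 1 x))

/-- A nondecreasing `C¹` function going from `0` to `1` on `[0, 1]`, and constant elsewhere. -/
def smoothStep (x : ℝ) : ℝ := ∫ y in (0 : ℝ)..x, smoothStepDeriv y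

theorem smoothStepDeriv_of_le {x : ℝ} (h : x ≤ 0) : smoothStepDeriv x = 0 := by
  rw [smoothStepDeriv, clamp, min_eq_left (by linarith), max_eq_left h]; norm_num

theorem smoothStepDeriv_of_ge {x : ℝ} (h : 1 ≤ x) : smoothStepDeriv x = 0 := by
  rw [smoothStepDeriv, clamp, min_eq_right h, max_eq_right zero_le_one]; norm_num

theorem continuous_smoothStepDeriv : Continuous smoothStepDeriv := by
  have := continuous_clamp 0 1
  unfold smoothStepDeriv; fun_prop

theorem hasDerivAt_smoothStep (x : ℝ) : HasDerivAt smoothStep (smoothStepDeriv x) x :=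
  intervalIntegral.integral_hasDerivAt_right (continuous_smoothStepDeriv.intervalIntegrable _ _)
    (continuous_smoothStepDeriv.stronglyMeasurableAtFilter _ _) continuous_smoothStepDeriv.continuousAt

theorem smoothStep_of_le {x : ℝ} (h : x ≤ 0) : smoothStep x = 0 := by
  rw [smoothStep, intervalIntegral.integral_congr (g := fun _ => 0)]
  · simp
  · intro y hy
    rw [uIcc_of_ge h] at hy
    exact smoothStepDeriv_of_le hy.2

theorem smoothStep_of_ge {x : ℝ} (h : 1 ≤ x) : smoothStep x = 1 := by
  have i := continuous_smoothStepDeriv.intervalIntegrable (μ := MeasureTheory.volume)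
  rw [smoothStep, ← intervalIntegral.integral_add_adjacent_intervals (i 0 1) (i 1 x),
    intervalIntegral.integral_congr (a := 1) (g := fun _ => 0),
    intervalIntegral.integral_congr (a := 0) (g := fun y => 6 * (y - y ^ 2))]
  · rw [intervalIntegral.integral_const_mul, intervalIntegral.integral_sub (by simp) (by simp)]
    norm_num
  · intro y hy
    rw [uIcc_of_le zero_le_one] at hy
    simp only [smoothStepDeriv, clamp_eq hy]
    ring
  · intro y hy
    rw [uIcc_of_le h] at hy
    exact smoothStepDeriv_of_ge hy.1

theorem monotone_smoothStep : Monotone smoothStep := by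
  refine monotone_of_deriv_nonneg (fun x => (hasDerivAt_smoothStep x).differentiableAt) fun x => ?_
  rw [(hasDerivAt_smoothStep x).deriv]
  have := clamp_mem zero_le_one x
  exact mul_nonneg (by norm_num) (mul_nonneg this.1 (by linarith [this.2]))

theorem smoothStep_mem (x : ℝ) : smoothStep x ∈ Icc (0 : ℝ) 1 := by
  refine ⟨?_, ?_⟩
  · rw [← smoothStep_of_le (min_le_left 0 x)]; exact monotone_smoothStep (min_le_right _ _)
  · rw [← smoothStep_of_ge (le_max_left 1 x)]; exact monotone_smoothStep (le_max_right _ _)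

/-- The smooth step from `a` to `b` over the interval `[a, b]`. -/
def stepOn (a b x : ℝ) : ℝ := a + (b - a) * smoothStep ((x - a) / (b - a))

section stepOn

variable {a b x : ℝ}

theorem stepOn_of_le (hab : a < b) (h : x ≤ a) : stepOn a b x = a := by
  rw [stepOn, smoothStep_of_le (div_nonpos_of_nonpos_of_nonneg (by linarith) (by linarith)),
    mul_zero, add_zero]

theorem stepOn_of_ge (hab : a < b) (h : b ≤ x) : stepOn a b x = b := by
  rw [stepOn, smoothStep_of_ge ((one_le_div (by linarith)).2 (by linarith))]; ring

theorem stepOn_mem (hab : a < b) (x : ℝ) : stepOn a b x ∈ Icc a b := by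
  have h := smoothStep_mem ((x - a) / (b - a))
  have h' : 0 ≤ b - a := by linarith
  constructor
  · rw [stepOn]; nlinarith [mul_nonneg h' h.1]
  · rw [stepOn]; nlinarith [mul_le_mul_of_nonneg_left h.2 h']

theorem monotone_stepOn (hab : a < b) : Monotone (stepOn a b) := fun x y hxy => by
  have h' : 0 ≤ b - a := by linarith
  have := monotone_smoothStep (div_le_div_of_nonneg_right (sub_le_sub_right hxy a) h')
  unfold stepOn
  nlinarith [mul_le_mul_of_nonneg_left this h']

theorem hasDerivAt_stepOn (hab : a < b) (x : ℝ) :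
    HasDerivAt (stepOn a b) (smoothStepDeriv ((x - a) / (b - a))) x := by
  have h1 : HasDerivAt (fun y => (y - a) / (b - a)) (1 / (b - a)) x :=
    ((hasDerivAt_id x).sub_const a).div_const _
  have h2 := (((hasDerivAt_smoothStep _).comp x h1).const_mul (b - a)).const_add a
  refine h2.congr_deriv ?_
  have : b - a ≠ 0 := by linarith
  field_simp

end stepOn

variable {n : ℕ} {σ : ℕ → ℝ} {D : ℕ → ℝ → ℂ}

/-- The sum of the smooth steps over the intervals of a subdivision. -/
def smoothing (n : ℕ) (σ : ℕ → ℝ) (x : ℝ) : ℝ :=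
  ∑ i ∈ Finset.range n, (stepOn (σ i) (σ (i + 1)) x - σ i)

/-- The derivative of `smoothing n σ`. -/
def smoothingDeriv (n : ℕ) (σ : ℕ → ℝ) (x : ℝ) : ℝ :=
  ∑ i ∈ Finset.range n, smoothStepDeriv ((x - σ i) / (σ (i + 1) - σ i))

theorem IsSubdivision.hasDerivAt_smoothing (hσ : IsSubdivision n σ) (x : ℝ) :
    HasDerivAt (smoothing n σ) (smoothingDeriv n σ x) x :=
  HasDerivAt.fun_sum fun i hi =>
    (hasDerivAt_stepOn (hσ.2.2 i (Finset.mem_range.1 hi)) x).sub_const (σ i)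

theorem continuous_smoothingDeriv : Continuous (smoothingDeriv n σ) := by
  have := continuous_smoothStepDeriv
  unfold smoothingDeriv; fun_prop

theorem IsSubdivision.continuous_smoothing (hσ : IsSubdivision n σ) : Continuous (smoothing n σ) :=
  continuous_iff_continuousAt.2 fun x => (hσ.hasDerivAt_smoothing x).continuousAt

theorem IsSubdivision.monotone_smoothing (hσ : IsSubdivision n σ) : Monotone (smoothing n σ) :=
  fun _ _ hxy => Finset.sum_le_sum fun i hi =>
    sub_le_sub_right (monotone_stepOn (hσ.2.2 i (Finset.mem_range.1 hi)) hxy) _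

/-- On the `j`-th interval the earlier steps are complete and telescope, while the later ones have
not begun. Taking for `f` the inclusion of `ℝ` computes `smoothing`; taking `γ` computes `γ ∘
smoothing`. -/
theorem IsSubdivision.sum_sub_stepOn (hσ : IsSubdivision n σ) (f : ℝ → ℂ) {j : ℕ} (hj : j < n)
    {x : ℝ} (hx : x ∈ Icc (σ j) (σ (j + 1))) :
    ∑ i ∈ Finset.range n, (f (stepOn (σ i) (σ (i + 1)) x) - f (σ i)) =
      f (stepOn (σ j) (σ (j + 1)) x) - f 0 := by
  have h1 : ∀ i ∈ Finset.range n, f (stepOn (σ i) (σ (i + 1)) x) - f (σ i) =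
      (if i < j then f (σ (i + 1)) - f (σ i) else 0) +
        if i = j then f (stepOn (σ j) (σ (j + 1)) x) - f (σ j) else 0 := by
    intro i hi
    have hi := Finset.mem_range.1 hi
    rcases lt_trichotomy i j with h | rfl | h
    · rw [stepOn_of_ge (hσ.2.2 i hi) ((hσ.mono h hj.le).trans hx.1)]
      simp [h, h.ne]
    · simp
    · rw [stepOn_of_le (hσ.2.2 i hi) (hx.2.trans (hσ.mono h hi.le))]
      simp [h.ne', h.not_gt]
  rw [Finset.sum_congr rfl h1, Finset.sum_add_distrib, Finset.sum_ite_eq',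
    if_pos (Finset.mem_range.2 hj), ← Finset.sum_filter]
  have h2 : (Finset.range n).filter (fun i => i < j) = Finset.range j := by
    ext i; simp only [Finset.mem_filter, Finset.mem_range]; omega
  rw [h2, Finset.sum_range_sub (fun i => f (σ i)), hσ.1]
  ring

theorem IsSubdivision.smoothing_eq (hσ : IsSubdivision n σ) {j : ℕ} (hj : j < n)
    {x : ℝ} (hx : x ∈ Icc (σ j) (σ (j + 1))) : smoothing n σ x = stepOn (σ j) (σ (j + 1)) x := by
  have := hσ.sum_sub_stepOn (fun y => (y : ℂ)) hj hx
  simp only [Complex.ofReal_zero, sub_zero] at this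
  exact_mod_cast this

theorem IsSubdivision.smoothing_mem (hσ : IsSubdivision n σ) {j : ℕ} (hj : j < n)
    {x : ℝ} (hx : x ∈ Icc (σ j) (σ (j + 1))) : smoothing n σ x ∈ Icc (σ j) (σ (j + 1)) := by
  rw [hσ.smoothing_eq hj hx]; exact stepOn_mem (hσ.2.2 j hj) x

theorem IsSubdivision.smoothing_of_le (hσ : IsSubdivision n σ) {x : ℝ} (hx : x ≤ 0) :
    smoothing n σ x = 0 :=
  Finset.sum_eq_zero fun i hi => by
    have hi := Finset.mem_range.1 hi
    rw [stepOn_of_le (hσ.2.2 i hi) (hx.trans (hσ.mem_Icc hi.le).1), sub_self]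

theorem IsSubdivision.smoothing_of_ge (hσ : IsSubdivision n σ) {x : ℝ} (hx : 1 ≤ x) :
    smoothing n σ x = 1 := by
  have : ∀ i ∈ Finset.range n, stepOn (σ i) (σ (i + 1)) x - σ i = σ (i + 1) - σ i := by
    intro i hi
    have hi := Finset.mem_range.1 hi
    rw [stepOn_of_ge (hσ.2.2 i hi) ((hσ.mem_Icc (Nat.succ_le_of_lt hi)).2.trans hx)]
  rw [smoothing, Finset.sum_congr rfl this, Finset.sum_range_sub, hσ.1, hσ.2.1, sub_zero]

theorem IsSubdivision.smoothing_mem_unit (hσ : IsSubdivision n σ) (x : ℝ) :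
    smoothing n σ x ∈ Icc (0 : ℝ) 1 := by
  refine ⟨?_, ?_⟩
  · rw [← hσ.smoothing_of_le (min_le_left 0 x)]; exact hσ.monotone_smoothing (min_le_right _ _)
  · rw [← hσ.smoothing_of_ge (le_max_left 1 x)]; exact hσ.monotone_smoothing (le_max_right _ _)

/-- The derivative of `γ ∘ smoothing n σ`. -/
def smoothedDeriv (n : ℕ) (σ : ℕ → ℝ) (D : ℕ → ℝ → ℂ) (x : ℝ) : ℂ :=
  ∑ i ∈ Finset.range n, smoothStepDeriv ((x - σ i) / (σ (i + 1) - σ i)) •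
    D i (stepOn (σ i) (σ (i + 1)) x)

/-- The composite is a sum of terms `γ ∘ stepOn`, each with values of `stepOn` in one interval of
the subdivision, so the one-sided derivatives of `γ` suffice and the corners need no separate
treatment. -/
theorem PwDeriv.hasDerivAt_comp_smoothing (h : PwDeriv n σ D γ) (x : ℝ) :
    HasDerivAt (γ ∘ smoothing n σ) (smoothedDeriv n σ D x) x := by
  have hσ := h.isSubdivision
  have e : γ ∘ smoothing n σ = fun x =>
      (∑ i ∈ Finset.range n, (γ (stepOn (σ i) (σ (i + 1)) x) - γ (σ i))) + γ 0 := by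
    funext x
    rw [Function.comp]
    rcases lt_or_ge x 0 with h0 | h0
    · rw [hσ.smoothing_of_le h0.le, Finset.sum_eq_zero, zero_add]
      intro i hi
      have hi := Finset.mem_range.1 hi
      rw [stepOn_of_le (hσ.2.2 i hi) (h0.le.trans (hσ.mem_Icc hi.le).1), sub_self]
    rcases lt_or_ge 1 x with h1 | h1
    · have : ∀ i ∈ Finset.range n, γ (stepOn (σ i) (σ (i + 1)) x) - γ (σ i) =
          γ (σ (i + 1)) - γ (σ i) := by
        intro i hi
        have hi := Finset.mem_range.1 hi
        rw [stepOn_of_ge (hσ.2.2 i hi) ((hσ.mem_Icc (Nat.succ_le_of_lt hi)).2.trans h1.le)]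
      rw [hσ.smoothing_of_ge h1.le, Finset.sum_congr rfl this,
        Finset.sum_range_sub (fun i => γ (σ i)), hσ.1, hσ.2.1, sub_add_cancel]
    · obtain ⟨j, hj, hxj⟩ := hσ.exists_mem ⟨h0, h1⟩
      rw [hσ.smoothing_eq hj hxj, hσ.sum_sub_stepOn γ hj hxj, sub_add_cancel]
  rw [e]
  refine HasDerivAt.add_const _ (HasDerivAt.fun_sum fun i hi => ?_)
  have hi := Finset.mem_range.1 hi
  have hlt := hσ.2.2 i hi
  exact ((h.hasDeriv i hi _ (stepOn_mem hlt x)).scomp_hasDerivAt x (hasDerivAt_stepOn hlt x)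
    (stepOn_mem hlt)).sub_const _

theorem PwDeriv.continuous_smoothedDeriv (h : PwDeriv n σ D γ) :
    Continuous (smoothedDeriv n σ D) := by
  refine continuous_finsetSum _ fun i hi => ?_
  have hi := Finset.mem_range.1 hi
  have hlt := h.isSubdivision.2.2 i hi
  have c1 := continuous_smoothStepDeriv
  have c2 : Continuous (stepOn (σ i) (σ (i + 1))) :=
    continuous_iff_continuousAt.2 fun x => (hasDerivAt_stepOn hlt x).continuousAt
  have c3 : Continuous fun x => D i (stepOn (σ i) (σ (i + 1)) x) :=
    (h.continuousOn i hi).comp_continuous c2 (stepOn_mem hlt)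
  have c4 : Continuous fun x => smoothStepDeriv ((x - σ i) / (σ (i + 1) - σ i)) := by fun_prop
  exact c4.smul c3

/-- The interpolation between `s` and `smoothing n σ s` preserves each interval of the subdivision,
so the corners stay at fixed parameters, as the definition of a homotopy demands. -/
theorem PwDeriv.clOf_comp_smoothing (h : PwDeriv n σ D γ) (ha : Allowed Ω γ) :
    clOf Ω γ = clOf Ω (γ ∘ smoothing n σ) := by
  have hσ := h.isSubdivision
  have cρ := hσ.continuous_smoothing
  set τ : ℝ → ℝ → ℝ := fun s t => (1 - t) * s + t * smoothing n σ s with hτ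
  have hτi : ∀ a b : ℝ, ∀ s t : ℝ, t ∈ Icc (0 : ℝ) 1 → s ∈ Icc a b → smoothing n σ s ∈ Icc a b →
      τ s t ∈ Icc a b := fun a b s t ht hs hs' =>
    convex_Icc a b hs hs' (by linarith [ht.2]) ht.1 (by ring)
  have hτu : ∀ t ∈ Icc (0 : ℝ) 1, MapsTo (fun s => τ s t) (Icc 0 1) (Icc 0 1) :=
    fun t ht s hs => hτi 0 1 s t ht hs (hσ.smoothing_mem_unit s)
  have hd : HomotopyData (fun s t => γ (τ s t)) n σ fun i q =>
      ((1 - q.2) + q.2 * smoothingDeriv n σ q.1) • D i (τ q.1 q.2) := by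
    refine ⟨?_, hσ, fun i hi => ?_, fun i hi s hs t ht => ?_⟩
    · exact h.piecewiseC1.1.comp (Continuous.continuousOn (by fun_prop))
        fun q hq => hτu q.2 hq.2 hq.1
    · have c1 := continuous_smoothingDeriv (n := n) (σ := σ)
      have c2 : Continuous fun q : ℝ × ℝ => (1 - q.2) + q.2 * smoothingDeriv n σ q.1 := by fun_prop
      have c3 : Continuous fun q : ℝ × ℝ => τ q.1 q.2 := by fun_prop
      exact c2.continuousOn.smul ((h.continuousOn i hi).comp c3.continuousOn fun q hq =>
        hτi _ _ _ _ hq.2 hq.1 (hσ.smoothing_mem hi hq.1))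
    · have h1 : HasDerivAt (fun s => τ s t) ((1 - t) + t * smoothingDeriv n σ s) s := by
        have := ((hasDerivAt_id s).const_mul (1 - t)).fun_add
          ((hσ.hasDerivAt_smoothing s).const_mul t)
        rw [mul_one] at this
        exact this
      exact (h.hasDeriv i hi _ (hτi _ _ _ _ ht hs (hσ.smoothing_mem hi hs))).scomp s
        h1.hasDerivWithinAt fun u hu => hτi _ _ _ _ ht hu (hσ.smoothing_mem hi hu)
  obtain ⟨L, hL, hA⟩ := ha
  have key := (hd.isHomotopy fun t ht => ⟨L, hL, hA.comp (τ := fun s => τ s t)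
    (Continuous.continuousOn (by fun_prop)) (fun a _ b _ hab => ?_) ?_ (hτu t ht)
    (hd.pwDeriv ht).piecewiseC1⟩).clOf_eq fun t ht => ?_
  · simp only [hτ, sub_zero, one_mul, zero_mul, add_zero, sub_self, zero_add] at key
    exact key
  · have := hσ.monotone_smoothing hab
    exact add_le_add (mul_le_mul_of_nonneg_left hab (by linarith [ht.2]))
      (mul_le_mul_of_nonneg_left this ht.1)
  · simp [hτ, hσ.smoothing_of_le le_rfl]
  · simp [hτ, hσ.smoothing_of_ge le_rfl]

/-- Speeding up by the factor `1 + t` moves the corners with `t`, which a fixed subdivision would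
forbid; after smoothing the path is `C¹` and there are no corners left. -/
theorem PwDeriv.clOf_comp_smoothing_two_mul (h : PwDeriv n σ D γ) (ha : Allowed Ω γ) :
    clOf Ω (γ ∘ smoothing n σ) = clOf Ω (fun s => γ (smoothing n σ (2 * s))) := by
  have hσ := h.isSubdivision
  have cρ := hσ.continuous_smoothing
  have cd := h.continuous_smoothedDeriv
  have hd : HomotopyData (fun s t => γ (smoothing n σ ((1 + t) * s))) 1 (fun i => (i : ℝ))
      fun _ q => (1 + q.2) • smoothedDeriv n σ D ((1 + q.2) * q.1) := by
    refine ⟨?_, IsSubdivision.unit, fun i hi => Continuous.continuousOn (by fun_prop),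
      fun i hi s hs t ht => ?_⟩
    · exact h.piecewiseC1.1.comp (Continuous.continuousOn (by fun_prop))
        fun q hq => hσ.smoothing_mem_unit _
    · have h1 : HasDerivAt (fun s => (1 + t) * s) (1 + t) s := by
        simpa using (hasDerivAt_id s).const_mul (1 + t)
      exact ((h.hasDerivAt_comp_smoothing _).scomp s h1).hasDerivWithinAt
  obtain ⟨L, hL, hA⟩ := ha
  have key := (hd.isHomotopy fun t ht => ⟨L, hL, hA.comp
    (τ := fun s => smoothing n σ ((1 + t) * s))
    (Continuous.continuousOn (by fun_prop)) (fun a _ b _ hab => hσ.monotone_smoothing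
      (mul_le_mul_of_nonneg_left hab (by linarith [ht.1]))) ?_ (fun _ _ => hσ.smoothing_mem_unit _)
    (hd.pwDeriv ht).piecewiseC1⟩).clOf_eq fun t ht => ?_
  · have e : (fun s => γ (smoothing n σ ((1 + 0) * s))) = γ ∘ smoothing n σ := by
      funext s; simp
    rw [e] at key
    rw [key]
    norm_num
  · simp [hσ.smoothing_of_le le_rfl]
  · simp only [mul_one]
    rw [hσ.smoothing_of_ge (by linarith [ht.1]), hσ.smoothing_of_ge (by linarith)]

theorem IsSubdivision.smoothing_half (hσ : IsSubdivision n σ) {s : ℝ} (hs : s ≤ 1 / 2) :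
    smoothing (n + 1) (halfSubdivision n σ) s = smoothing n σ (2 * s) / 2 := by
  rw [smoothing, Finset.sum_range_succ, (halfSubdivision_last hσ).1, (halfSubdivision_last hσ).2,
    stepOn_of_le (by norm_num) hs, sub_self, add_zero, smoothing, Finset.sum_div]
  refine Finset.sum_congr rfl fun i hi => ?_
  have hi := Finset.mem_range.1 hi
  rw [(halfSubdivision_lt hi).1, (halfSubdivision_lt hi).2, stepOn, stepOn]
  have : (s - σ i / 2) / (σ (i + 1) / 2 - σ i / 2) = (2 * s - σ i) / (σ (i + 1) - σ i) := by
    have := hσ.2.2 i hi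
    have h1 : σ (i + 1) - σ i ≠ 0 := by linarith
    have h2 : σ (i + 1) / 2 - σ i / 2 ≠ 0 := by intro h; apply h1; linarith
    rw [div_eq_div_iff h2 h1]; ring
  rw [this]; ring

/-- A path is homotopic to its product with a constant path. -/
theorem Allowed.clOf_segConcat_self (ha : Allowed Ω γ) :
    Allowed Ω (segConcat γ (γ 1)) ∧ clOf Ω (segConcat γ (γ 1)) = clOf Ω γ := by
  obtain ⟨n, σ, D, h⟩ := ha.piecewiseC1.exists_pwDeriv
  have hσ := h.isSubdivision
  have h' := h.concat_lineMap (γ 1)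
  have hm : EqOn (γ ∘ fun s => min (2 * s) 1) (segConcat γ (γ 1)) (Icc 0 1) := by
    intro s hs
    rcases le_total s (1 / 2) with h1 | h1
    · rw [segConcat_left h1, Function.comp, min_eq_left (by linarith)]
    · rw [segConcat_right h1, Function.comp, min_eq_right (by linarith)]; simp
  have ha' : Allowed Ω (segConcat γ (γ 1)) := by
    obtain ⟨L, hL, hA⟩ := ha
    refine ⟨L, hL, (hA.comp (τ := fun s => min (2 * s) 1) (Continuous.continuousOn (by fun_prop))
      (fun a _ b _ hab => min_le_min_right _ (by linarith)) (by simp) (fun s hs =>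
        ⟨le_min (by linarith [hs.1]) zero_le_one, min_le_right _ _⟩)
      (h'.piecewiseC1.congr hm.symm)).congr hm⟩
  refine ⟨ha', ?_⟩
  -- Both classes are brought to the same path `s ↦ γ (smoothing n σ (2 * s))`: smoothing the
  -- product along the halved subdivision is smoothing `γ` at double speed and then resting.
  rw [PwDeriv.clOf_comp_smoothing (γ := segConcat γ (γ 1)) h' ha', h.clOf_comp_smoothing ha,
    h.clOf_comp_smoothing_two_mul ha]
  congr 1
  funext s
  have hσ' := hσ.half
  change segConcat γ (γ 1) _ = _
  rcases le_total s (1 / 2) with h1 | h1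
  · rw [hσ.smoothing_half h1, segConcat_left]
    · congr 1; ring
    · linarith [(hσ.smoothing_mem_unit (2 * s)).2]
  · have h2 : 1 / 2 ≤ smoothing (n + 1) (halfSubdivision n σ) s := by
      have := hσ'.monotone_smoothing h1
      rw [hσ.smoothing_half le_rfl, hσ.smoothing_of_ge (by norm_num)] at this
      exact this
    rw [segConcat_right h2, hσ.smoothing_of_ge (by linarith)]
    simp

end reparametrization

section singularSet

/-! ### The singular set of a discrete filtered set -/

variable {ω : ℂ} {Ω Ω' : DiscreteFilteredSet ω}

/-- The set of the `(ℓ, a)` such that `ω + a` belongs to `Ω_L` for all `L > ℓ`. -/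
def DiscreteFilteredSet.singularSet (Ω : DiscreteFilteredSet ω) : Set (ℝ × ℂ) :=
  {z | 0 ≤ z.1 ∧ ∀ L, z.1 < L → ω + z.2 ∈ Ω.level L}

namespace DiscreteFilteredSet

/-- Closedness is the reason for asking membership for all `L > ℓ` rather than at `ℓ`: a violating
`L` still exceeds the height of nearby points, and `Ω_L` is finite. -/
theorem isClosed_singularSet (Ω : DiscreteFilteredSet ω) : IsClosed Ω.singularSet := by
  refine isOpen_compl_iff.1 (isOpen_iff_mem_nhds.2 fun z hz => ?_)
  by_cases h0 : z.1 < 0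
  · filter_upwards [continuous_fst.continuousAt.eventually (gt_mem_nhds h0)] with w hw h
    exact hw.not_ge h.1
  · have hz' : ∃ L, z.1 < L ∧ ω + z.2 ∉ Ω.level L := by
      by_contra! h
      exact hz ⟨not_lt.1 h0, h⟩
    obtain ⟨L, hL, hzL⟩ := hz'
    have hcl := (Ω.finite_level L ((not_lt.1 h0).trans_lt hL)).isClosed.isOpen_compl
    have hc : Continuous fun w : ℝ × ℂ => ω + w.2 := by fun_prop
    filter_upwards [continuous_fst.continuousAt.eventually (gt_mem_nhds hL),
      hc.continuousAt.eventually_mem (hcl.mem_nhds hzL)] with w hw hw' h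
    exact hw' (h.2 L hw)

theorem mem_singularSet_of_mem {L : ℝ} (hL : 0 < L) {a : ℂ} (h : ω + a ∈ Ω.level L) :
    (L, a) ∈ Ω.singularSet :=
  ⟨hL.le, fun _ h' => Ω.level_mono _ _ hL h'.le h⟩

theorem mk_zero_mem_singularSet {a : ℝ} (ha : 0 ≤ a) : (a, (0 : ℂ)) ∈ Ω.singularSet :=
  ⟨ha, fun _ h => by simpa using Ω.center_mem (ha.trans_lt h)⟩

theorem zero_mem_singularSet : (0 : ℝ × ℂ) ∈ Ω.singularSet := mk_zero_mem_singularSet le_rfl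

theorem singularSet_small {r : ℝ} (h : ∀ L, 0 < L → L < r → Ω.level L = {ω}) :
    ∀ a ∈ Ω.singularSet, a.1 < r → a.2 = 0 := fun a ha har => by
  have h1 := ha.1
  have h2 := ha.2 ((a.1 + r) / 2) (by linarith)
  rw [h _ (by linarith) (by linarith)] at h2
  simpa using h2

theorem singularSet_mono (h : ∀ L, Ω.level L ⊆ Ω'.level L) : Ω.singularSet ⊆ Ω'.singularSet :=
  fun _ hz => ⟨hz.1, fun L hL => h L (hz.2 L hL)⟩

theorem add_mem_singularSet : ∀ a ∈ Ω.singularSet, ∀ b ∈ Ω'.singularSet,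
    a + b ∈ (Ω.fineSum Ω').singularSet := fun a ha b hb => by
  refine ⟨add_nonneg ha.1 hb.1, fun L hL => ?_⟩
  change a.1 + b.1 < L at hL
  have h1 := ha.1
  have h2 := hb.1
  -- The excess `L - a.1 - b.1 > 0` is shared equally, which puts both levels strictly above the two
  -- heights.
  refine ⟨a.1 + (L - a.1 - b.1) / 2, b.1 + (L - a.1 - b.1) / 2, by linarith, by linarith, by ring,
    ω + a.2, ha.2 _ (by linarith), ω + b.2, hb.2 _ (by linarith), ?_⟩
  change ω + (a.2 + b.2) = _
  ring

end DiscreteFilteredSet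

theorem HasContinuation.mono {K K' : Set (ℝ × ℂ)} {r r' : ℝ} {φ : ℂ → ℂ}
    (h : HasContinuation K r φ) (hK : K ⊆ K') (hr : r' ≤ r) : HasContinuation K' r' φ :=
  fun q hq hav h0 h1 => h q hq (fun t ht => hav t (hK ht)) h0 (h1.trans_le hr)

/-- Segments issued from `a` avoid generically a finite set which does not contain `a`. -/
theorem exists_lineMap_notMem {F : Set ℂ} (hF : F.Finite) {a : ℂ} (ha : a ∉ F) (z : ℂ) {ε : ℝ}
    (hε : 0 < ε) : ∃ y ∈ Metric.ball z ε, ∀ u ∈ Icc (0 : ℝ) 1, (AffineMap.lineMap a y u : ℂ) ∉ F := by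
  -- If `[a, y]` meets `b ∈ F`, then `y` lies on the line through `a` and `b`; finitely many lines
  -- cannot fill a disc.
  set B : ℂ → AffineSubspace ℝ ℂ := fun b => AffineSubspace.mk' a (Submodule.span ℝ {b - a})
  have hB : ∀ b, MeasureTheory.volume (B b : Set ℂ) = 0 := fun b => by
    refine MeasureTheory.Measure.addHaar_affineSubspace _ _ fun h => ?_
    have h1 : (B b).direction = ⊤ := by rw [h, AffineSubspace.direction_top]
    rw [AffineSubspace.direction_mk'] at h1
    have h2 := finrank_span_le_card (R := ℝ) ({b - a} : Set ℂ)
    rw [h1, finrank_top, Complex.finrank_real_complex] at h2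
    simp at h2
  have hU : MeasureTheory.volume (⋃ b ∈ F, (B b : Set ℂ)) = 0 :=
    (MeasureTheory.measure_biUnion_null_iff hF.countable).2 fun b _ => hB b
  have hne : ¬ Metric.ball z ε ⊆ ⋃ b ∈ F, (B b : Set ℂ) := fun h =>
    (Metric.measure_ball_pos MeasureTheory.volume z hε).ne'
      (MeasureTheory.measure_mono_null h hU)
  obtain ⟨y, hy, hyB⟩ := not_subset.1 hne
  refine ⟨y, hy, fun u hu hm => hyB (mem_biUnion hm ?_)⟩
  have hu0 : u ≠ 0 := by
    rintro rfl
    exact ha (by simpa using hm)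
  rw [SetLike.mem_coe, AffineSubspace.mem_mk', Submodule.mem_span_singleton]
  refine ⟨u⁻¹, ?_⟩
  rw [AffineMap.lineMap_apply, vsub_eq_sub, vadd_eq_add, add_sub_cancel_right, smul_smul,
    inv_mul_cancel₀ hu0, one_smul]

end singularSet

section germs

/-! ### Continuation along causal paths of a function on the surface -/

variable {ω : ℂ} {Ω : DiscreteFilteredSet ω} {p : ℝ → ℂ} {L L₂ L' L₂' r : ℝ} {U U' : Set ℂ}
  {Φ : Surface Ω → ℂ}

theorem IsStarNhd.eventually_proj (h : IsStarNhd Ω p L L₂ U) {ξ : ℂ} (hξ : ξ ∈ U) :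
    ∀ᶠ x in 𝓝 ξ, proj (clOf Ω (segConcat p x)) = x := by
  filter_upwards [h.isOpen.mem_nhds hξ] with x hx
  rw [proj_clOf (h.allowedAt_segConcat hx).allowed, segConcat_one]

theorem IsCentralNhd.eventually_proj (h : IsCentralNhd Ω L U) {ξ : ℂ} (hξ : ξ ∈ U) :
    ∀ᶠ x in 𝓝 ξ, proj (clOf Ω (ray ω x)) = x := by
  filter_upwards [h.isOpen.mem_nhds hξ] with x hx
  rw [proj_clOf (h.allowedAt_ray hx).allowed, ray_one]

theorem IsStarNhd.analyticOnNhd (h : IsStarNhd Ω p L L₂ U) (hΦ : HolomorphicOnSurface Φ) :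
    AnalyticOnNhd ℂ (fun x => Φ (clOf Ω (segConcat p x))) U := fun _ hξ =>
  hΦ.analyticAt (h.tendsto_clOf hξ) (h.eventually_proj hξ)

theorem IsCentralNhd.analyticOnNhd (h : IsCentralNhd Ω L U) (hΦ : HolomorphicOnSurface Φ) :
    AnalyticOnNhd ℂ (fun x => Φ (clOf Ω (ray ω x))) U := fun _ hξ =>
  hΦ.analyticAt (h.tendsto_clOf hξ) (h.eventually_proj hξ)

/-- The two sections agree at `x = y`, where the second path is the first one followed by a constant
segment. -/
theorem IsStarNhd.eventuallyEq_segConcat (hΦ : HolomorphicOnSurface Φ) {y : ℂ}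
    (h : IsStarNhd Ω p L L₂ U) (hy : y ∈ U) (h' : IsStarNhd Ω (segConcat p y) L' L₂' U') :
    (fun x => Φ (clOf Ω (segConcat p x))) =ᶠ[𝓝 y]
      fun x => Φ (clOf Ω (segConcat (segConcat p y) x)) := by
  have hy' : y ∈ U' := by simpa [segConcat_one] using h'.mem
  have he := (h.allowedAt_segConcat hy).allowed.clOf_segConcat_self.2
  rw [segConcat_one] at he
  exact hΦ.eventuallyEq he.symm (h.tendsto_clOf hy) (h'.tendsto_clOf hy') (h.eventually_proj hy)
    (h'.eventually_proj hy')

theorem IsCentralNhd.eventuallyEq_segConcat (hΦ : HolomorphicOnSurface Φ) {y : ℂ}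
    (h : IsCentralNhd Ω L U) (hy : y ∈ U) (h' : IsStarNhd Ω (ray ω y) L' L₂' U') :
    (fun x => Φ (clOf Ω (ray ω x))) =ᶠ[𝓝 y] fun x => Φ (clOf Ω (segConcat (ray ω y) x)) := by
  have hy' : y ∈ U' := by simpa [ray_one] using h'.mem
  have he := (h.allowedAt_ray hy).allowed.clOf_segConcat_self.2
  rw [ray_one] at he
  exact hΦ.eventuallyEq he.symm (h.tendsto_clOf hy) (h'.tendsto_clOf hy') (h.eventually_proj hy)
    (h'.eventually_proj hy')

theorem isCentralNhd_ball (hr : 0 < r) (h : Ω.level r = {ω}) :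
    IsCentralNhd Ω r (Metric.ball ω r) :=
  ⟨hr, Metric.isOpen_ball, Metric.mem_ball_self hr,
    (convex_ball ω r).starConvex (Metric.mem_ball_self hr), fun x hx => ⟨hx, by simp [h]⟩⟩

theorem clOf_eq_basePoint {γ : ℝ → ℂ} (h : ∀ t ∈ Icc (0 : ℝ) 1, γ t = ω) :
    clOf Ω γ = basePoint Ω :=
  (clOf_congr (constPath Ω).2 fun t ht => (h t ht).symm).symm.trans (clOf_coe _)

theorem clOf_ray_self : clOf Ω (ray ω ω) = basePoint Ω :=
  clOf_eq_basePoint fun t _ => by simp [ray_eq]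

theorem IsCentralNhd.eqOn_ball (hΦ : HolomorphicOnSurface Φ)
    (h : IsCentralNhd Ω r (Metric.ball ω r)) {φ : ℂ → ℂ}
    (hφ : AnalyticOnNhd ℂ φ (Metric.ball ω r))
    (hb : ∀ᶠ z in 𝓝 (basePoint Ω), Φ z = φ (proj z)) :
    EqOn (fun x => Φ (clOf Ω (ray ω x))) φ (Metric.ball ω r) := by
  refine (h.analyticOnNhd hΦ).eqOn_of_preconnected_of_eventuallyEq hφ
    (convex_ball ω r).isPreconnected h.mem ?_
  have ht := h.tendsto_clOf h.mem
  rw [clOf_ray_self] at ht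
  filter_upwards [ht.eventually hb, h.eventually_proj h.mem] with x h1 h2
  rw [h1, h2]

end germs

theorem IsContinuationOn.shift {c : ℝ → ℂ} {f : ℝ → ℂ → ℂ} {I : Set ℝ}
    (h : IsContinuationOn c f I) (a : ℂ) :
    IsContinuationOn (fun t => c t - a) (fun t x => f t (a + x)) I := by
  have hsh : ∀ x, AnalyticAt ℂ (fun x => a + x) x := fun x => by fun_prop
  refine fun t ht => ⟨?_, (h t ht).2.mono fun t' h' => ?_⟩
  · have := (h t ht).1
    rw [← add_sub_cancel a (c t)] at this
    exact this.fun_comp (hsh _)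
  · rw [← add_sub_cancel a (c t')] at h'
    exact (hsh _).continuousAt.eventually h'

/-! ### Shadowing causal paths by allowed polygonal paths -/

section causal

variable {ω : ℂ} {Ω : DiscreteFilteredSet ω} {Φ : Surface Ω → ℂ} {q : ℝ → ℝ × ℂ} {ρ ε T T' : ℝ}

/-- `p` is an allowed path which nearly realises the path `q` stopped at time `T`. -/
structure Shadows (Ω : DiscreteFilteredSet ω) (q : ℝ → ℝ × ℂ) (ρ T ε : ℝ) (p : ℝ → ℂ) : Prop where
  allowedAt : AllowedAt Ω ((q 1).1 + 3 * ρ) p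
  length_lt : pathLength p < (q T).1 + ε
  dist_lt : ‖p 1 - (ω + (q T).2)‖ < ε

theorem IsCausal.fst_mono (hq : IsCausal q) : Monotone fun t => (q t).1 := fun t t' h => by
  have := (norm_nonneg _).trans (hq.inCone t t' h)
  exact sub_nonneg.1 this

/-- The path avoids the singular points of the final level, but the section is built at the level
reached at time `T`, where a whole disc of radius `2 * ρ` is free. Since the length and end errors
are at most `ρ / 2`, the radius `5 / 2 * ρ` covers this disc and still fits below the level `(q T).1
+ 3 * ρ`. -/
theorem Shadows.isStarNhd {p : ℝ → ℂ} (h : Shadows Ω q ρ T ε p) (hq : IsCausal q) (hT : T ≤ 1)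
    (hε : ε ≤ ρ / 2) (hρ : 0 < ρ)
    (hav : ∀ x, ‖x - (q T).2‖ ≤ 3 * ρ → ω + x ∉ Ω.level ((q T).1 + 3 * ρ)) :
    IsStarNhd Ω p ((q T).1 + 3 * ρ) (5 / 2 * ρ) (Metric.ball (ω + (q T).2) (2 * ρ)) := by
  have h1 := h.length_lt
  have h2 := h.dist_lt
  have h3 : (q T).1 ≤ (q 1).1 := hq.fst_mono hT
  have hm : p 1 ∈ Metric.ball (ω + (q T).2) (2 * ρ) := by
    rw [Metric.mem_ball, dist_eq_norm]; linarith
  refine ⟨h.allowedAt.mono (by linarith) (by linarith), by linarith, by linarith,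
    Metric.isOpen_ball, hm, (convex_ball _ _).starConvex hm, fun x hx => ⟨?_, ?_⟩⟩
  · rw [Metric.mem_ball] at hx ⊢
    rw [← dist_eq_norm, dist_comm] at h2
    linarith [dist_triangle x (ω + (q T).2) (p 1)]
  · rw [Metric.mem_ball, dist_eq_norm] at hx
    have := hav (x - ω) (by
      have e : x - ω - (q T).2 = x - (ω + (q T).2) := by ring
      rw [e]; linarith)
    rwa [add_sub_cancel] at this

/-- The germ of `φ` can be continued along `q` up to time `T`, the result being given by `Φ`. -/
def Reaches (Φ : Surface Ω → ℂ) (φ : ℂ → ℂ) (q : ℝ → ℝ × ℂ) (ρ T : ℝ) : Prop :=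
  ∀ ε > 0, ∃ p, Shadows Ω q ρ T ε p ∧
    ContinuesAlong (fun t => ω + (q t).2) φ (fun x => Φ (clOf Ω (segConcat p x))) T

/-- The shadow is prolonged by a segment ending near `ω + (q T').2`, in general position so as to
miss every singular point of the final level. The old and new sections agree near its end, hence on
the intersection of their discs, which contains `ω + (q T').2`. -/
theorem Reaches.step (hΦ : HolomorphicOnSurface Φ) {φ : ℂ → ℂ} (hq : IsCausal q) (hρ : 0 < ρ)
    (hav : ∀ t x, ‖x - (q t).2‖ ≤ 3 * ρ → ω + x ∉ Ω.level ((q t).1 + 3 * ρ))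
    (h : Reaches Φ φ q ρ T) (hT0 : 0 ≤ T) (hTT : T ≤ T') (hT' : T' ≤ 1)
    (hcl : ∀ t ∈ Icc T T', ‖(q t).2 - (q T).2‖ < ρ) : Reaches Φ φ q ρ T' := by
  intro ε hε
  -- The prolonged path has length error at most `3 * η` and end error at most `η`. The bound `ρ /
  -- 8` makes it also a shadow with precision `ρ / 2`, which its own disc requires.
  set η := min (ε / 4) (ρ / 8) with hη
  have hη0 : 0 < η := lt_min (by linarith) (by linarith)
  have hη1 : η ≤ ε / 4 := min_le_left _ _
  have hη2 : η ≤ ρ / 8 := min_le_right _ _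
  obtain ⟨p, hp, hc⟩ := h η hη0
  have hN := hp.isStarNhd hq (hTT.trans hT') (by linarith) hρ (hav T)
  have hq1 : (q T').1 ≤ (q 1).1 := hq.fst_mono hT'
  have hqT : (q T).1 ≤ (q T').1 := hq.fst_mono hTT
  have hB : 0 < (q 1).1 + 3 * ρ := pathLength_nonneg.trans_lt hp.allowedAt.2.2.1
  have hp1 : p 1 ∉ Ω.level ((q 1).1 + 3 * ρ) := fun hm =>
    (allowedAt_iff.1 hp.allowedAt).2.2.2.2 1 (by simp)
      ⟨hm, fun he => (hN.subset hN.mem).2 (by rw [he]; exact hN.center_mem)⟩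
  obtain ⟨y, hy, hyav⟩ := exists_lineMap_notMem (Ω.finite_level _ hB) hp1 (ω + (q T').2) hη0
  rw [Metric.mem_ball, dist_eq_norm] at hy
  have h1 := hp.length_lt
  have h2 := hp.dist_lt
  have h3 : ‖(q T').2 - (q T).2‖ ≤ (q T').1 - (q T).1 := hq.inCone T T' hTT
  have h4 : ‖y - p 1‖ ≤ (q T').1 - (q T).1 + 2 * η := by
    have e : y - p 1 = (y - (ω + (q T').2)) + ((q T').2 - (q T).2) - (p 1 - (ω + (q T).2)) := by
      ring
    rw [e]
    refine (norm_sub_le _ _).trans ?_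
    linarith [norm_add_le (y - (ω + (q T').2)) ((q T').2 - (q T).2)]
  have hlen : pathLength (segConcat p y) ≤ pathLength p + ‖y - p 1‖ :=
    hp.allowedAt.2.1.pathLength_concat_le y
  have hsh : ∀ ε', 4 * η ≤ ε' → Shadows Ω q ρ T' ε' (segConcat p y) := fun ε' hε' =>
    ⟨hp.allowedAt.segConcat (by linarith) hyav, by linarith, by rw [segConcat_one]; linarith⟩
  refine ⟨segConcat p y, hsh ε (by linarith), ?_⟩
  have hN' := (hsh (ρ / 2) (by linarith)).isStarNhd hq hT' le_rfl hρ (hav T')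
  have hqc := hq.continuous
  have hmem : ∀ t ∈ Icc T T', ω + (q t).2 ∈ Metric.ball (ω + (q T).2) (2 * ρ) := fun t ht => by
    rw [Metric.mem_ball, dist_eq_norm, add_sub_add_left_eq_sub]
    linarith [hcl t ht]
  have hyU : y ∈ Metric.ball (ω + (q T).2) (2 * ρ) := by
    have := hcl T' ⟨hTT, le_rfl⟩
    rw [Metric.mem_ball]
    rw [← dist_eq_norm] at hy
    have e : dist (ω + (q T').2) (ω + (q T).2) < ρ := by
      rwa [dist_eq_norm, add_sub_add_left_eq_sub]
    linarith [dist_triangle y (ω + (q T').2) (ω + (q T).2)]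
  refine hc.extend (by fun_prop) hT0 hTT (fun t ht => hN.analyticOnNhd hΦ _ (hmem t ht)) ?_
  exact eventuallyEq_of_convex (Metric.isOpen_ball.inter Metric.isOpen_ball)
    ((convex_ball (ω + (q T).2) (2 * ρ)).inter (convex_ball (ω + (q T').2) (2 * ρ)))
    ((hN.analyticOnNhd hΦ).mono inter_subset_left) ((hN'.analyticOnNhd hΦ).mono inter_subset_right)
    ⟨hyU, by rw [Metric.mem_ball, dist_eq_norm]; linarith⟩
    ⟨hmem _ ⟨hTT, le_rfl⟩, Metric.mem_ball_self (by linarith)⟩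
    (hN.eventuallyEq_segConcat hΦ hyU hN')

theorem reaches_zero (hΦ : HolomorphicOnSurface Φ) {φ : ℂ → ℂ} {r : ℝ} (hq : IsCausal q)
    (hρ : 0 < ρ) (hav : ∀ t x, ‖x - (q t).2‖ ≤ 3 * ρ → ω + x ∉ Ω.level ((q t).1 + 3 * ρ))
    (hr : IsCentralNhd Ω r (Metric.ball ω r)) (hφ : AnalyticOnNhd ℂ φ (Metric.ball ω r))
    (hb : ∀ᶠ z in 𝓝 (basePoint Ω), Φ z = φ (proj z)) (h0 : InCone (q 0)) (h0r : (q 0).1 < r) :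
    Reaches Φ φ q ρ 0 := by
  intro ε hε
  change ‖(q 0).2‖ ≤ (q 0).1 at h0
  set η := min (ε / 4) (min (ρ / 8) (r - (q 0).1)) with hη
  have hη0 : 0 < η := lt_min (by linarith) (lt_min (by linarith) (by linarith))
  have hη1 : η ≤ ε / 4 := min_le_left _ _
  have hη2 : η ≤ ρ / 8 := (min_le_right _ _).trans (min_le_left _ _)
  have hη3 : η ≤ r - (q 0).1 := (min_le_right _ _).trans (min_le_right _ _)
  have hq1 : (q 0).1 ≤ (q 1).1 := hq.fst_mono zero_le_one
  have hB : 0 < (q 1).1 + 3 * ρ := by linarith [norm_nonneg (q 0).2]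
  -- The first shadow is a straight ray issued from `ω`, so `ω` is removed from the set to avoid;
  -- `φ` itself is the function read along such rays in the initial disc.
  obtain ⟨y, hy, hyav⟩ := exists_lineMap_notMem (F := Ω.level ((q 1).1 + 3 * ρ) \ {ω})
    ((Ω.finite_level _ hB).subset sdiff_subset) (a := ω) (by simp) (ω + (q 0).2) hη0
  rw [Metric.mem_ball, dist_eq_norm] at hy
  have h4 : ‖y - ω‖ < (q 0).1 + η := by
    have e : y - ω = (y - (ω + (q 0).2)) + (q 0).2 := by ring
    rw [e]
    linarith [norm_add_le (y - (ω + (q 0).2)) (q 0).2]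
  have hlen : pathLength (ray ω y) ≤ ‖y - ω‖ := pathLength_lineMap_le ω y
  have hsh : ∀ ε', η ≤ ε' → Shadows Ω q ρ 0 ε' (ray ω y) := fun ε' hε' =>
    ⟨allowedAt_iff.2 ⟨by simp [ray], (pwDeriv_lineMap ω y).piecewiseC1, by linarith,
      departs_ray y, hyav⟩, by linarith, by rw [ray_one]; linarith⟩
  refine ⟨ray ω y, hsh ε (by linarith), ?_⟩
  have hN := (hsh (ρ / 2) (by linarith)).isStarNhd hq zero_le_one le_rfl hρ (hav 0)
  have hyr : y ∈ Metric.ball ω r := by rw [Metric.mem_ball, dist_eq_norm]; linarith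
  have hcr : ω + (q 0).2 ∈ Metric.ball ω r := by
    rw [Metric.mem_ball, dist_eq_norm, add_sub_cancel_left]; linarith
  refine ContinuesAlong.zero (fun t ht => by rw [hq.left t ht]) (hφ _ hcr) ?_
  exact eventuallyEq_of_convex (Metric.isOpen_ball.inter Metric.isOpen_ball)
    ((convex_ball ω r).inter (convex_ball (ω + (q 0).2) (2 * ρ)))
    (hφ.mono inter_subset_left) ((hN.analyticOnNhd hΦ).mono inter_subset_right)
    ⟨hyr, by rw [Metric.mem_ball, dist_eq_norm]; linarith⟩
    ⟨hcr, Metric.mem_ball_self (by linarith)⟩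
    (((hr.eqOn_ball hΦ hφ hb).symm.eventuallyEq_of_mem (Metric.isOpen_ball.mem_nhds hyr)).trans
      (hr.eventuallyEq_segConcat hΦ hyr hN))

theorem reaches_one (hΦ : HolomorphicOnSurface Φ) {φ : ℂ → ℂ} (hq : IsCausal q)
    (hρ : 0 < ρ) (hav : ∀ t x, ‖x - (q t).2‖ ≤ 3 * ρ → ω + x ∉ Ω.level ((q t).1 + 3 * ρ))
    (h : Reaches Φ φ q ρ 0) : Reaches Φ φ q ρ 1 := by
  have hqc := hq.continuous
  have huc := (isCompact_Icc (a := (0 : ℝ)) (b := 1)).uniformContinuousOn_of_continuous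
    (f := fun t => (q t).2) (Continuous.continuousOn (by fun_prop))
  obtain ⟨δ, hδ, hδ'⟩ := Metric.uniformContinuousOn_iff.1 huc ρ hρ
  obtain ⟨N, hN⟩ := exists_nat_one_div_lt hδ
  have hN0 : (0 : ℝ) < (N : ℝ) + 1 := by positivity
  have key : ∀ k : ℕ, k ≤ N + 1 → Reaches Φ φ q ρ (k / ((N : ℝ) + 1)) := by
    intro k
    induction k with
    | zero => intro _; simpa using h
    | succ k ih =>
      intro hk
      have hk' : ((k + 1 : ℕ) : ℝ) ≤ N + 1 := by exact_mod_cast hk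
      have e : ((k + 1 : ℕ) : ℝ) / ((N : ℝ) + 1) = k / ((N : ℝ) + 1) + 1 / ((N : ℝ) + 1) := by
        push_cast; ring
      have h0 : (0 : ℝ) ≤ k / ((N : ℝ) + 1) := by positivity
      have h1 : ((k + 1 : ℕ) : ℝ) / ((N : ℝ) + 1) ≤ 1 := (div_le_one hN0).2 hk'
      have h2 : (0 : ℝ) < 1 / ((N : ℝ) + 1) := by positivity
      refine (ih (by omega)).step hΦ hq hρ hav h0 (by linarith) h1 fun t ht => ?_
      rw [← dist_eq_norm]
      refine hδ' t ⟨by linarith [ht.1], by linarith [ht.2]⟩ _ ⟨h0, by linarith⟩ ?_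
      rw [Real.dist_eq, abs_of_nonneg (by linarith [ht.1])]
      linarith [ht.2]
  have := key (N + 1) le_rfl
  push_cast at this
  rwa [div_self hN0.ne'] at this

/-- A germ which can be continued to the Riemann surface can be continued along the causal paths
which avoid the singular set. -/
theorem ContinuesTo.hasContinuation {φ : ℂ → ℂ} (h : ContinuesTo Ω φ) :
    ∃ r > 0, AnalyticOnNhd ℂ (fun x => φ (ω + x)) (Metric.ball 0 r) ∧
      HasContinuation Ω.singularSet r fun x => φ (ω + x) := by
  obtain ⟨hφ, Φ, hΦ, hb⟩ := h
  obtain ⟨r₀, hr₀, hφr⟩ := exists_ball_of_analyticAt hφ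
  obtain ⟨δ, hδ, hlev⟩ := Ω.level_small
  set r := min r₀ (δ / 2) with hr
  have hr0 : 0 < r := lt_min hr₀ (by linarith)
  have hφ' : AnalyticOnNhd ℂ φ (Metric.ball ω r) :=
    hφr.mono (Metric.ball_subset_ball (min_le_left _ _))
  have hN := isCentralNhd_ball hr0 (hlev r hr0 ((min_le_right _ _).trans_lt (by linarith)))
  have hsh : ∀ x, AnalyticAt ℂ (fun x => ω + x) x := fun x => by fun_prop
  refine ⟨r, hr0, fun x hx => ?_, fun q hq hav h0 h0r => ?_⟩
  · refine (hφ' (ω + x) ?_).fun_comp (hsh x)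
    rwa [Metric.mem_ball, dist_eq_norm, add_sub_cancel_left, ← mem_ball_zero_iff]
  obtain ⟨m, hm, hm'⟩ := hq.exists_le_infDist Ω.isClosed_singularSet ⟨0, Ω.zero_mem_singularSet⟩ hav
  -- A point of `Ω` within `3 * (m / 4)` of `ω + (q t).2`, at level `(q t).1 + 3 * (m / 4)`, would
  -- give a singular pair at sup distance less than `m` from `q t`.
  have hm'' : ∀ t x, ‖x - (q t).2‖ ≤ 3 * (m / 4) → ω + x ∉ Ω.level ((q t).1 + 3 * (m / 4)) := by
    intro t x hx hmem
    have hpos : 0 ≤ (q t).1 := by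
      have h1 : 0 ≤ (q 0).1 := (norm_nonneg _).trans h0
      rcases le_total t 0 with ht | ht
      · rw [hq.left t ht]; exact h1
      · exact h1.trans (hq.fst_mono ht)
    have h1 := Metric.infDist_le_dist_of_mem (x := q t)
      (Ω.mem_singularSet_of_mem (by linarith) hmem)
    have h2 : dist (q t) ((q t).1 + 3 * (m / 4), x) ≤ 3 * (m / 4) := by
      rw [Prod.dist_eq, max_le_iff]
      refine ⟨?_, by rwa [dist_comm, dist_eq_norm]⟩
      rw [Real.dist_eq, sub_add_cancel_left, abs_neg, abs_of_nonneg (by linarith)]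
    linarith [hm' t]
  obtain ⟨p, -, f, hf, hf0, -⟩ := reaches_one hΦ hq (by linarith) hm''
    (reaches_zero hΦ hq (by linarith) hm'' hN hφ' hb h0 h0r) 1 one_pos
  have hc : ∀ t, q (min t 1) = q t := fun t => by
    rcases le_total t 1 with ht | ht
    · rw [min_eq_left ht]
    · rw [min_eq_right ht, hq.right t ht]
  simp only [hc] at hf
  have hf' := hf.shift ω
  simp only [add_sub_cancel_left] at hf'
  exact ⟨_, hf', (hsh _).continuousAt.eventually hf0⟩

end causal

section endGerm

/-! ### Continuation along allowed paths -/

variable {ω : ℂ} {Ω : DiscreteFilteredSet ω} {γ γ' : ℝ → ℂ} {φ g g' : ℂ → ℂ}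

theorem IsContinuationOn.comp {τ : ℝ → ℝ} {c : ℝ → ℂ} {f : ℝ → ℂ → ℂ} {I J : Set ℝ}
    (h : IsContinuationOn c f I) (hτ : ContinuousOn τ J) (hm : MapsTo τ J I) :
    IsContinuationOn (c ∘ τ) (f ∘ τ) J := fun t ht =>
  ⟨(h _ (hm ht)).1, (tendsto_nhdsWithin_of_tendsto_nhds_of_eventually_within _ (hτ t ht)
    (eventually_mem_nhdsWithin.mono fun _ hs => hm hs)).eventually (h _ (hm ht)).2⟩

theorem IsContinuationOn.congr {c c' : ℝ → ℂ} {f : ℝ → ℂ → ℂ} {I : Set ℝ}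
    (h : IsContinuationOn c f I) (he : EqOn c c' I) : IsContinuationOn c' f I := fun t ht => by
  refine ⟨he ht ▸ (h t ht).1, ?_⟩
  filter_upwards [(h t ht).2, eventually_mem_nhdsWithin] with s hs hsI
  exact he hsI ▸ hs

theorem IsContinuationOn.glue {c : ℝ → ℂ} (hc : Continuous c) {f g : ℝ → ℂ → ℂ} {T : ℝ}
    (hf : IsContinuationOn c f (Iic T)) (hg : IsContinuationOn c g (Ici T))
    (h : f T =ᶠ[𝓝 (c T)] g T) :
    IsContinuationOn c (fun t => if t ≤ T then f t else g t) univ := by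
  intro t _
  rw [nhdsWithin_univ]
  rcases lt_trichotomy t T with h1 | rfl | h1
  · have h2 := hf t h1.le
    rw [nhdsWithin_eq_nhds.2 (Iic_mem_nhds h1)] at h2
    simp only [h1.le, if_true]
    refine ⟨h2.1, ?_⟩
    filter_upwards [h2.2, Iio_mem_nhds h1] with s h3 h4
    simpa [le_of_lt (mem_Iio.1 h4)] using h3
  · have h2 := hf t self_mem_Iic
    have h3 := hg t self_mem_Ici
    simp only [le_refl, if_true]
    refine ⟨h2.1, ?_⟩
    have h4 := eventually_nhdsWithin_iff.1 h2.2
    have h5 := eventually_nhdsWithin_iff.1 h3.2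
    filter_upwards [h4, h5, eventually_eventuallyEq_comp h (hc.tendsto t)] with s e1 e2 e3
    by_cases hs : s ≤ t
    · simpa [hs] using e1 hs
    · simpa [hs] using (e2 (le_of_not_ge hs)).trans e3.symm
  · have h2 := hg t h1.le
    rw [nhdsWithin_eq_nhds.2 (Ici_mem_nhds h1)] at h2
    simp only [not_le.2 h1, if_false]
    refine ⟨h2.1, ?_⟩
    filter_upwards [h2.2, Ioi_mem_nhds h1] with s h3 h4
    simpa [not_le.2 (mem_Ioi.1 h4)] using h3

/-- The germ `g` at the end of `γ` is the analytic continuation along `γ` of the germ `φ`. -/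
def EndGerm (φ : ℂ → ℂ) (γ : ℝ → ℂ) (g : ℂ → ℂ) : Prop :=
  ∃ f, IsContinuationOn (fun s => γ (clamp 0 1 s)) f univ ∧ f 0 =ᶠ[𝓝 (γ 0)] φ ∧
    f 1 =ᶠ[𝓝 (γ 1)] g

theorem clamp_zero_one_zero : clamp 0 1 0 = 0 := clamp_eq (by simp)

theorem clamp_zero_one_one : clamp 0 1 1 = 1 := clamp_eq (by simp)

theorem continuous_comp_clamp (h : ContinuousOn γ (Icc 0 1)) :
    Continuous fun s => γ (clamp 0 1 s) :=
  h.comp_continuous (continuous_clamp 0 1) fun s => clamp_mem zero_le_one s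

theorem EndGerm.congr (h : EndGerm φ γ g) (he : EqOn γ γ' (Icc 0 1)) : EndGerm φ γ' g := by
  obtain ⟨f, hf, h0, h1⟩ := h
  refine ⟨f, hf.congr fun s _ => he (clamp_mem zero_le_one s), ?_, ?_⟩
  · rw [← he (by simp)]; exact h0
  · rw [← he (by simp)]; exact h1

theorem EndGerm.analyticAt (h : EndGerm φ γ g) : AnalyticAt ℂ g (γ 1) := by
  obtain ⟨f, hf, h0, h1⟩ := h
  have := (hf 1 trivial).1
  simp only [clamp_zero_one_one] at this
  exact this.congr h1

theorem EndGerm.of_analyticOnNhd {U : Set ℂ} (hφ : AnalyticOnNhd ℂ φ U)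
    (hγ : MapsTo γ (Icc 0 1) U) : EndGerm φ γ φ :=
  ⟨fun _ => φ, IsContinuationOn.const fun s _ => hφ _ (hγ (clamp_mem zero_le_one s)),
    EventuallyEq.rfl, EventuallyEq.rfl⟩

theorem EndGerm.segConcat (h : EndGerm φ γ g) (hγ : PiecewiseC1 γ) {U : Set ℂ} {ξ : ℂ}
    (hU : StarConvex ℝ (γ 1) U) (hg : AnalyticOnNhd ℂ g U) (hξ : ξ ∈ U) :
    EndGerm φ (segConcat γ ξ) g := by
  obtain ⟨f, hf, h0, h1⟩ := h
  have hc : Continuous fun s => Resurgence.segConcat γ ξ (clamp 0 1 s) :=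
    continuous_comp_clamp (hγ.concat_lineMap ξ).1
  have e1 : EqOn ((fun s => γ (clamp 0 1 s)) ∘ fun s => 2 * s)
      (fun s => Resurgence.segConcat γ ξ (clamp 0 1 s)) (Iic (1 / 2)) := by
    intro s hs
    have hs : s ≤ 1 / 2 := hs
    have h2 : clamp 0 1 s ≤ 1 / 2 := max_le (by norm_num) ((min_le_left _ _).trans hs)
    simp only [Function.comp]
    rw [segConcat_left h2]
    congr 1
    rcases le_total s 0 with h3 | h3
    · rw [clamp, clamp, min_eq_left (by linarith), min_eq_left (by linarith), max_eq_left (by linarith),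
        max_eq_left (by linarith), mul_zero]
    · rw [clamp_eq ⟨by linarith, by linarith⟩, clamp_eq ⟨h3, by linarith⟩]
  have key := ((hf.comp (τ := fun s => 2 * s) (J := Iic (1 / 2)) (by fun_prop)
    (fun _ _ => trivial)).congr e1).glue hc (g := fun _ => g) (IsContinuationOn.const fun s hs => ?_) ?_
  · refine ⟨_, key, ?_, ?_⟩
    · rw [segConcat_left (by norm_num)]; simpa using h0
    · norm_num
  · have hs : 1 / 2 ≤ s := hs
    have h2 : 1 / 2 ≤ clamp 0 1 s := le_max_of_le_right (le_min hs (by norm_num))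
    have h3 := (clamp_mem zero_le_one s).2
    simp only [segConcat_right h2]
    exact hg _ (lineMap_mem_of_starConvex hU hξ ⟨by linarith, by linarith⟩)
  · have h2 : clamp 0 1 (1 / 2) = 1 / 2 := clamp_eq (by norm_num)
    have h3 : (2 : ℝ) * (1 / 2) = 1 := by norm_num
    simp only [h2, Function.comp, segConcat_left le_rfl, h3]
    exact h1

theorem EndGerm.eventuallyEq (hγ : ContinuousOn γ (Icc 0 1)) (h : EndGerm φ γ g)
    (h' : EndGerm φ γ g') : g =ᶠ[𝓝 (γ 1)] g' := by
  obtain ⟨f, hf, h0, h1⟩ := h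
  obtain ⟨f', hf', h0', h1'⟩ := h'
  have := IsContinuationOn.eventuallyEq isPreconnected_univ (continuous_comp_clamp hγ).continuousOn hf hf'
    (mem_univ 0) (mem_univ 1) (by simpa only [clamp_zero_one_zero] using h0.trans h0'.symm)
  simp only [clamp_zero_one_one] at this
  exact (h1.symm.trans this).trans h1'

/-- The continuation along the paths of a homotopy with fixed end does not depend on the path. -/
theorem EndGerm.eventuallyEq_of_homotopy {H : ℝ → ℝ → ℂ}
    (hc : ContinuousOn (fun q : ℝ × ℝ => H q.1 q.2) (Icc 0 1 ×ˢ Icc 0 1))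
    (he₀ : ∀ t ∈ Icc (0 : ℝ) 1, H 0 t = H 0 0) (he : ∀ t ∈ Icc (0 : ℝ) 1, H 1 t = H 1 0)
    (hH : ∀ t ∈ Icc (0 : ℝ) 1, ∃ g, EndGerm φ (fun s => H s t) g)
    (h : EndGerm φ (fun s => H s 0) g) (h' : EndGerm φ (fun s => H s 1) g') :
    g =ᶠ[𝓝 (H 1 0)] g' := by
  have k01 := continuous_clamp 0 1
  have hcl : ∀ t, clamp 0 1 t ∈ Icc (0 : ℝ) 1 := clamp_mem zero_le_one
  choose! G hG using hH
  choose f hf h0 h1 using fun t => hG _ (hcl t)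
  have hcc : Continuous fun q : ℝ × ℝ => H (clamp 0 1 q.2) (clamp 0 1 q.1) :=
    hc.comp_continuous (f := fun q : ℝ × ℝ => (clamp 0 1 q.2, clamp 0 1 q.1)) (by fun_prop)
      fun q => ⟨hcl _, hcl _⟩
  have hloc : ∀ t, ∀ᶠ t' in 𝓝 t, f t' 1 =ᶠ[𝓝 (H 1 0)] f t 1 := by
    intro t
    have := IsContinuationOn.coherent (c := fun t s => H (clamp 0 1 s) (clamp 0 1 t)) hcc hf t
      (Eventually.of_forall fun t' => ?_) 1
    · have h2 : Tendsto (fun t' => (t', (1 : ℝ))) (𝓝 t) (𝓝 (t, 1)) :=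
        Continuous.tendsto (by fun_prop) t
      refine (h2.eventually this).mono fun t' h3 => ?_
      simpa only [clamp_zero_one_one, he _ (hcl t')] using h3
    · have e1 := h0 t'
      have e2 := h0 t
      simp only [clamp_zero_one_zero, he₀ _ (hcl _)] at e1 e2 ⊢
      exact e1.trans e2.symm
  have key := (isPreconnected_univ (α := ℝ)).induction₂
    (fun t t' => f t 1 =ᶠ[𝓝 (H 1 0)] f t' 1)
    (fun t _ => by rw [nhdsWithin_univ]; exact (hloc t).mono fun _ h => h.symm)
    (fun _ _ _ _ _ _ h h' => h.trans h') (fun _ _ _ _ h => h.symm) (mem_univ 0) (mem_univ 1)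
  have c0 : ∀ t ∈ Icc (0 : ℝ) 1, ContinuousOn (fun s => H s t) (Icc 0 1) := fun t ht =>
    hc.comp (f := fun s => (s, t)) (by fun_prop) fun s hs => ⟨hs, ht⟩
  have i0 : (0 : ℝ) ∈ Icc (0 : ℝ) 1 := by simp
  have i1 : (1 : ℝ) ∈ Icc (0 : ℝ) 1 := by simp
  have e0 := EndGerm.eventuallyEq (c0 0 i0) h (hG 0 i0)
  have e1 := EndGerm.eventuallyEq (c0 1 i1) h' (hG 1 i1)
  have d0 := h1 0
  have d1 := h1 1
  simp only [clamp_zero_one_zero, clamp_zero_one_one, he 1 i1] at e0 e1 d0 d1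
  exact (((e0.trans d0.symm).trans key).trans d1).trans e1.symm

variable {r : ℝ}

/-- The running length supplies the height. The path is frozen before `s₁`, at height `b`. -/
theorem PiecewiseC1.isCausal (h : PiecewiseC1 γ) {s₁ : ℝ} (hs₁ : s₁ ∈ Icc (0 : ℝ) 1) (b : ℝ)
    (a : ℂ) : IsCausal fun s =>
      (b + (runLength γ (clamp s₁ 1 s) - runLength γ s₁), γ (clamp s₁ 1 s) - a) := by
  have hcl : ∀ s, clamp s₁ 1 s ∈ Icc (0 : ℝ) 1 := fun s =>
    Icc_subset_Icc_left hs₁.1 (clamp_mem hs₁.2 s)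
  have c1 := continuous_clamp s₁ 1
  have c2 : Continuous fun s => runLength γ (clamp s₁ 1 s) :=
    h.continuousOn_runLength.comp_continuous c1 hcl
  have c3 : Continuous fun s => γ (clamp s₁ 1 s) := h.1.comp_continuous c1 hcl
  refine ⟨(continuous_const.add (c2.sub continuous_const)).prodMk (c3.sub continuous_const),
    fun s t hst => ?_, fun s hs => ?_, fun s hs => ?_⟩
  · have hle : clamp s₁ 1 s ≤ clamp s₁ 1 t := max_le_max_left _ (min_le_min_right _ hst)
    have := h.norm_sub_le (hcl s).1 hle (hcl t).2
    change ‖(γ _ - a) - (γ _ - a)‖ ≤ (b + _) - (b + _)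
    rw [sub_sub_sub_cancel_right]
    linarith
  · have e : ∀ s ≤ 0, clamp s₁ 1 s = s₁ := fun s hs =>
      max_eq_left ((min_le_left _ _).trans (hs.trans hs₁.1))
    simp only [e s hs, e 0 le_rfl]
  · simp only [clamp, min_eq_right hs, min_self]

/-- While the path rests at `ω` it is on the singular set, so the causal path is started at a time
`s₁` after departure with `γ` still in the initial disc, at height `‖γ s₁ - ω‖`. Up to `s₁` the
continuation is `φ`; the two parts are glued there. -/
theorem HasContinuation.exists_endGerm (h : HasContinuation Ω.singularSet r fun x => φ (ω + x))
    (hr : 0 < r) (hφ : AnalyticOnNhd ℂ φ (Metric.ball ω r)) (hγ : Allowed Ω γ) :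
    ∃ g, EndGerm φ γ g := by
  obtain ⟨L, hL, hγ0, hp, hlen, hd⟩ := hγ
  rcases hd with hd | ⟨t₀, ht₀, hd, hav⟩
  · exact ⟨φ, .of_analyticOnNhd hφ fun t ht => by rw [hd t ht]; exact Metric.mem_ball_self hr⟩
  have hcc := continuous_comp_clamp hp.1
  have hγt₀ : γ t₀ = ω := hd t₀ ⟨ht₀.1, le_rfl⟩
  obtain ⟨s₁, hs₁, hs₁'⟩ : ∃ s₁ ∈ Ioc t₀ 1, ∀ s ≤ s₁, γ (clamp 0 1 s) ∈ Metric.ball ω r := by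
    have h1 : ∀ᶠ s in 𝓝 t₀, γ (clamp 0 1 s) ∈ Metric.ball ω r :=
      hcc.continuousAt.eventually_mem (Metric.isOpen_ball.mem_nhds (by
        rw [clamp_eq ⟨ht₀.1, ht₀.2.le⟩, hγt₀]; exact Metric.mem_ball_self hr))
    obtain ⟨ε, hε, hball⟩ := Metric.eventually_nhds_iff_ball.1 h1
    have h2 := min_le_left (t₀ + ε / 2) 1
    refine ⟨min (t₀ + ε / 2) 1, ⟨lt_min (by linarith) ht₀.2, min_le_right _ _⟩, fun s hs => ?_⟩
    rcases le_total s t₀ with h3 | h3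
    · rw [hd _ ⟨(clamp_mem zero_le_one s).1, max_le ht₀.1 ((min_le_left _ _).trans h3)⟩]
      exact Metric.mem_ball_self hr
    · refine hball s ?_
      rw [Metric.mem_ball, Real.dist_eq, abs_of_nonneg (by linarith)]
      linarith
  have hs0 : s₁ ∈ Icc (0 : ℝ) 1 := ⟨ht₀.1.trans hs₁.1.le, hs₁.2⟩
  have e₁ : clamp s₁ 1 0 = s₁ := max_eq_left ((min_le_left _ _).trans hs0.1)
  have hγs₁ : ‖γ s₁ - ω‖ < r := by
    have := hs₁' s₁ le_rfl
    rwa [clamp_eq hs0, Metric.mem_ball, dist_eq_norm] at this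
  -- The straight distance is at most the running length at `s₁`, so all heights stay below `L`; a
  -- singular pair would put the path in `Ω_L`.
  have hav' : ∀ s, (‖γ s₁ - ω‖ + (runLength γ (clamp s₁ 1 s) - runLength γ s₁),
      γ (clamp s₁ 1 s) - ω) ∉ Ω.singularSet := fun s hs => by
    have hc := clamp_mem hs0.2 s
    have h1 := hp.norm_sub_le le_rfl hs0.1 hs0.2
    rw [hγ0, runLength_zero, sub_zero] at h1
    have h2 := hp.runLength_mono (a := clamp s₁ 1 s) (b := 1) ⟨hs0.1.trans hc.1, hc.2⟩ (by simp) hc.2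
    rw [runLength_one] at h2
    have h3 := hs.2 L (by simp only; linarith)
    simp only [add_sub_cancel] at h3
    exact (hav _ ⟨hs₁.1.trans_le hc.1, hc.2⟩).2 h3
  obtain ⟨f, hf, hf0⟩ := h _ (hp.isCausal hs0 ‖γ s₁ - ω‖ ω) hav' (by simp [InCone, e₁])
    (by simpa only [e₁, sub_self, add_zero] using hγs₁)
  replace hf := hf.shift (-ω)
  simp only [sub_neg_eq_add, sub_add_cancel] at hf
  simp only [e₁] at hf0
  have hsh : ContinuousAt (fun x => -ω + x) (γ s₁) := by fun_prop
  have hf1 : (fun x => f 0 (-ω + x)) =ᶠ[𝓝 (γ s₁)] φ := by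
    have h1 : Tendsto (fun x => -ω + x) (𝓝 (γ s₁)) (𝓝 (γ s₁ - ω)) := by
      rw [sub_eq_neg_add]; exact hsh
    filter_upwards [h1.eventually hf0] with x hx
    rw [hx, add_neg_cancel_left]
  have hle : ∀ s ≤ s₁, clamp s₁ 1 s = s₁ := fun s hs =>
    max_eq_left ((min_le_left _ _).trans hs)
  have hAn : AnalyticAt ℂ φ (γ s₁) := by
    have := hφ _ (hs₁' s₁ le_rfl)
    rwa [clamp_eq hs0] at this
  -- The continuation is normalized at time `0`, whereas gluing takes place at `s₁`; the causal path
  -- is constant in between, so uniqueness transports the germ.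
  have hf2 := IsContinuationOn.eventuallyEq (I := Iic s₁) (g := fun _ => φ)
    isPreconnected_Iic (by
      refine (continuousOn_const (c := γ s₁)).congr fun s hs => ?_
      simp only [hle s hs]) (hf.mono (subset_univ _))
    (IsContinuationOn.const fun s hs => by simp only [hle s hs]; exact hAn)
    (mem_Iic.2 hs0.1) (mem_Iic.2 le_rfl) (by simp only [e₁]; exact hf1)
  simp only [hle s₁ le_rfl] at hf2
  have heq : EqOn (fun s => γ (clamp s₁ 1 s)) (fun s => γ (clamp 0 1 s)) (Ici s₁) := by
    intro s hs
    have hs : s₁ ≤ s := hs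
    have h1 : s₁ ≤ min s 1 := le_min hs hs0.2
    simp only [clamp, max_eq_right h1, max_eq_right (hs0.1.trans h1)]
  have key := IsContinuationOn.glue hcc (f := fun _ => φ)
    (IsContinuationOn.const fun s hs => hφ _ (hs₁' s hs))
    ((hf.mono (subset_univ _)).congr heq) (by rw [clamp_eq hs0]; exact hf2.symm)
  exact ⟨_, _, key, by simp [hs0.1], EventuallyEq.rfl⟩

/-- A germ which can be continued along the causal paths which avoid the singular set can be
continued to the Riemann surface. -/
theorem HasContinuation.continuesTo (h : HasContinuation Ω.singularSet r fun x => φ (ω + x))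
    (hr : 0 < r) (hlev : Ω.level r = {ω}) (hφ : AnalyticOnNhd ℂ φ (Metric.ball ω r)) :
    ContinuesTo Ω φ := by
  have hN := isCentralNhd_ball hr hlev
  have hex : ∀ α : AllowedPath Ω, ∃ g, EndGerm φ α.1 g := fun α => h.exists_endGerm hr hφ α.2
  choose G hG using hex
  set Ψ : Surface Ω → ℂ := Quot.lift (fun α => G α (α.1 1)) (by
    rintro α β ⟨H, hH, h0, h1, hs, he⟩
    have i0 : (0 : ℝ) ∈ Icc (0 : ℝ) 1 := by simp
    have i1 : (1 : ℝ) ∈ Icc (0 : ℝ) 1 := by simp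
    have e1 : β.1 1 = α.1 1 := (h1 1 i1).symm.trans (he 1 i1)
    have := EndGerm.eventuallyEq_of_homotopy hH.1 (fun t ht => by rw [hs t ht, hs 0 i0])
      (fun t ht => by rw [he t ht, he 0 i0]) (fun t ht => h.exists_endGerm hr hφ (hH.2.2 t ht))
      ((hG α).congr fun s hs => (h0 s hs).symm) ((hG β).congr fun s hs => (h1 s hs).symm)
    rw [he 0 i0] at this
    have := this.eq_of_nhds
    change G α (α.1 1) = G β (β.1 1)
    rw [e1]; exact this) with hΨ
  have hval : ∀ (α : AllowedPath Ω) (g : ℂ → ℂ), EndGerm φ α.1 g → Ψ (cl α) = g (proj (cl α)) :=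
    fun α g hg => (EndGerm.eventuallyEq α.2.piecewiseC1.1 (hG α) hg).eq_of_nhds
  have hbase : ∀ᶠ z in 𝓝 (basePoint Ω), Ψ z = φ (proj z) := by
    have hW : IsOpen {q : Surface Ω | ∃ γ : AllowedPath Ω, q = cl γ ∧ ∃ ξ ∈ Metric.ball ω r,
        EqOn γ.1 (fun t => AffineMap.lineMap ω ξ t) (Icc 0 1)} :=
      TopologicalSpace.isOpen_generateFrom_of_mem
        (Or.inl ⟨r, _, hN.pos, hN.isOpen, hN.mem, hN.star, hN.subset, rfl⟩)
    filter_upwards [hW.mem_nhds ⟨constPath Ω, rfl, ω, hN.mem, fun t _ => by simp [constPath]⟩]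
    rintro _ ⟨γ, rfl, ξ, hξ, he⟩
    exact hval γ φ (.of_analyticOnNhd hφ fun t ht => by
      rw [he ht]; exact lineMap_mem_of_starConvex hN.star hξ ht)
  refine ⟨hφ _ hN.mem, Ψ, ?_, hbase⟩
  refine Quot.ind fun α => ?_
  change ∃ f, AnalyticAt ℂ f (proj (cl α)) ∧ ∀ᶠ w in 𝓝 (cl α), Ψ w = f (proj w)
  obtain ⟨L, hL, hA⟩ := α.2
  have hpr : proj (cl α) = α.1 1 := rfl
  rcases hA.2.2.2 with hd | ⟨t₀, ht₀, -, hav⟩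
  · have : cl α = basePoint Ω := (clOf_coe α).symm.trans (clOf_eq_basePoint hd)
    refine ⟨φ, ?_, this ▸ hbase⟩
    rw [hpr, hd 1 (by simp)]
    exact hφ _ hN.mem
  · have hg := hG α
    obtain ⟨ε, hε, hgε⟩ := exists_ball_of_analyticAt hg.analyticAt
    obtain ⟨ε', hε', hlε⟩ := Metric.mem_nhds_iff.1
      ((Ω.finite_level L hL).isClosed.isOpen_compl.mem_nhds (hav 1 ⟨ht₀.2, le_rfl⟩).2)
    have hlt := hA.2.2.1
    set L₂ := (L - pathLength α.1) / 2 with hL₂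
    set d := min ε (min ε' L₂) with hd
    have hd0 : 0 < d := lt_min hε (lt_min hε' (by linarith))
    have hm := Metric.mem_ball_self (x := α.1 1) hd0
    have hstar := (convex_ball (α.1 1) d).starConvex hm
    have hW : IsOpen {q : Surface Ω | ∃ γ : AllowedPath Ω, q = cl γ ∧ ∃ ξ ∈ Metric.ball (α.1 1) d,
        EqOn γ.1 (concat α.1 fun t => AffineMap.lineMap (α.1 1) ξ t) (Icc 0 1)} :=
      TopologicalSpace.isOpen_generateFrom_of_mem (Or.inr ⟨α, L, L₂, _, hA, by linarith,
        by linarith, Metric.isOpen_ball, hm, hstar, fun x hx =>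
        ⟨Metric.ball_subset_ball ((min_le_right _ _).trans (min_le_right _ _)) hx,
          hlε (Metric.ball_subset_ball ((min_le_right _ _).trans (min_le_left _ _)) hx)⟩, rfl⟩)
    refine ⟨G α, hg.analyticAt, ?_⟩
    -- The generating set consists of classes of products with segments; it contains `cl α` because
    -- `α` is homotopic to its product with a constant path.
    have hself := α.2.clOf_segConcat_self
    filter_upwards [hW.mem_nhds ⟨⟨_, hself.1⟩,
      (clOf_coe α).symm.trans (hself.2.symm.trans (clOf_eq hself.1)), α.1 1, hm, fun _ _ => rfl⟩]
    rintro _ ⟨γ, rfl, ξ, hξ, he⟩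
    exact hval γ _ ((hg.segConcat α.2.piecewiseC1 hstar
      (hgε.mono (Metric.ball_subset_ball (min_le_left _ _))) hξ).congr he.symm)

end endGerm

section convPow

/-! ### Convolution powers -/

variable {ω : ℂ} {Ω : DiscreteFilteredSet ω}

theorem DiscreteFilteredSet.iterFineSum_level_subset (n : ℕ) (L : ℝ) :
    (Ω.iterFineSum n).level L ⊆ Ω.saturated.level L :=
  subset_iUnion (fun n => (Ω.iterFineSum n).level L) n

/-- One radius serves for all powers: below level `r` the saturated set, hence each iterated fine
sum, reduces to the centre. The power `n + 1` goes with `iterFineSum n`, the sum of `n + 1` copies.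
-/
theorem hasContinuation_convPow {r : ℝ} {φ : ℂ → ℂ}
    (hlev : ∀ L, 0 < L → L < r → Ω.saturated.level L = {ω})
    (hφ : AnalyticOnNhd ℂ (fun x => φ (ω + x)) (Metric.ball 0 r))
    (h : HasContinuation Ω.singularSet r fun x => φ (ω + x)) (n : ℕ) :
    AnalyticOnNhd ℂ (fun x => convPow ω φ (n + 1) (ω + x)) (Metric.ball 0 r) ∧
    HasContinuation (Ω.iterFineSum n).singularSet r fun x => convPow ω φ (n + 1) (ω + x) := by
  have hsm : ∀ n, ∀ a ∈ (Ω.iterFineSum n).singularSet, a.1 < r → a.2 = 0 := fun n a ha =>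
    DiscreteFilteredSet.singularSet_small hlev a
      (DiscreteFilteredSet.singularSet_mono (DiscreteFilteredSet.iterFineSum_level_subset n) ha)
  induction n with
  | zero => exact ⟨hφ, h⟩
  | succ n ih =>
    have e : (fun x => convPow ω φ (n + 1 + 1) (ω + x)) =
        conv₀ (fun x => convPow ω φ (n + 1) (ω + x)) fun x => φ (ω + x) :=
      funext fun x => conv_add_center ω _ _ x
    rw [e]
    exact ⟨analyticOnNhd_conv₀ ih.1 hφ, ih.2.conv₀ ih.1 hφ h (DiscreteFilteredSet.isClosed_singularSet _)
      Ω.isClosed_singularSet (DiscreteFilteredSet.isClosed_singularSet _)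
      DiscreteFilteredSet.zero_mem_singularSet DiscreteFilteredSet.zero_mem_singularSet
      (fun _ => DiscreteFilteredSet.mk_zero_mem_singularSet) (hsm n) (hsm 0)
      DiscreteFilteredSet.add_mem_singularSet⟩

theorem ContinuesTo.convPow {φ : ℂ → ℂ} (h : ContinuesTo Ω φ) (n : ℕ) :
    ContinuesTo Ω.saturated (convPow ω φ (n + 1)) := by
  obtain ⟨r, hr, hφ, hc⟩ := h.hasContinuation
  obtain ⟨δ, hδ, hlev⟩ := Ω.saturated.level_small
  set r' := min r (δ / 2) with hr'
  have hr0 : 0 < r' := lt_min hr (by linarith)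
  have hrδ : r' < δ := (min_le_right _ _).trans_lt (by linarith)
  have key := hasContinuation_convPow (fun L h0 h1 => hlev L h0 (h1.trans hrδ))
    (hφ.mono (Metric.ball_subset_ball (min_le_left _ _))) (hc.mono Subset.rfl (min_le_left _ _)) n
  refine (key.2.mono (DiscreteFilteredSet.singularSet_mono
    (DiscreteFilteredSet.iterFineSum_level_subset n)) le_rfl).continuesTo hr0
    (hlev _ hr0 hrδ) fun x hx => ?_
  have h1 := key.1 (x - ω) (by rwa [mem_ball_zero_iff, ← dist_eq_norm])
  have h2 : AnalyticAt ℂ (fun y => y - ω) x := by fun_prop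
  have h3 := AnalyticAt.fun_comp (f := fun y => y - ω) h1 h2
  simpa only [add_sub_cancel] using h3

end convPow

end Resurgence

end

theorem mainTheorem2 (ω : ℂ) (Ω : Resurgence.DiscreteFilteredSet ω) (φ : ℂ → ℂ)
    (hφ : Resurgence.ContinuesTo Ω φ) (n : ℕ) (hn : 1 ≤ n) :
    Resurgence.ContinuesTo Ω.saturated (Resurgence.convPow ω φ n) := by
  obtain ⟨n, rfl⟩ := Nat.exists_eq_add_of_le' hn
  exact hφ.convPow n
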